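/- **Setting.** Let $T>0$, let $W$ be a standard $d$-dimensional Brownian motion on a probability space, with its natural filtration augmented by null sets. Let $r_t\in\mathbb R$, $\mu_t\in\mathbb R^d$, $\sigma_t\in\mathbb R^{d\times d}$ ($t\ge 0$) be deterministic càdlàg functions with $\sigma_t$ non-singular for almost every $t\ge0$, and put $\theta_t=\sigma_t^{-1}(\mu_t-r_t\mathbf 1)$, $R_t=\int_0^t r_u\,du$, $\|f\|_t=(\int_0^t|f_u|^2du)^{1/2}$; assume $\|\theta\|_T<\infty$. Let $\mathcal U$ be the set of pairs $(y,v)$ of deterministic functions on $[0,T]$ with $y$ $\mathbb R^d$-valued, $\|y\|_T<\infty$, $v\ge 0$, $\int_0^Tv_t\,dt<\infty$. For an initial endowment $x>0$ and $\varsigma=(y,v)\in\mathcal U$ the wealth process $X^\varsigma$ on $[0,T]$ is the positive continuous adapted solution, bounded in $L^2$, of $$dX_t=X_t\,(r_t-v_t+y_t'\theta_t)\,dt+X_t\,y_t'\,dW_t,\qquad X_0=x$$ ($y_t=\sigma_t'\pi_t$, where $\pi_t$ are the fractions of wealth invested in the $d$ stocks, and consumption is $c_t=v_tX_t$). Put $$J(x,\varsigma)=\mathbf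 E\Big(\int_0^T v_tX^\varsigma_t\,dt+X^\varsigma_T\Big)\in[0,\infty].$$ For $0<\alpha<1/2$ let $\lambda_t=\inf\{\lambda\ge0:\mathbf P(X_t^\varsigma\le\lambda)\ge\alpha\}$ and $\mathrm{ES}_t(x,\varsigma,\alpha)=xe^{R_t}-\mathbf E(X^\varsigma_t\mid X^\varsigma_t\le\lambda_t)$, and let $\zeta_t(x)=\zeta xe^{R_t}$ for $0<\zeta<1$. Consider the problem of maximizing $J(x,\varsigma)$ over $\varsigma\in\mathcal U$ subject to $$\sup_{0\le t\le T}\frac{\mathrm{ES}_t(x,\varsigma,\alpha)}{\zeta_t(x)}\le1 .$$ Let $z_\alpha$ be the $\alpha$-quantile of the standard normal distribution, $F_\alpha(z)=\int_z^\infty e^{-t^2/2}dt\big/\int_{|z_\alpha|}^\infty e^{-t^2/2}dt$, and $$\psi(\rho,u)=\|\theta\|_T\,\rho\,u^2+\ln F_\alpha(|z_\alpha|+\rho u),\qquad \rho^*_{\mathrm{ES}}=\sup\{\rho>0:\psi(\rho,1)\ge\ln(1-\zeta)\}\quad(\sup\emptyset=\infty).$$ **Theorem.** Assume $r_t\ge0$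 for all $t\in[0,T]$, $0<\zeta<1$, $0<\alpha<1/2$ and $|z_\alpha|\ge2\|\theta\|_T$. Every $\varsigma\in\mathcal U$ has a wealth process. Moreover $0<\rho^*_{\mathrm{ES}}<\infty$, $\rho^*_{\mathrm{ES}}$ is the unique solution $\rho\ge 0$ of $\psi(\rho,1)=\ln(1-\zeta)$, and: (a) If $\|\theta\|_T>0$, the problem is solved by $\varsigma^*=(y^*,v^*)$, $$y_t^*=\rho^*_{\mathrm{ES}}\frac{\theta_t}{\|\theta\|_T}\quad\Big(\text{equivalently }\ \pi^*_t=\rho^*_{\mathrm{ES}}\frac{(\sigma_t\sigma_t')^{-1}}{\|\theta\|_T}(\mu_t-r_t\mathbf 1)\ \text{ for a.e. }t\Big),\qquad v_t^*=0,$$ and this optimal control is unique up to equality for almost every $t\in[0,T]$. The optimal value is $J(x,\varsigma^*)=x\,e^{\rho^*_{\mathrm{ES}}\|\theta\|_T+R_T}$. (b) If $\|\theta\|_T=0$, then for every deterministic $y^*$ with $\|y^*\|_T\le\rho^*_{\mathrm{ES}}$ the control $(y^*,0)$ solves the problem, and the optimal value is $x\,e^{R_T}$. -/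

import Mathlib

open MeasureTheory ProbabilityTheory Filter Set
open scoped NNReal ENNReal Topology

noncomputable section

namespace ESProblem

/-! ### The market -/

/-- `f` restricted to `[0,∞)` is right continuous with left limits. -/
def IsCadlag {E : Type*} [TopologicalSpace E] (f : ℝ → E) : Prop :=
  (∀ t, 0 ≤ t → ContinuousWithinAt f (Ici t) t) ∧
    ∀ t, 0 < t → ∃ l, Tendsto f (𝓝[<] t) (𝓝 l)

/-- Deterministic coefficients of a Black-Scholes market with one bond and `d` stocks: the riskless
rate `r`, the appreciation rates `μ` and the volatility matrix `σ`. Only times `t ≥ 0` matter. -/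
structure Market (d : ℕ) where
  r : ℝ → ℝ
  μ : ℝ → Fin d → ℝ
  σ : ℝ → Matrix (Fin d) (Fin d) ℝ
  cadlag_r : IsCadlag r
  cadlag_μ : IsCadlag μ
  cadlag_σ : IsCadlag σ
  nonsingular : ∀ᵐ t ∂(volume.restrict (Ici (0 : ℝ))), IsUnit (σ t).det

/-- The excess rate of return `μ_t - r_t 𝟏`. -/
def Market.excess {d : ℕ} (M : Market d) (t : ℝ) : Fin d → ℝ := fun i => M.μ t i - M.r t

/-- `θ_t = σ_t⁻¹ (μ_t - r_t 𝟏)`. -/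
def Market.θ {d : ℕ} (M : Market d) (t : ℝ) : EuclideanSpace ℝ (Fin d) :=
  WithLp.toLp 2 ((M.σ t)⁻¹.mulVec (M.excess t))

/-- `R_t = ∫_0^t r_u du`. -/
def Market.R {d : ℕ} (M : Market d) (t : ℝ) : ℝ := ∫ u in (0 : ℝ)..t, M.r u

/-- `‖f‖_T = (∫_0^T |f_t|² dt)^{1/2}` (Euclidean norm inside). -/
def normL2 {d : ℕ} (T : ℝ) (f : ℝ → EuclideanSpace ℝ (Fin d)) : ℝ :=
  Real.sqrt (∫ t in (0 : ℝ)..T, ‖f t‖ ^ 2)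

/-- `f` is measurable and square integrable over `[0,T]`. -/
def SqIntegrable {d : ℕ} (T : ℝ) (f : ℝ → EuclideanSpace ℝ (Fin d)) : Prop :=
  MemLp f 2 (volume.restrict (Icc 0 T))

/-! ### Brownian motion and its filtration -/

section Brownian

variable {Ω : Type*} [MeasurableSpace Ω] {d : ℕ}

/-- `W = (W_1, …, W_d)` is a standard `d`-dimensional Brownian motion: the components are
independent standard real Brownian motions. -/
structure IsStdBrownian (W : Fin d → ℝ≥0 → Ω → ℝ) (P : Measure Ω) : Prop where
  measurable : ∀ j t, Measurable (W j t)
  brownian : ∀ j, IsBrownianReal (W j) P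
  indep : iIndepFun (fun j ω t => W j t ω) P

/-- The vector `W_t` (for a real time `t ≥ 0`). -/
def vecW (W : Fin d → ℝ≥0 → Ω → ℝ) (t : ℝ) (ω : Ω) : EuclideanSpace ℝ (Fin d) :=
  WithLp.toLp 2 (fun j => W j t.toNNReal ω)

/-- The filtration generated by `W`, augmented by the `P`-null sets. -/
@[reducible]
def filtW (W : Fin d → ℝ≥0 → Ω → ℝ) (P : Measure Ω) (t : ℝ) : MeasurableSpace Ω :=
  (⨆ s ∈ Icc 0 t, MeasurableSpace.comap (vecW W s) inferInstance) ⊔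
    MeasurableSpace.generateFrom {A | MeasurableSet A ∧ P A = 0}

/-! ### The Itô integral of square integrable integrands -/

/-- A simple process `∑_{i<n} ξ_i 1_{(t_i, t_{i+1}]}` with `0 ≤ t_0 ≤ t_1 ≤ …` deterministic and
`ξ_i` bounded and `F_{t_i}`-measurable. -/
structure SimpleProcess (W : Fin d → ℝ≥0 → Ω → ℝ) (P : Measure Ω) where
  n : ℕ
  t : ℕ → ℝ
  ξ : ℕ → Ω → EuclideanSpace ℝ (Fin d)
  mono : Monotone t
  nonneg : 0 ≤ t 0
  adapted : ∀ i, Measurable[filtW W P (t i)] (ξ i)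
  bounded : ∃ C : ℝ, ∀ i ω, ‖ξ i ω‖ ≤ C

/-- The value of a simple process. -/
def SimpleProcess.eval {W : Fin d → ℝ≥0 → Ω → ℝ} {P : Measure Ω} (G : SimpleProcess W P)
    (s : ℝ) (ω : Ω) : EuclideanSpace ℝ (Fin d) :=
  ∑ i ∈ Finset.range G.n, (Ioc (G.t i) (G.t (i + 1))).indicator (fun _ => G.ξ i ω) s

/-- `∫_0^s G_u' dW_u = ∑_i ξ_i' (W_{t_{i+1} ∧ s} - W_{t_i ∧ s})` for a simple process. -/
def SimpleProcess.integral {W : Fin d → ℝ≥0 → Ω → ℝ} {P : Measure Ω} (G : SimpleProcess W P)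
    (s : ℝ) (ω : Ω) : ℝ :=
  ∑ i ∈ Finset.range G.n,
    inner ℝ (G.ξ i ω) (vecW W (min (G.t (i + 1)) s) ω - vecW W (min (G.t i) s) ω)

/-- `I_t = ∫_0^t H_s' dW_s` for `0 ≤ t ≤ T`, in Itô's `L²` sense: simple processes
approximate `H` in `L²([0,T] × Ω)` and their integrals converge to `I_t` in `L²(Ω)`. -/
def IsItoIntegral (W : Fin d → ℝ≥0 → Ω → ℝ) (P : Measure Ω) (T : ℝ)
    (H : ℝ → Ω → EuclideanSpace ℝ (Fin d)) (I : ℝ → Ω → ℝ) : Prop :=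
  ∃ G : ℕ → SimpleProcess W P,
    Tendsto (fun n => eLpNorm (fun p : ℝ × Ω => (G n).eval p.1 p.2 - H p.1 p.2) 2
      ((volume.restrict (Icc 0 T)).prod P)) atTop (𝓝 0) ∧
    ∀ t ∈ Icc 0 T,
      Tendsto (fun n => eLpNorm (fun ω => (G n).integral t ω - I t ω) 2 P) atTop (𝓝 0)

end Brownian

/-! ### Controls, wealth, cost and risk -/

/-- A deterministic control: `y` is the vector `σ' π` of volatility-weighted portfolio fractions,
`v` is the consumption rate, so that consumption is `c_t = v_t X_t`. -/
structure Control (d : ℕ) where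
  y : ℝ → EuclideanSpace ℝ (Fin d)
  v : ℝ → ℝ

/-- The class `U` of controls. -/
structure Control.IsAdmissible {d : ℕ} (T : ℝ) (c : Control d) : Prop where
  sq_integrable : SqIntegrable T c.y
  integrable : IntegrableOn c.v (Icc 0 T)
  nonneg : ∀ t ∈ Icc 0 T, 0 ≤ c.v t

section Wealth

variable {Ω : Type*} [MeasurableSpace Ω] {d : ℕ}

/-- `X` is the wealth process on `[0,T]` of the control `c` with initial endowment `x`: the
a.s. positive, continuous, adapted strong solution, bounded in `L²`, of
`dX_t = X_t (r_t - v_t + y_t' θ_t) dt + X_t y_t' dW_t`, `X_0 = x`. -/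
structure IsWealth (W : Fin d → ℝ≥0 → Ω → ℝ) (P : Measure Ω) (M : Market d) (T x : ℝ)
    (c : Control d) (X : ℝ → Ω → ℝ) : Prop where
  adapted : ∀ t ∈ Icc 0 T, Measurable[filtW W P t] (X t)
  continuous : ∀ᵐ ω ∂P, ContinuousOn (fun t => X t ω) (Icc 0 T)
  pos : ∀ᵐ ω ∂P, ∀ t ∈ Icc 0 T, 0 < X t ω
  bounded : ∃ C : ℝ≥0, ∀ t ∈ Icc 0 T, eLpNorm (X t) 2 P ≤ C
  equation : ∃ I : ℝ → Ω → ℝ, IsItoIntegral W P T (fun s ω => X s ω • c.y s) I ∧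
    ∀ t ∈ Icc 0 T, ∀ᵐ ω ∂P,
      X t ω = x + (∫ s in (0 : ℝ)..t, X s ω * (M.r s - c.v s + inner ℝ (c.y s) (M.θ s))) + I t ω

/-- The cost function `E(∫_0^T c_t^{γ₁} dt + X_T^{γ₂})` with `c_t = v_t X_t`, as an element of
`[0,∞]`. -/
def cost (P : Measure Ω) (T γ₁ γ₂ : ℝ) (c : Control d) (X : ℝ → Ω → ℝ) : ℝ≥0∞ :=
  ∫⁻ ω, ((∫⁻ t in Icc 0 T, ENNReal.ofReal (c.v t * X t ω) ^ γ₁) +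
    ENNReal.ofReal (X T ω) ^ γ₂) ∂P

/-- The `α`-quantile `inf {l ≥ 0 : P(Z ≤ l) ≥ α}` of a nonnegative random variable. -/
def quantile (P : Measure Ω) (α : ℝ) (Z : Ω → ℝ) : ℝ :=
  sInf {l : ℝ | 0 ≤ l ∧ ENNReal.ofReal α ≤ P {ω | Z ω ≤ l}}

/-- `E(Z | Z ≤ λ)`, where `λ` is the `α`-quantile of `Z`. -/
def tailMean (P : Measure Ω) (α : ℝ) (Z : Ω → ℝ) : ℝ :=
  ∫ ω, Z ω ∂(ProbabilityTheory.cond P {ω | Z ω ≤ quantile P α Z})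

/-- The Expected Shortfall at time `t` relative to the pure bond investment. -/
def ES (P : Measure Ω) (M : Market d) (x α : ℝ) (X : ℝ → Ω → ℝ) (t : ℝ) : ℝ :=
  x * Real.exp (M.R t) - tailMean P α (X t)

/-- The level risk function `ζ x e^{R_t}`. -/
def level (M : Market d) (x ζ t : ℝ) : ℝ := ζ * x * Real.exp (M.R t)

/-- The uniform risk bound `sup_{0 ≤ t ≤ T} ES_t / ζ_t(x) ≤ 1`. -/
def SatisfiesES (P : Measure Ω) (M : Market d) (T x α ζ : ℝ) (X : ℝ → Ω → ℝ) : Prop :=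
  ∀ t ∈ Icc 0 T, ES P M x α X t / level M x ζ t ≤ 1

/-- The control `c` solves the problem of maximizing the cost function (with exponents `γ₁`, `γ₂`)
over all admissible controls subject to the uniform Expected Shortfall bound. -/
structure IsOptimal (W : Fin d → ℝ≥0 → Ω → ℝ) (P : Measure Ω) (M : Market d)
    (T x α ζ γ₁ γ₂ : ℝ) (c : Control d) : Prop where
  admissible : c.IsAdmissible T
  exists_wealth : ∃ X, IsWealth W P M T x c X
  feasible : ∀ X, IsWealth W P M T x c X → SatisfiesES P M T x α ζ X
  optimal : ∀ X, IsWealth W P M T x c X →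
    ∀ c' : Control d, c'.IsAdmissible T → ∀ X', IsWealth W P M T x c' X' →
      SatisfiesES P M T x α ζ X' → cost P T γ₁ γ₂ c' X' ≤ cost P T γ₁ γ₂ c X

end Wealth

/-! ### The critical value -/

/-- The `α`-quantile of the standard normal distribution. -/
def zq (α : ℝ) : ℝ := sInf {z : ℝ | α ≤ cdf (gaussianReal 0 1) z}

/-- `F_α(z) = ∫_z^∞ e^{-t²/2} dt / ∫_{|z_α|}^∞ e^{-t²/2} dt`. -/
def Fα (α z : ℝ) : ℝ :=
  (∫ t in Ioi z, Real.exp (-t ^ 2 / 2)) / ∫ t in Ioi |zq α|, Real.exp (-t ^ 2 / 2)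

/-- `ψ(ρ,u) = ‖θ‖_T ρ u² + ln F_α(|z_α| + ρ u)`. -/
def psi {d : ℕ} (M : Market d) (T α ρ u : ℝ) : ℝ :=
  normL2 T M.θ * ρ * u ^ 2 + Real.log (Fα α (|zq α| + ρ * u))

open Classical in
/-- `ρ*_ES = sup {ρ > 0 : ψ(ρ,1) ≥ ln(1-ζ)}`, with the convention `sup ∅ = ∞`. -/
def rhoES {d : ℕ} (M : Market d) (T α ζ : ℝ) : EReal :=
  if {ρ : ℝ | 0 < ρ ∧ Real.log (1 - ζ) ≤ psi M T α ρ 1}.Nonempty then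
    sSup ((fun ρ : ℝ => (ρ : EReal)) '' {ρ : ℝ | 0 < ρ ∧ Real.log (1 - ζ) ≤ psi M T α ρ 1})
  else ⊤

/-- The control `y_t = ρ θ_t / ‖θ‖_T`, `v_t = 0`. -/
def starControl {d : ℕ} (M : Market d) (T ρ : ℝ) : Control d where
  y := fun t => (ρ / normL2 T M.θ) • M.θ t
  v := fun _ => 0

end ESProblem

end

open ESProblem

/-! Controls are deterministic, so wealth is explicit: `X_t = m_t E_t`, where `m_t = x exp(R_t -
∫_0^t v + ∫_0^t y'θ)` is the mean and `E_t = exp(∫_0^t y'dW - ‖y‖_t²/2)` is a stochastic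
exponential. Each `X_t` is log-normal and the problem becomes one about real functions. The cost is
`∫ v m + m_T` (`IsWealth.cost_eq`), and the lower tail mean of `X_t` is `m_t F_α(|z_α| + ‖y‖_t)`.
After taking logarithms the risk bound reads `ln(1-ζ) ≤ -∫_0^t v + ∫_0^t y'θ + ln F_α(|z_α| +
‖y‖_t)` (`IsWealth.satisfiesES_iff`).

Optimization. By Cauchy-Schwarz the risk bound at `t` implies `ψ(‖y‖_t, 1) ≥ ln(1-ζ)`. The Gaussian
tail satisfies `gaussTail (a+δ) < exp(-aδ) gaussTail a`, which together with the condition on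
`|z_α|` makes `ψ(·,1)` strictly decreasing, so `‖y‖_t ≤ ρ*`. Since `r ≥ 0`, this gives `m_t ≤ B
exp(-∫_0^t v)` with `B = x exp(ρ*‖θ‖_T + R_T)`. As `v exp(-∫v)` is minus the derivative of
`exp(-∫v)`, the cost is at most `B`. When `‖θ‖_T > 0`, attaining `B` forces equality in
Cauchy-Schwarz, hence `y` parallel to `θ` with norm `ρ*`, and then the bound at `T` leaves no room
for consumption. The candidate is feasible at every `t` because `ψ(ρ,1) ≤ ψ(ρ,u)` for `u =
‖θ‖_t/‖θ‖_T` (`psi_one_le`); here the factor 2 in `|z_α| ≥ 2‖θ‖_T` is essential.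

The probabilistic work is to derive the explicit formula from the `L²` definition of the Itô
integral (`exists_wealth`, `IsWealth.ae_eq`). Wiener integrals come from the isometry sending
`1_(0,t] e_j` to `W_j(t)`; their independence of the past is read off from characteristic functions.
Itô's formula is replaced by duality: with `a` the drift rate, the residual `X_t - x - ∫_0^t X_s a_s
ds` is paired with suitable variables `U`, and the product rule is applied to the real function `E[U
X_s]`. All pairings agree with those prescribed by Itô's isometry, so the residual is exactly as far
from the integral of a simple process `G` as `G` is from `X y`. Density of simple processes then
yields existence. For an arbitrary wealth process the same identity bounds its distance to the
explicit one, and Gronwall's inequality yields uniqueness. -/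

noncomputable section

namespace ESProblem

/-! ### Isonormal extension of Brownian motion -/

section Wiener

set_option linter.unusedSectionVars false

variable {Ω : Type*} [MeasurableSpace Ω] {P : Measure Ω} [IsProbabilityMeasure P] {d : ℕ}
  {W : Fin d → ℝ≥0 → Ω → ℝ}

/-- Lebesgue measure on the half line of positive times. -/
abbrev posVol : Measure ℝ := volume.restrict (Ioi 0)

/-- The Hilbert space of square integrable vector functions on the half line. -/
abbrev TimeL2 (d : ℕ) := Lp (EuclideanSpace ℝ (Fin d)) 2 posVol

lemma posVol_Ioc_ne_top (a b : ℝ) : posVol (Ioc a b) ≠ ∞ :=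
  ((Measure.restrict_apply_le _ _).trans_lt measure_Ioc_lt_top).ne

lemma posVol_real_Ioc {a b : ℝ} (ha : 0 ≤ a) : posVol.real (Ioc a b) = max (b - a) 0 := by
  rw [measureReal_restrict_apply measurableSet_Ioc, inter_eq_left.2, Real.volume_real_Ioc]
  exact fun x hx => ha.trans_lt hx.1

lemma IsStdBrownian.isPre (hW : IsStdBrownian W P) (j : Fin d) : IsPreBrownianReal (W j) P :=
  (hW.brownian j).toIsPreBrownianReal

lemma IsStdBrownian.isGaussianProcess_component (hW : IsStdBrownian W P) (j : Fin d) :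
    IsGaussianProcess (W j) P :=
  IsPreBrownianReal.isGaussianProcess (hW.isPre j)

lemma IsStdBrownian.memLp (hW : IsStdBrownian W P) (j : Fin d) (t : ℝ≥0) :
    MemLp (W j t) 2 P :=
  ((hW.isGaussianProcess_component j).hasGaussianLaw_eval t).memLp_two

lemma IsStdBrownian.covariance (hW : IsStdBrownian W P) (i j : Fin d) (s t : ℝ≥0) :
    cov[W i s, W j t; P] = if i = j then (min s t : ℝ) else 0 := by
  split_ifs with h
  · subst h; simpa using (hW.isPre i).covariance_eval s t
  · have := (hW.indep.indepFun h).comp (measurable_pi_apply s) (measurable_pi_apply t)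
    exact IndepFun.covariance_eq_zero this (hW.memLp i s) (hW.memLp j t)

/-- Independence merges the Gaussian laws of the components, each taken at all times occurring in
`I`, into one Gaussian vector, and the required family is a linear image of it. -/
lemma IsStdBrownian.isGaussianProcess (hW : IsStdBrownian W P) :
    IsGaussianProcess (fun p : Fin d × ℝ≥0 => W p.1 p.2) P where
  hasGaussianLaw I := by
    classical
    let J : Finset ℝ≥0 := I.image Prod.snd
    have h1 : ∀ j, HasGaussianLaw (fun ω => J.restrict (fun t => W j t ω)) P := fun j =>
      (hW.isGaussianProcess_component j).hasGaussianLaw J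
    have h2 : iIndepFun (fun j ω => J.restrict (fun t => W j t ω)) P :=
      hW.indep.comp (fun _ x => J.restrict x) (fun _ => by fun_prop)
    have h3 := h2.hasGaussianLaw h1
    let L : (Fin d → J → ℝ) →L[ℝ] (I → ℝ) :=
      { toFun x p := x p.1.1 ⟨p.1.2, Finset.mem_image_of_mem _ p.2⟩
        map_add' x y := by ext; simp
        map_smul' c x := by ext; simp }
    exact h3.map L

/-- The function `1_(0,t] e_j` as an element of `L²`. -/
def stepVec (p : Fin d × ℝ≥0) : TimeL2 d :=
  indicatorConstLp 2 (measurableSet_Ioc : MeasurableSet (Ioc 0 (p.2 : ℝ)))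
    (posVol_Ioc_ne_top _ _) (EuclideanSpace.single p.1 1)

/-- The random variable `W_j(t)` as an element of `L²`. -/
def brownVec (hW : IsStdBrownian W P) (p : Fin d × ℝ≥0) : Lp ℝ 2 P := (hW.memLp p.1 p.2).toLp

/-- Formal step functions, as combinations of the functions `1_(0,t] e_j`. -/
abbrev FormalStep (d : ℕ) := (Fin d × ℝ≥0) →₀ ℝ

/-- The `L²` function of a formal step function. -/
def stepMap (d : ℕ) : FormalStep d →ₗ[ℝ] TimeL2 d := Finsupp.linearCombination ℝ stepVec

/-- The stochastic integral of a formal step function. -/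
def brownMap (hW : IsStdBrownian W P) : FormalStep d →ₗ[ℝ] Lp ℝ 2 P :=
  Finsupp.linearCombination ℝ (brownVec hW)

lemma inner_stepVec (p q : Fin d × ℝ≥0) :
    inner ℝ (stepVec p) (stepVec q) = if p.1 = q.1 then (min p.2 q.2 : ℝ) else 0 := by
  rw [stepVec, stepVec, L2.inner_indicatorConstLp_indicatorConstLp measurableSet_Ioc measurableSet_Ioc
    (posVol_Ioc_ne_top _ _) (posVol_Ioc_ne_top _ _), Ioc_inter_Ioc,
    posVol_real_Ioc (by simp)]
  simp [EuclideanSpace.inner_single_left]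

lemma inner_brownVec (hW : IsStdBrownian W P) (p q : Fin d × ℝ≥0) :
    inner ℝ (brownVec hW p) (brownVec hW q) = if p.1 = q.1 then (min p.2 q.2 : ℝ) else 0 := by
  rw [← hW.covariance, L2.inner_def, covariance_eq_sub (hW.memLp _ _) (hW.memLp _ _),
    (hW.isPre _).integral_eval, zero_mul, sub_zero]
  refine integral_congr_ae ?_
  filter_upwards [(hW.memLp p.1 p.2).coeFn_toLp, (hW.memLp q.1 q.2).coeFn_toLp] with ω h1 h2
  simp only [brownVec, h1, h2, Pi.mul_apply]
  simp [mul_comm]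

/-- Both generating families have the same Gram matrix, by `inner_stepVec` and `inner_brownVec`.
Working with formal combinations avoids checking that the map is well defined on functions. -/
lemma norm_brownMap (hW : IsStdBrownian W P) (v : FormalStep d) :
    ‖brownMap hW v‖ = ‖stepMap d v‖ := by
  have : inner ℝ (brownMap hW v) (brownMap hW v) = inner ℝ (stepMap d v) (stepMap d v) := by
    simp only [brownMap, stepMap, Finsupp.linearCombination_apply, Finsupp.sum, sum_inner,
      inner_sum, inner_smul_left, inner_smul_right, inner_brownVec, inner_stepVec]
  rw [real_inner_self_eq_norm_sq, real_inner_self_eq_norm_sq] at this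
  exact (sq_eq_sq₀ (norm_nonneg _) (norm_nonneg _)).1 this

lemma ae_eq_zero_of_forall_intervalIntegral {F : Type*} [NormedAddCommGroup F] [NormedSpace ℝ F]
    [CompleteSpace F] {f : ℝ → F} (hf : LocallyIntegrable f)
    (h : ∀ b, ∫ x in (0 : ℝ)..b, f x = 0) : f =ᵐ[volume] 0 := by
  filter_upwards [_root_.LocallyIntegrable.ae_hasDerivAt_integral hf] with x hx
  have h1 := hx 0
  simp only [h] at h1
  exact h1.unique (hasDerivAt_const x 0)

lemma TimeL2.locallyIntegrable (g : TimeL2 d) :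
    LocallyIntegrable ((Ioi (0 : ℝ)).indicator g) := by
  refine (locallyIntegrable_iff).2 fun K hK => ?_
  have h1 : MemLp ((Ioi (0 : ℝ)).indicator g) 2 volume :=
    (memLp_indicator_iff_restrict measurableSet_Ioi).2 (Lp.memLp g)
  have h2 := h1.restrict K
  have : IsFiniteMeasure (volume.restrict K) := ⟨by simpa using hK.measure_lt_top⟩
  exact h2.integrable (by norm_num)

/-- A function orthogonal to the range has zero primitive in each component, hence vanishes by
Lebesgue differentiation. -/
lemma denseRange_stepMap (d : ℕ) : DenseRange (stepMap d) := by
  have : (LinearMap.range (stepMap d)).topologicalClosure = ⊤ := by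
    rw [Submodule.topologicalClosure_eq_top_iff, Submodule.eq_bot_iff]
    intro g hg
    have h1 : ∀ p, inner ℝ (stepVec p) g = 0 := fun p => by
      have := (Submodule.mem_orthogonal _ _).1 hg (stepMap d (Finsupp.single p 1)) ⟨_, rfl⟩
      simpa [stepMap] using this
    have h2 : ∀ b : ℝ, 0 ≤ b → ∫ x in Ioc 0 b, g x ∂posVol = 0 := by
      intro b hb
      ext j
      have h3 := h1 (j, b.toNNReal)
      rw [stepVec, L2.inner_indicatorConstLp_eq_inner_setIntegral] at h3
      simpa [EuclideanSpace.inner_single_left, Real.coe_toNNReal b hb] using h3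
    have h4 := ae_eq_zero_of_forall_intervalIntegral (TimeL2.locallyIntegrable g) (fun b => by
      rcases le_total 0 b with hb | hb
      · rw [intervalIntegral.integral_of_le hb, ← h2 b hb,
          integral_indicator measurableSet_Ioi, Measure.restrict_restrict measurableSet_Ioi,
          Measure.restrict_restrict measurableSet_Ioc, inter_comm]
      · rw [intervalIntegral.integral_of_ge hb, setIntegral_indicator measurableSet_Ioi]
        have : Ioc b 0 ∩ Ioi 0 = ∅ := by ext x; simp
        simp [this])
    rw [Lp.eq_zero_iff_ae_eq_zero]
    filter_upwards [ae_restrict_of_ae h4, ae_restrict_mem measurableSet_Ioi] with x hx hx'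
    simpa [hx'] using hx
  have h := (Submodule.dense_iff_topologicalClosure_eq_top (s := LinearMap.range (stepMap d))).2 this
  exact h

/-- The Wiener integral as an operator from `L²` in time to `L²` of the probability space. -/
def wienerL (hW : IsStdBrownian W P) : TimeL2 d →L[ℝ] Lp ℝ 2 P :=
  (brownMap hW).extendOfNorm (stepMap d)

lemma wienerL_stepMap (hW : IsStdBrownian W P) (v : FormalStep d) :
    wienerL hW (stepMap d v) = brownMap hW v :=
  LinearMap.extendOfNorm_eq (denseRange_stepMap d) ⟨1, fun x => by simp [norm_brownMap]⟩ v

lemma norm_wienerL (hW : IsStdBrownian W P) (f : TimeL2 d) : ‖wienerL hW f‖ = ‖f‖ := by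
  refine (denseRange_stepMap d).induction_on (p := fun f => ‖wienerL hW f‖ = ‖f‖) f
    (isClosed_eq (by fun_prop) (by fun_prop)) fun v => ?_
  rw [wienerL_stepMap, norm_brownMap]

lemma inner_wienerL (hW : IsStdBrownian W P) (f g : TimeL2 d) :
    inner ℝ (wienerL hW f) (wienerL hW g) = inner ℝ f g := by
  have h1 := norm_add_sq_real (wienerL hW f) (wienerL hW g)
  have h2 := norm_add_sq_real f g
  rw [← map_add, norm_wienerL, norm_wienerL, norm_wienerL] at h1
  linarith

end Wiener

/-! ### Wiener integrals over the future are Gaussian and independent of the past -/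

section WienerLaw

set_option linter.unusedSectionVars false

variable {Ω : Type*} [MeasurableSpace Ω] {P : Measure Ω} [IsProbabilityMeasure P] {d : ℕ}
  {W : Fin d → ℝ≥0 → Ω → ℝ}

/-- The part of a formal step function after time `s`. -/
def FormalStep.tail (s : ℝ≥0) : FormalStep d →ₗ[ℝ] FormalStep d :=
  LinearMap.id - Finsupp.lmapDomain ℝ ℝ (fun p : Fin d × ℝ≥0 => (p.1, min p.2 s))

lemma coeFn_stepVec (p : Fin d × ℝ≥0) :
    stepVec p =ᵐ[posVol] (Ioc 0 (p.2 : ℝ)).indicator fun _ => EuclideanSpace.single p.1 (1 : ℝ) :=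
  indicatorConstLp_coeFn

/-- On a generator this is `1_(0,t] - 1_(0, min t s] = 1_(s,∞) 1_(0,t]`; linearity does the rest. -/
lemma coeFn_stepMap_tail (s : ℝ≥0) (v : FormalStep d) :
    stepMap d (FormalStep.tail s v) =ᵐ[posVol] (Ioi (s : ℝ)).indicator (stepMap d v) := by
  induction v using Finsupp.induction_linear with
  | zero =>
    simp only [map_zero]
    filter_upwards [Lp.coeFn_zero (EuclideanSpace ℝ (Fin d)) 2 posVol] with x hx
    by_cases h : x ∈ Ioi (s : ℝ)
    · rw [indicator_of_mem h]
    · rw [indicator_of_notMem h, hx, Pi.zero_apply]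
  | add f g hf hg =>
    simp only [map_add]
    filter_upwards [hf, hg, Lp.coeFn_add (stepMap d (FormalStep.tail s f))
      (stepMap d (FormalStep.tail s g)), Lp.coeFn_add (stepMap d f) (stepMap d g)]
      with x h1 h2 h3 h4
    rw [h3]
    simp only [Pi.add_apply, h1, h2, indicator, h4]
    split_ifs <;> simp
  | single p c =>
    have h : stepMap d (FormalStep.tail s (Finsupp.single p c)) =
        c • (stepVec p - stepVec (p.1, min p.2 s)) := by
      simp [FormalStep.tail, stepMap, Finsupp.lmapDomain_apply, Finsupp.mapDomain_single, smul_sub]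
    have h' : stepMap d (Finsupp.single p c) = c • stepVec p := by simp [stepMap]
    rw [h, h']
    filter_upwards [Lp.coeFn_smul c (stepVec p - stepVec (p.1, min p.2 s)),
      Lp.coeFn_sub (stepVec p) (stepVec (p.1, min p.2 s)), Lp.coeFn_smul c (stepVec p),
      coeFn_stepVec p, coeFn_stepVec (p.1, min p.2 s), ae_restrict_mem measurableSet_Ioi]
      with x h1 h2 h3 h4 h5 h6
    rw [h1, Pi.smul_apply, h2, Pi.sub_apply, h4, h5]
    by_cases hs : (s : ℝ) < x
    · rw [indicator_of_mem (mem_Ioi.2 hs), h3, Pi.smul_apply, h4,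
        indicator_of_notMem (s := Ioc 0 ((min p.2 s : ℝ≥0) : ℝ)), sub_zero]
      simp [hs]
    · have h0 : 0 < x := h6
      rw [indicator_of_notMem (s := Ioi (s : ℝ)) hs]
      simp [indicator, h0, not_lt.1 hs]

/-- `f` vanishes almost everywhere up to time `s`. -/
def VanishesUpTo (s : ℝ≥0) (f : TimeL2 d) : Prop := ∀ᵐ x ∂posVol, x ≤ (s : ℝ) → f x = 0

/-- Cutting an approximating step function off before `s` cannot increase its distance to a function
that is already zero there. -/
lemma VanishesUpTo.mem_closure {s : ℝ≥0} {f : TimeL2 d} (hf : VanishesUpTo s f) :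
    f ∈ closure (range fun v => stepMap d (FormalStep.tail s v)) := by
  rw [Metric.mem_closure_iff]
  intro ε hε
  obtain ⟨v, hv⟩ := (denseRange_stepMap d).exists_dist_lt f hε
  refine ⟨_, ⟨v, rfl⟩, lt_of_le_of_lt ?_ hv⟩
  rw [dist_eq_norm, dist_eq_norm]
  refine Lp.norm_le_norm_of_ae_le ?_
  filter_upwards [hf, coeFn_stepMap_tail s v, Lp.coeFn_sub f (stepMap d (FormalStep.tail s v)),
    Lp.coeFn_sub f (stepMap d v)] with x h1 h2 h3 h4
  rw [h3, h4, Pi.sub_apply, Pi.sub_apply, h2]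
  by_cases hx : (s : ℝ) < x
  · simp [hx]
  · simp [hx, h1 (not_lt.1 hx)]

/-- The stochastic integral of the part after `s` of a formal step function, as a function. -/
def tailSum (W : Fin d → ℝ≥0 → Ω → ℝ) (s : ℝ≥0) (v : FormalStep d) (ω : Ω) : ℝ :=
  v.sum fun p c => c * (W p.1 p.2 ω - W p.1 (min p.2 s) ω)

lemma coeFn_brownMap (hW : IsStdBrownian W P) (v : FormalStep d) :
    brownMap hW v =ᵐ[P] fun ω => v.sum fun p c => c * W p.1 p.2 ω := by
  induction v using Finsupp.induction_linear with
  | zero => simpa using! Lp.coeFn_zero ℝ 2 P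
  | add f g hf hg =>
    rw [map_add]
    filter_upwards [hf, hg, Lp.coeFn_add (brownMap hW f) (brownMap hW g)] with ω h1 h2 h3
    rw [h3, Pi.add_apply, h1, h2, Finsupp.sum_add_index' (by simp) (by intros; ring)]
  | single p c =>
    have h' : brownMap hW (Finsupp.single p c) = c • brownVec hW p := by simp [brownMap]
    rw [h']
    filter_upwards [Lp.coeFn_smul c (brownVec hW p), (hW.memLp p.1 p.2).coeFn_toLp] with ω h1 h2
    rw [h1, Pi.smul_apply, brownVec, h2]
    simp

lemma coeFn_brownMap_tail (hW : IsStdBrownian W P) (s : ℝ≥0) (v : FormalStep d) :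
    brownMap hW (FormalStep.tail s v) =ᵐ[P] tailSum W s v := by
  filter_upwards [coeFn_brownMap hW (FormalStep.tail s v)] with ω h
  rw [h, FormalStep.tail]
  simp only [LinearMap.sub_apply, LinearMap.id_apply, Finsupp.lmapDomain_apply]
  rw [Finsupp.sum_sub_index (by intros; ring), Finsupp.sum_mapDomain_index (by simp)
    (by intros; ring), tailSum, Finsupp.sum, Finsupp.sum, Finsupp.sum, ← Finset.sum_sub_distrib]
  exact Finset.sum_congr rfl fun p _ => by ring

lemma measurable_tailSum (hW : IsStdBrownian W P) (s : ℝ≥0) (v : FormalStep d) :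
    Measurable (tailSum W s v) :=
  Finset.measurable_sum _ fun p _ =>
    ((hW.measurable p.1 p.2).sub (hW.measurable p.1 _)).const_mul _

lemma hasGaussianLaw_brownMap (hW : IsStdBrownian W P) (v : FormalStep d) :
    HasGaussianLaw (brownMap hW v) P := by
  have h := ((hW.isGaussianProcess.smul (fun p => v p)).hasGaussianLaw_fun_sum (I := v.support))
  exact h.congr (by simpa [Finsupp.sum] using! (coeFn_brownMap hW v).symm)

lemma integral_brownMap (hW : IsStdBrownian W P) (v : FormalStep d) :
    ∫ ω, brownMap hW v ω ∂P = 0 := by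
  rw [integral_congr_ae (coeFn_brownMap hW v)]
  simp only [Finsupp.sum]
  rw [integral_finsetSum _ fun p _ => ((hW.isPre p.1).integrable_eval p.2).const_mul _]
  refine Finset.sum_eq_zero fun p _ => ?_
  rw [integral_const_mul, (hW.isPre p.1).integral_eval, mul_zero]

lemma map_brownMap (hW : IsStdBrownian W P) (v : FormalStep d) :
    P.map (brownMap hW v) = gaussianReal 0 (‖stepMap d v‖ ^ 2).toNNReal := by
  rw [(hasGaussianLaw_brownMap hW v).map_eq_gaussianReal, integral_brownMap,
    variance_of_integral_eq_zero (Lp.aestronglyMeasurable _).aemeasurable (integral_brownMap hW v),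
    ← norm_brownMap hW, ← real_inner_self_eq_norm_sq, L2.inner_def]
  congr 2
  exact integral_congr_ae (ae_of_all _ fun ω => by simp [sq])

/-- A set of the augmented filtration agrees a.e. with one of the raw filtration. -/
lemma exists_ae_eq_of_measurableSet_filtW {s : ℝ} {A : Set Ω}
    (hA : MeasurableSet[filtW W P s] A) :
    ∃ A', MeasurableSet[⨆ r ∈ Icc 0 s, MeasurableSpace.comap (vecW W r) inferInstance] A' ∧
      A =ᵐ[P] A' := by
  have : filtW W P s ≤ eventuallyMeasurableSpace
      (⨆ r ∈ Icc 0 s, MeasurableSpace.comap (vecW W r) inferInstance) (ae P) := by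
    refine sup_le le_eventuallyMeasurableSpace (MeasurableSpace.generateFrom_le fun B hB => ?_)
    exact ⟨∅, @MeasurableSet.empty _ (⨆ r ∈ Icc 0 s, MeasurableSpace.comap (vecW W r) inferInstance),
      ae_eq_empty.2 hB.2⟩
  exact this A hA

lemma measurable_vecW (hW : IsStdBrownian W P) (t : ℝ) : Measurable (vecW W t) :=
  (WithLp.measurable_toLp 2 _).comp (measurable_pi_lambda _ fun j => hW.measurable j _)

lemma filtW_le (hW : IsStdBrownian W P) (t : ℝ) : filtW W P t ≤ (inferInstance : MeasurableSpace Ω) :=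
  sup_le (iSup₂_le fun s _ => (measurable_vecW hW s).comap_le)
    (MeasurableSpace.generateFrom_le fun _ hB => hB.1)

lemma filtW_mono {s t : ℝ} (hst : s ≤ t) : filtW W P s ≤ filtW W P t :=
  sup_le_sup_right (biSup_mono fun _ hr => ⟨hr.1, hr.2.trans hst⟩) _

/-- Jointly Gaussian families are independent once their covariances vanish, and `min p t = min (min
p s) t` for `t ≤ s` kills the covariance of an increment after `s` with the past. -/
lemma indepFun_tailSum (hW : IsStdBrownian W P) (s : ℝ≥0) (v : FormalStep d) :
    IndepFun (tailSum W s v) (fun ω (q : Fin d × Iic s) => W q.1 q.2 ω) P := by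
  have h : IndepFun (fun ω (p : Fin d × ℝ≥0) => W p.1 p.2 ω - W p.1 (min p.2 s) ω)
      (fun ω (q : Fin d × Iic s) => W q.1 q.2 ω) P := by
    classical
    refine IsGaussianProcess.indepFun_of_covariance_eq_zero
      (X := fun (p : Fin d × ℝ≥0) ω => W p.1 p.2 ω - W p.1 (min p.2 s) ω)
      (Y := fun (q : Fin d × Iic s) ω => W q.1 q.2 ω) ?_
      (fun p => ((hW.measurable _ _).sub (hW.measurable _ _)).aemeasurable)
      (fun q => (hW.measurable _ _).aemeasurable) ?_
    · apply hW.isGaussianProcess.of_isGaussianProcess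
      rintro (p | q)
      · exact ⟨{p, (p.1, min p.2 s)},
          { toFun x := x ⟨p, by simp⟩ - x ⟨(p.1, min p.2 s), by simp⟩
            map_add' x y := by simp; abel
            map_smul' c x := by simp; ring }, by simp⟩
      · exact ⟨{(q.1, (q.2 : ℝ≥0))},
          { toFun x := x ⟨(q.1, (q.2 : ℝ≥0)), by simp⟩
            map_add' x y := by simp
            map_smul' c x := by simp }, by simp⟩
    · rintro p ⟨j, t, ht⟩
      rw [covariance_fun_sub_left (hW.memLp _ _) (hW.memLp _ _) (hW.memLp _ _), hW.covariance,
        hW.covariance]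
      have : min (p.2 : ℝ) t = min (min (p.2 : ℝ) s) t := by
        rw [min_assoc, min_eq_right (a := (s : ℝ)) (b := t) (by exact_mod_cast ht)]
      simp [this]
  have hm : Measurable (fun x : Fin d × ℝ≥0 → ℝ => v.sum fun p c => c * x p) :=
    Finset.measurable_sum _ fun p _ => (measurable_pi_apply p).const_mul _
  exact h.comp hm measurable_id

lemma iSup_comap_vecW_le (s : ℝ≥0) :
    (⨆ r ∈ Icc 0 (s : ℝ), MeasurableSpace.comap (vecW W r) inferInstance) ≤
      MeasurableSpace.comap (fun ω (q : Fin d × Iic s) => W q.1 q.2 ω) inferInstance := by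
  refine iSup₂_le fun r hr => ?_
  have hr' : r.toNNReal ≤ s := Real.toNNReal_le_iff_le_coe.2 hr.2
  have : vecW W r = (fun x : Fin d × Iic s → ℝ => WithLp.toLp 2 fun j => x (j, ⟨_, hr'⟩)) ∘
      (fun ω (q : Fin d × Iic s) => W q.1 q.2 ω) := rfl
  rw [this, ← MeasurableSpace.comap_comp]
  refine MeasurableSpace.comap_mono (Measurable.comap_le ?_)
  exact (WithLp.measurable_toLp 2 _).comp (measurable_pi_lambda _ fun j => measurable_pi_apply _)

-- The inequality `|e^{ia} - e^{ib}| ≤ |a - b|` gives a Lipschitz bound in `L¹`, which the `L²` norm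
-- dominates on a probability space. It carries characteristic function identities from step
-- functions to their limits.
open Complex in
lemma continuous_setIntegral_exp (A : Set Ω) :
    Continuous fun g : Lp ℝ 2 P => ∫ ω in A, exp (g ω * I) ∂P := by
  have hint : ∀ g : Lp ℝ 2 P, Integrable (fun ω => exp (g ω * I)) P := fun g => by
    refine Integrable.of_bound (C := 1) ?_ (ae_of_all _ fun ω => by simp [norm_exp_ofReal_mul_I])
    have := (Lp.aestronglyMeasurable g).aemeasurable
    exact (by fun_prop : AEMeasurable (fun ω => exp (g ω * I)) P).aestronglyMeasurable
  refine (LipschitzWith.of_dist_le_mul (K := 1) fun g h => ?_).continuous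
  rw [dist_eq_norm, ← integral_sub (hint g).integrableOn (hint h).integrableOn, dist_eq_norm,
    NNReal.coe_one, one_mul]
  have hgh : Integrable (fun ω => ‖(g - h : Lp ℝ 2 P) ω‖) P :=
    ((Lp.memLp (g - h)).integrable (by norm_num)).norm
  calc ‖∫ ω in A, (exp (g ω * I) - exp (h ω * I)) ∂P‖
      ≤ ∫ ω in A, ‖exp (g ω * I) - exp (h ω * I)‖ ∂P := norm_integral_le_integral_norm _
    _ ≤ ∫ ω, ‖exp (g ω * I) - exp (h ω * I)‖ ∂P :=
        setIntegral_le_integral ((hint g).sub (hint h)).norm (ae_of_all _ fun _ => norm_nonneg _)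
    _ ≤ ∫ ω, ‖(g - h : Lp ℝ 2 P) ω‖ ∂P := by
        refine integral_mono_ae ((hint g).sub (hint h)).norm hgh ?_
        filter_upwards [Lp.coeFn_sub g h] with ω hω
        rw [hω, Pi.sub_apply]
        have h1 : exp (g ω * I) - exp (h ω * I) =
            exp (h ω * I) * (exp (I * ((g ω - h ω : ℝ) : ℂ)) - 1) := by
          rw [mul_sub, ← exp_add, mul_one]; congr 2; push_cast; ring
        rw [h1, norm_mul, norm_exp_ofReal_mul_I, one_mul]
        exact Real.norm_exp_I_mul_ofReal_sub_one_le
    _ ≤ ‖g - h‖ := by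
        rw [Lp.norm_def, integral_norm_eq_lintegral_enorm (Lp.aestronglyMeasurable _),
          ← eLpNorm_one_eq_lintegral_enorm]
        exact ENNReal.toReal_mono (Lp.eLpNorm_ne_top _)
          (eLpNorm_le_eLpNorm_of_exponent_le (by norm_num) (Lp.aestronglyMeasurable _))

-- Ranging over past events `A`, this one formula encodes both the Gaussian law and independence of
-- the past. For cut-off step functions, `A` is replaced by an almost equal event of the unaugmented
-- filtration and independence factors the integral; both sides are continuous in `f`.
open Complex in
lemma setIntegral_exp_wienerL (hW : IsStdBrownian W P) {s : ℝ≥0} {f : TimeL2 d}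
    (hf : VanishesUpTo s f) {A : Set Ω} (hA : MeasurableSet[filtW W P s] A) :
    ∫ ω in A, exp (wienerL hW f ω * I) ∂P = P.real A * exp (-‖f‖ ^ 2 / 2 : ℝ) := by
  have hc1 : Continuous fun f : TimeL2 d => ∫ ω in A, exp (wienerL hW f ω * I) ∂P :=
    (continuous_setIntegral_exp A).comp (wienerL hW).continuous
  have hc2 : Continuous fun f : TimeL2 d => (P.real A * exp (-‖f‖ ^ 2 / 2 : ℝ) : ℂ) := by fun_prop
  refine closure_minimal ?_ (isClosed_eq hc1 hc2) hf.mem_closure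
  rintro _ ⟨v, rfl⟩
  simp only [mem_ofPred_eq]
  obtain ⟨A', hA', hAA'⟩ := exists_ae_eq_of_measurableSet_filtW hA
  have hA'm : MeasurableSet[MeasurableSpace.comap
    (fun ω (q : Fin d × Iic s) => W q.1 q.2 ω) inferInstance] A' := iSup_comap_vecW_le s _ hA'
  obtain ⟨B, hB, rfl⟩ := hA'm
  have hBm : MeasurableSet ((fun ω (q : Fin d × Iic s) => W q.1 q.2 ω) ⁻¹' B) :=
    (measurable_pi_lambda _ fun q => hW.measurable q.1 _) hB
  have hm1 : Measurable fun x : ℝ => exp (x * I) := by fun_prop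
  have hm2 : Measurable (B.indicator fun _ => (1 : ℂ)) := measurable_const.indicator hB
  have hind := (indepFun_tailSum hW s v).comp hm1 hm2
  have hmul := hind.integral_mul_eq_mul_integral
    (hm1.comp (measurable_tailSum hW s v)).aestronglyMeasurable
    (hm2.comp (measurable_pi_lambda _ fun q : Fin d × Iic s =>
      hW.measurable q.1 _)).aestronglyMeasurable
  rw [Measure.restrict_congr_set hAA', measureReal_congr hAA', wienerL_stepMap,
    integral_congr_ae (ae_restrict_of_ae ((coeFn_brownMap_tail hW s v).mono
      fun ω h => by rw [h] : ∀ᵐ ω ∂P, exp (brownMap hW (FormalStep.tail s v) ω * I) =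
        exp (tailSum W s v ω * I))), ← integral_indicator hBm]
  have e1 : ∫ ω, exp (tailSum W s v ω * I) ∂P =
      exp (-‖stepMap d (FormalStep.tail s v)‖ ^ 2 / 2 : ℝ) := by
    have h1 : ∫ ω, exp (tailSum W s v ω * I) ∂P =
        charFun (P.map (brownMap hW (FormalStep.tail s v))) 1 := by
      rw [charFun_apply_real, integral_map (Lp.aestronglyMeasurable _).aemeasurable (by fun_prop)]
      refine integral_congr_ae ?_
      filter_upwards [coeFn_brownMap_tail hW s v] with ω h
      simp [h]
    rw [h1, map_brownMap, charFun_gaussianReal]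
    congr 1
    simp
    ring
  have e2 : ∫ ω, (B.indicator (fun _ => (1 : ℂ)) ∘ fun ω (q : Fin d × Iic s) => W q.1 q.2 ω) ω ∂P =
      P.real ((fun ω (q : Fin d × Iic s) => W q.1 q.2 ω) ⁻¹' B) := by
    have : (B.indicator (fun _ => (1 : ℂ)) ∘ fun ω (q : Fin d × Iic s) => W q.1 q.2 ω) =
      ((fun ω (q : Fin d × Iic s) => W q.1 q.2 ω) ⁻¹' B).indicator fun _ => 1 := rfl
    rw [this, integral_indicator hBm]
    simp
  simp only [Function.comp_apply, Pi.mul_apply] at hmul e2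
  rw [e1, e2, mul_comm] at hmul
  rw [← hmul]
  refine integral_congr_ae (ae_of_all _ fun ω => ?_)
  beta_reduce
  by_cases h : (fun q : Fin d × Iic s => W q.1 q.2 ω) ∈ B
  · rw [indicator_of_mem (mem_preimage.2 h), indicator_of_mem h, mul_one]
  · rw [indicator_of_notMem (fun h' => h (mem_preimage.1 h')), indicator_of_notMem h, mul_zero]

end WienerLaw

/-! ### Joint laws and exponential moments of Wiener integrals -/

section WienerFun

set_option linter.unusedSectionVars false

variable {Ω : Type*} [MeasurableSpace Ω] {P : Measure Ω} [IsProbabilityMeasure P] {d : ℕ}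
  {W : Fin d → ℝ≥0 → Ω → ℝ}

open Classical in
/-- The Wiener integral `∫_0^∞ f' dW` of a square integrable deterministic function. -/
def wiener (hW : IsStdBrownian W P) (f : ℝ → EuclideanSpace ℝ (Fin d)) : Ω → ℝ :=
  if h : MemLp f 2 posVol then wienerL hW (h.toLp f) else 0

variable (hW : IsStdBrownian W P) {f g : ℝ → EuclideanSpace ℝ (Fin d)}

lemma wiener_of_memLp (hf : MemLp f 2 posVol) : wiener hW f = wienerL hW (hf.toLp f) := dif_pos hf

lemma measurable_wiener (f : ℝ → EuclideanSpace ℝ (Fin d)) : Measurable (wiener hW f) := by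
  unfold wiener
  split_ifs
  · exact (Lp.stronglyMeasurable _).measurable
  · exact measurable_const

lemma wiener_congr (h : f =ᵐ[posVol] g) : wiener hW f = wiener hW g := by
  by_cases hf : MemLp f 2 posVol
  · have hg : MemLp g 2 posVol := hf.ae_eq h
    rw [wiener_of_memLp hW hf, wiener_of_memLp hW hg, MemLp.toLp_congr hf hg h]
  · have hg : ¬ MemLp g 2 posVol := fun hg => hf (hg.ae_eq h.symm)
    simp [wiener, hf, hg]

lemma wiener_add (hf : MemLp f 2 posVol) (hg : MemLp g 2 posVol) :
    wiener hW (f + g) =ᵐ[P] wiener hW f + wiener hW g := by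
  rw [wiener_of_memLp hW hf, wiener_of_memLp hW hg, wiener_of_memLp hW (hf.add hg),
    MemLp.toLp_add, map_add]
  exact Lp.coeFn_add _ _

lemma wiener_sub (hf : MemLp f 2 posVol) (hg : MemLp g 2 posVol) :
    wiener hW (f - g) =ᵐ[P] wiener hW f - wiener hW g := by
  rw [wiener_of_memLp hW hf, wiener_of_memLp hW hg, wiener_of_memLp hW (hf.sub hg),
    MemLp.toLp_sub, map_sub]
  exact Lp.coeFn_sub _ _

lemma wiener_smul (c : ℝ) (hf : MemLp f 2 posVol) :
    wiener hW (c • f) =ᵐ[P] c • wiener hW f := by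
  rw [wiener_of_memLp hW hf, wiener_of_memLp hW (hf.const_smul c), MemLp.toLp_const_smul, map_smul]
  exact Lp.coeFn_smul _ _

lemma norm_toLp_sq (hf : MemLp f 2 posVol) : ‖hf.toLp f‖ ^ 2 = ∫ x, ‖f x‖ ^ 2 ∂posVol := by
  rw [← real_inner_self_eq_norm_sq, L2.inner_def]
  refine integral_congr_ae ?_
  filter_upwards [hf.coeFn_toLp] with x hx
  simp [hx]

lemma inner_toLp (hf : MemLp f 2 posVol) (hg : MemLp g 2 posVol) :
    inner ℝ (hf.toLp f) (hg.toLp g) = ∫ x, inner ℝ (f x) (g x) ∂posVol := by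
  rw [L2.inner_def]
  refine integral_congr_ae ?_
  filter_upwards [hf.coeFn_toLp, hg.coeFn_toLp] with x hx hx'
  simp [hx, hx']

lemma integrable_inner_of_memLp {α : Type*} [MeasurableSpace α] {ν : Measure α}
    {f g : α → EuclideanSpace ℝ (Fin d)} (hf : MemLp f 2 ν) (hg : MemLp g 2 ν) :
    Integrable (fun x => inner ℝ (f x) (g x)) ν := by
  refine (L2.integrable_inner (𝕜 := ℝ) (hf.toLp f) (hg.toLp g)).congr ?_
  filter_upwards [hf.coeFn_toLp, hg.coeFn_toLp] with x hx hx'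
  rw [hx, hx']

lemma memLp_wiener (hf : MemLp f 2 posVol) : MemLp (wiener hW f) 2 P := by
  rw [wiener_of_memLp hW hf]; exact Lp.memLp _

lemma integral_wiener_mul (hf : MemLp f 2 posVol) (hg : MemLp g 2 posVol) :
    ∫ ω, wiener hW f ω * wiener hW g ω ∂P = ∫ x, inner ℝ (f x) (g x) ∂posVol := by
  rw [← inner_toLp hf hg, ← inner_wienerL hW, L2.inner_def, wiener_of_memLp hW hf,
    wiener_of_memLp hW hg]
  exact integral_congr_ae (ae_of_all _ fun ω => by simp [mul_comm])

/-- `f` vanishes almost everywhere on `(0,s]`. -/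
def ZeroUpTo (s : ℝ) (f : ℝ → EuclideanSpace ℝ (Fin d)) : Prop := ∀ᵐ x ∂posVol, x ≤ s → f x = 0

lemma zeroUpTo_indicator_Ioc {s a b : ℝ} (h : s ≤ a) : ZeroUpTo s ((Ioc a b).indicator f) :=
  ae_of_all _ fun _ hx => indicator_of_notMem (fun hx' => not_lt.2 hx (h.trans_lt hx'.1)) _

open Complex in
lemma setIntegral_exp_wiener (hf : MemLp f 2 posVol) {s : ℝ} (hs : 0 ≤ s) (h : ZeroUpTo s f)
    {A : Set Ω} (hA : MeasurableSet[filtW W P s] A) :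
    ∫ ω in A, exp (wiener hW f ω * I) ∂P =
      P.real A * exp (-(∫ x, ‖f x‖ ^ 2 ∂posVol) / 2 : ℝ) := by
  rw [wiener_of_memLp hW hf, ← norm_toLp_sq hf]
  refine setIntegral_exp_wienerL hW (s := ⟨s, hs⟩) ?_ hA
  filter_upwards [h, hf.coeFn_toLp] with x hx h2 h3
  rw [h2, hx h3]

open Complex in
lemma map_wiener (hf : MemLp f 2 posVol) :
    P.map (wiener hW f) = gaussianReal 0 (∫ x, ‖f x‖ ^ 2 ∂posVol).toNNReal := by
  have := Measure.isProbabilityMeasure_map (μ := P) (measurable_wiener hW f).aemeasurable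
  refine Measure.ext_of_charFun (funext fun u => ?_)
  rw [charFun_apply_real, integral_map (measurable_wiener hW f).aemeasurable (by fun_prop),
    charFun_gaussianReal]
  -- Under `posVol` this is vacuous, so the formula with `s = 0` and `A = univ` gives the
  -- characteristic function of any Wiener integral.
  have h0 : ZeroUpTo 0 (u • f) := by
    filter_upwards [ae_restrict_mem measurableSet_Ioi] with x hx h
    exact absurd hx (not_lt.2 h)
  have h1 := setIntegral_exp_wiener hW (hf.const_smul u) le_rfl h0 MeasurableSet.univ
  rw [setIntegral_univ] at h1
  have h2 : ∫ ω, exp (u * wiener hW f ω * I) ∂P = ∫ ω, exp (wiener hW (u • f) ω * I) ∂P := by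
    refine integral_congr_ae ?_
    filter_upwards [wiener_smul hW u hf] with ω hω
    simp [hω]
  rw [h2, h1]
  simp only [Pi.smul_apply, norm_smul, mul_pow, integral_const_mul]
  rw [Real.coe_toNNReal _ (by positivity)]
  simp only [Real.norm_eq_abs, sq_abs, probReal_univ, ofReal_one, one_mul]
  congr 1
  push_cast
  simp
  ring

/-- Every linear functional of the pair is again a Wiener integral, so all one-dimensional images
are Gaussian. -/
lemma hasGaussianLaw_wiener_pair (hf : MemLp f 2 posVol) (hg : MemLp g 2 posVol) :
    HasGaussianLaw (fun ω => (wiener hW f ω, wiener hW g ω)) P where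
  isGaussian_map := by
    have hm : Measurable fun ω => (wiener hW f ω, wiener hW g ω) :=
      (measurable_wiener hW f).prodMk (measurable_wiener hW g)
    refine isGaussian_of_map_eq_gaussianReal fun L => ?_
    rw [Measure.map_map (by fun_prop) hm]
    have : L ∘ (fun ω => (wiener hW f ω, wiener hW g ω)) =ᵐ[P]
        wiener hW (L (1, 0) • f + L (0, 1) • g) := by
      filter_upwards [wiener_add hW (hf.const_smul (L (1, 0))) (hg.const_smul (L (0, 1))),
        wiener_smul hW (L (1, 0)) hf, wiener_smul hW (L (0, 1)) hg] with ω h1 h2 h3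
      rw [h1, Pi.add_apply, h2, h3, Function.comp_apply]
      have : (wiener hW f ω, wiener hW g ω) =
        wiener hW f ω • ((1 : ℝ), (0 : ℝ)) + wiener hW g ω • ((0 : ℝ), (1 : ℝ)) := by simp
      rw [this, map_add, map_smul, map_smul]
      simp [mul_comm]
    rw [Measure.map_congr this, map_wiener hW ((hf.const_smul _).add (hg.const_smul _))]
    exact ⟨_, _, rfl⟩

-- Characteristic functions determine finite measures, and a linear functional of the pair is the
-- Wiener integral of a function that still vanishes up to `s`. This is independence of the pair
-- from the past.
open Complex in
lemma map_restrict_wiener_pair (hf : MemLp f 2 posVol) (hg : MemLp g 2 posVol)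
    {s : ℝ} (hs : 0 ≤ s) (hf0 : ZeroUpTo s f) (hg0 : ZeroUpTo s g)
    {A : Set Ω} (hA : MeasurableSet[filtW W P s] A) :
    (P.restrict A).map (fun ω => (wiener hW f ω, wiener hW g ω)) =
      P A • P.map (fun ω => (wiener hW f ω, wiener hW g ω)) := by
  have hm : Measurable fun ω => (wiener hW f ω, wiener hW g ω) :=
    (measurable_wiener hW f).prodMk (measurable_wiener hW g)
  have : IsFiniteMeasure (P A • P.map (fun ω => (wiener hW f ω, wiener hW g ω))) :=
    Measure.smul_finite _ (measure_ne_top _ _)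
  refine Measure.ext_of_charFunDual (funext fun L => ?_)
  have key : ∀ B, MeasurableSet[filtW W P s] B →
      ∫ ω in B, exp (L (wiener hW f ω, wiener hW g ω) * I) ∂P = P.real B *
        exp (-(∫ x, ‖(L (1, 0) • f + L (0, 1) • g) x‖ ^ 2 ∂posVol) / 2 : ℝ) := by
    intro B hB
    rw [← setIntegral_exp_wiener hW ((hf.const_smul (L (1, 0))).add (hg.const_smul (L (0, 1)))) hs
      ?_ hB]
    · refine integral_congr_ae (ae_restrict_of_ae ?_)
      filter_upwards [wiener_add hW (hf.const_smul (L (1, 0))) (hg.const_smul (L (0, 1))),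
        wiener_smul hW (L (1, 0)) hf, wiener_smul hW (L (0, 1)) hg] with ω h1 h2 h3
      rw [h1, Pi.add_apply, h2, h3]
      have : (wiener hW f ω, wiener hW g ω) =
        wiener hW f ω • ((1 : ℝ), (0 : ℝ)) + wiener hW g ω • ((0 : ℝ), (1 : ℝ)) := by simp
      rw [this, map_add, map_smul, map_smul]
      simp [mul_comm]
    · filter_upwards [hf0, hg0] with x h1 h2 hx
      simp [h1 hx, h2 hx]
  have e1 : charFunDual ((P.restrict A).map fun ω => (wiener hW f ω, wiener hW g ω)) L =
      ∫ ω in A, exp (L (wiener hW f ω, wiener hW g ω) * I) ∂P := by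
    rw [charFunDual_apply, integral_map hm.aemeasurable (by fun_prop)]
  have e2 : charFunDual (P A • P.map fun ω => (wiener hW f ω, wiener hW g ω)) L =
      P.real A * ∫ ω in univ, exp (L (wiener hW f ω, wiener hW g ω) * I) ∂P := by
    rw [charFunDual_apply, integral_smul_measure, integral_map hm.aemeasurable (by fun_prop),
      setIntegral_univ]
    simp [Measure.real]
  rw [e1, e2, key A hA, key univ MeasurableSet.univ]
  simp

/-- Wiener integrals over times after `s` are independent of the past up to `s`. -/
lemma integral_mul_wiener_pair (hf : MemLp f 2 posVol) (hg : MemLp g 2 posVol)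
    {s : ℝ} (hs : 0 ≤ s) (hf0 : ZeroUpTo s f) (hg0 : ZeroUpTo s g)
    {η : Ω → ℝ} (hη : Measurable[filtW W P s] η) {h : ℝ × ℝ → ℝ} (hh : Measurable h) :
    ∫ ω, η ω * h (wiener hW f ω, wiener hW g ω) ∂P =
      (∫ ω, η ω ∂P) * ∫ ω, h (wiener hW f ω, wiener hW g ω) ∂P := by
  have hm : Measurable fun ω => (wiener hW f ω, wiener hW g ω) :=
    (measurable_wiener hW f).prodMk (measurable_wiener hW g)
  have hη' : Measurable η := hη.mono (filtW_le hW s) le_rfl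
  have hind : IndepFun η (fun ω => (wiener hW f ω, wiener hW g ω)) P := by
    rw [IndepFun_iff]
    rintro _ _ ⟨B, hB, rfl⟩ ⟨C, hC, rfl⟩
    have h1 := congrArg (fun ν => ν C)
      (map_restrict_wiener_pair hW hf hg hs hf0 hg0 (hη hB))
    rw [Measure.map_apply hm hC, Measure.restrict_apply (hm hC)] at h1
    rw [inter_comm, h1, Measure.smul_apply, Measure.map_apply hm hC, smul_eq_mul]
  have := (hind.comp measurable_id hh).integral_mul_eq_mul_integral
    hη'.aestronglyMeasurable (hh.comp hm).aestronglyMeasurable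
  simpa using! this

lemma integral_mul_wiener (hf : MemLp f 2 posVol) {s : ℝ} (hs : 0 ≤ s) (hf0 : ZeroUpTo s f)
    {η : Ω → ℝ} (hη : Measurable[filtW W P s] η) {h : ℝ → ℝ} (hh : Measurable h) :
    ∫ ω, η ω * h (wiener hW f ω) ∂P = (∫ ω, η ω ∂P) * ∫ ω, h (wiener hW f ω) ∂P :=
  integral_mul_wiener_pair hW hf hf hs hf0 hf0 hη (hh.comp measurable_fst)

lemma integral_wiener (hf : MemLp f 2 posVol) : ∫ ω, wiener hW f ω ∂P = 0 := by
  have h := integral_id_gaussianReal (μ := 0) (v := (∫ x, ‖f x‖ ^ 2 ∂posVol).toNNReal)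
  rwa [← map_wiener hW hf, integral_map (measurable_wiener hW f).aemeasurable (by fun_prop)] at h

lemma mgf_wiener (hf : MemLp f 2 posVol) (u : ℝ) :
    mgf (wiener hW f) P u = Real.exp ((∫ x, ‖f x‖ ^ 2 ∂posVol) * u ^ 2 / 2) := by
  rw [mgf_gaussianReal (map_wiener hW hf) u, Real.coe_toNNReal _ (by positivity)]
  simp

lemma integrable_exp_wiener (hf : MemLp f 2 posVol) (u : ℝ) :
    Integrable (fun ω => Real.exp (u * wiener hW f ω)) P := by
  have h := integrable_exp_mul_gaussianReal (μ := 0) (v := (∫ x, ‖f x‖ ^ 2 ∂posVol).toNNReal) u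
  rw [← map_wiener hW hf, integrable_map_measure (by fun_prop)
    (measurable_wiener hW f).aemeasurable] at h
  exact h

lemma integral_exp_wiener (hf : MemLp f 2 posVol) :
    ∫ ω, Real.exp (wiener hW f ω) ∂P = Real.exp ((∫ x, ‖f x‖ ^ 2 ∂posVol) / 2) := by
  have := mgf_wiener hW hf 1
  simpa [mgf] using this

lemma memLp_exp_wiener (hf : MemLp f 2 posVol) : MemLp (fun ω => Real.exp (wiener hW f ω)) 2 P := by
  refine (memLp_two_iff_integrable_sq
    (measurable_wiener hW f).exp.aestronglyMeasurable).2 ?_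
  refine (integrable_exp_wiener hW hf 2).congr (ae_of_all _ fun ω => ?_)
  simp only
  rw [← Real.exp_nat_mul]; norm_num

lemma wiener_eq_zero (hf : MemLp f 2 posVol) (h : ∫ x, ‖f x‖ ^ 2 ∂posVol = 0) :
    wiener hW f =ᵐ[P] 0 := by
  have h1 : HasLaw (wiener hW f) (Measure.dirac 0) P :=
    ⟨(measurable_wiener hW f).aemeasurable, by
      rw [map_wiener hW hf, h, Real.toNNReal_zero, gaussianReal_zero_var]⟩
  exact h1.ae_eq_of_dirac

/-- Obtained by differentiating the moment generating function at 1. -/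
lemma integral_wiener_mul_exp_self (hf : MemLp f 2 posVol) :
    ∫ ω, wiener hW f ω * Real.exp (wiener hW f ω) ∂P =
      (∫ x, ‖f x‖ ^ 2 ∂posVol) * Real.exp ((∫ x, ‖f x‖ ^ 2 ∂posVol) / 2) := by
  have hset : integrableExpSet (wiener hW f) P = univ :=
    eq_univ_of_forall fun u => integrable_exp_wiener hW hf u
  have h1 := deriv_mgf (X := wiener hW f) (μ := P) (t := 1) (by simp [hset])
  have h2 : mgf (wiener hW f) P = fun u => Real.exp ((∫ x, ‖f x‖ ^ 2 ∂posVol) * u ^ 2 / 2) :=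
    funext (mgf_wiener hW hf)
  rw [h2] at h1
  simp only [one_mul] at h1
  rw [← h1]
  set q := ∫ x, ‖f x‖ ^ 2 ∂posVol
  have h3 : HasDerivAt (fun u : ℝ => Real.exp (q * u ^ 2 / 2))
      (Real.exp (q * 1 ^ 2 / 2) * (q * (2 * 1 ^ 1 * 1) / 2)) 1 := by
    have := ((((hasDerivAt_id (1 : ℝ)).pow 2).const_mul q).div_const 2).exp
    simpa using! this
  rw [h3.deriv]
  ring_nf

/-- Split `g = c f + g'` with `g'` orthogonal to `f` in `L²`. The integral of `g'` is uncorrelated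
with that of `f`, hence independent of it, and having mean zero it contributes nothing; the multiple
of `f` is the previous case. -/
lemma integral_wiener_mul_exp (hf : MemLp f 2 posVol) (hg : MemLp g 2 posVol) :
    ∫ ω, wiener hW g ω * Real.exp (wiener hW f ω) ∂P =
      (∫ x, inner ℝ (g x) (f x) ∂posVol) * Real.exp ((∫ x, ‖f x‖ ^ 2 ∂posVol) / 2) := by
  set q := ∫ x, ‖f x‖ ^ 2 ∂posVol with hq
  have hqf : q = ∫ x, inner ℝ (f x) (f x) ∂posVol := by simp [hq]
  -- The projection coefficient divides by `q`, so a null function `f` is treated separately.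
  rcases eq_or_ne q 0 with h0 | h0
  · have hf0 : f =ᵐ[posVol] 0 := by
      have : hf.toLp f = 0 := by
        rw [← norm_eq_zero, ← sq_eq_zero_iff, norm_toLp_sq, ← hq, h0]
      exact hf.coeFn_toLp.symm.trans ((Lp.eq_zero_iff_ae_eq_zero).1 this)
    have h1 : ∫ x, inner ℝ (g x) (f x) ∂posVol = 0 := by
      refine integral_eq_zero_of_ae ?_
      filter_upwards [hf0] with x hx
      simp [hx]
    rw [h1, zero_mul, ← integral_wiener hW hg]
    refine integral_congr_ae ?_
    filter_upwards [wiener_eq_zero hW hf h0] with ω hω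
    simp [hω]
  set c := (∫ x, inner ℝ (g x) (f x) ∂posVol) / q with hc
  have hg' : MemLp (g - c • f) 2 posVol := hg.sub (hf.const_smul c)
  have hdec : wiener hW (g - c • f) =ᵐ[P] fun ω => wiener hW g ω - c * wiener hW f ω := by
    filter_upwards [wiener_sub hW hg (hf.const_smul c), wiener_smul hW c hf] with ω h1 h2
    simp [h1, h2]
  have hint : ∀ {φ : ℝ → EuclideanSpace ℝ (Fin d)}, MemLp φ 2 posVol →
      Integrable (fun ω => wiener hW φ ω * Real.exp (wiener hW f ω)) P := fun hφ =>
    (memLp_wiener hW hφ).integrable_mul (memLp_exp_wiener hW hf)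
  have hcov : cov[wiener hW (g - c • f), wiener hW f; P] = 0 := by
    rw [covariance_eq_sub (memLp_wiener hW hg') (memLp_wiener hW hf), integral_wiener hW hf,
      mul_zero, sub_zero]
    have : ∫ ω, (wiener hW (g - c • f) * wiener hW f) ω ∂P =
        ∫ x, inner ℝ ((g - c • f) x) (f x) ∂posVol := integral_wiener_mul hW hg' hf
    rw [this]
    simp only [Pi.sub_apply, Pi.smul_apply, inner_sub_left, inner_smul_left]
    have hi1 : Integrable (fun x => inner ℝ (g x) (f x)) posVol := integrable_inner_of_memLp hg hf
    have hi2 : Integrable (fun x => inner ℝ (f x) (f x)) posVol := integrable_inner_of_memLp hf hf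
    rw [integral_sub hi1 (hi2.const_mul _), integral_const_mul, ← hqf, hc]
    simp
    field_simp
    simp
  have hind := (hasGaussianLaw_wiener_pair hW hg' hf).indepFun_of_covariance_eq_zero hcov
  have h1 : ∫ ω, wiener hW (g - c • f) ω * Real.exp (wiener hW f ω) ∂P = 0 := by
    have := (hind.comp measurable_id Real.measurable_exp).integral_mul_eq_mul_integral
      (measurable_wiener hW _).aestronglyMeasurable
      (measurable_wiener hW f).exp.aestronglyMeasurable
    simp only [Pi.mul_apply, Function.comp_apply, id_eq] at this
    rw [this, integral_wiener hW hg', zero_mul]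
  have h2 : ∫ ω, wiener hW (g - c • f) ω * Real.exp (wiener hW f ω) ∂P =
      ∫ ω, (wiener hW g ω * Real.exp (wiener hW f ω) -
        c * (wiener hW f ω * Real.exp (wiener hW f ω))) ∂P := by
    refine integral_congr_ae ?_
    filter_upwards [hdec] with ω hω
    rw [hω]; ring
  rw [h2, integral_sub (hint hg) ((hint hf).const_mul c), integral_const_mul,
    integral_wiener_mul_exp_self hW hf, sub_eq_zero] at h1
  rw [h1, hc, ← hq]
  field_simp

lemma memLp_indicator_Ioc (a b : ℝ) (e : EuclideanSpace ℝ (Fin d)) :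
    MemLp ((Ioc a b).indicator fun _ => e) 2 posVol :=
  memLp_indicator_const _ measurableSet_Ioc _ (.inr (posVol_Ioc_ne_top a b))

lemma wiener_indicator_Ioc_zero (j : Fin d) (t : ℝ≥0) :
    wiener hW ((Ioc 0 (t : ℝ)).indicator fun _ => EuclideanSpace.single j 1) =ᵐ[P] W j t := by
  rw [wiener_of_memLp hW (memLp_indicator_Ioc _ _ _)]
  have h1 : (memLp_indicator_Ioc 0 (t : ℝ) (EuclideanSpace.single j (1 : ℝ))).toLp _ =
      stepMap d (Finsupp.single (j, t) 1) := by
    simp [stepMap, stepVec, indicatorConstLp]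
  rw [h1, wienerL_stepMap]
  filter_upwards [coeFn_brownMap hW (Finsupp.single (j, t) 1)] with ω hω
  simp [hω]

lemma wiener_indicator_Ioc (j : Fin d) {a b : ℝ} (ha : 0 ≤ a) (hab : a ≤ b) :
    wiener hW ((Ioc a b).indicator fun _ => EuclideanSpace.single j 1) =ᵐ[P]
      fun ω => W j b.toNNReal ω - W j a.toNNReal ω := by
  have h1 : ((Ioc a b).indicator fun _ => EuclideanSpace.single j (1 : ℝ)) =
      ((Ioc 0 b).indicator fun _ => EuclideanSpace.single j (1 : ℝ)) -
        (Ioc 0 a).indicator fun _ => EuclideanSpace.single j (1 : ℝ) := by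
    ext1 x
    by_cases h1 : a < x
    · simp [indicator, h1, ha.trans_lt h1, not_le.2 h1]
    · have h2 : x ≤ b := (not_lt.1 h1).trans hab
      simp [indicator, not_lt.1 h1, h2]
  rw [h1]
  have hb := wiener_indicator_Ioc_zero hW j b.toNNReal
  have ha' := wiener_indicator_Ioc_zero hW j a.toNNReal
  rw [Real.coe_toNNReal _ (ha.trans hab)] at hb
  rw [Real.coe_toNNReal _ ha] at ha'
  filter_upwards [wiener_sub hW (memLp_indicator_Ioc 0 b (EuclideanSpace.single j (1 : ℝ)))
    (memLp_indicator_Ioc 0 a (EuclideanSpace.single j (1 : ℝ))), hb, ha'] with ω h2 h3 h4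
  rw [h2, Pi.sub_apply, h3, h4]

end WienerFun

/-! ### A continuous adapted version of the running Wiener integral -/

section ContinuousVersion

set_option linter.unusedSectionVars false

variable {Ω : Type*} [MeasurableSpace Ω] {P : Measure Ω} [IsProbabilityMeasure P] {d : ℕ}
  {W : Fin d → ℝ≥0 → Ω → ℝ}

lemma eLpNorm_wiener (hW : IsStdBrownian W P) {f : ℝ → EuclideanSpace ℝ (Fin d)}
    (hf : MemLp f 2 posVol) : eLpNorm (wiener hW f) 2 P = eLpNorm f 2 posVol := by
  have h := norm_wienerL hW (hf.toLp f)
  rw [Lp.norm_toLp, Lp.norm_def] at h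
  rw [wiener_of_memLp hW hf]
  exact (ENNReal.toReal_eq_toReal_iff' (Lp.eLpNorm_ne_top _) hf.eLpNorm_ne_top).1 h

/-- The running stochastic integral of a formal step function. -/
def pathSum (W : Fin d → ℝ≥0 → Ω → ℝ) (v : FormalStep d) (t : ℝ) (ω : Ω) : ℝ :=
  v.sum fun p c => c * W p.1 (min p.2 t.toNNReal) ω

lemma pathSum_sub (v w : FormalStep d) (t : ℝ) (ω : Ω) :
    pathSum W (v - w) t ω = pathSum W v t ω - pathSum W w t ω := by
  rw [pathSum, Finsupp.sum_sub_index (by intros; ring)]; rfl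

lemma continuous_pathSum (v : FormalStep d) {ω : Ω} (h : ∀ j, Continuous fun t => W j t ω) :
    Continuous fun t => pathSum W v t ω := by
  unfold pathSum Finsupp.sum
  refine continuous_finsetSum _ fun p _ => continuous_const.mul ?_
  exact (h p.1).comp (continuous_const.min continuous_real_toNNReal)

lemma measurable_vecW_filtW {s t : ℝ} (hs : 0 ≤ s) (hst : s ≤ t) :
    Measurable[filtW W P t] (vecW W s) := by
  refine Measurable.mono (comap_measurable _) ?_ le_rfl
  exact (le_biSup (fun r => MeasurableSpace.comap (vecW W r) inferInstance)
    (show s ∈ Icc 0 t from ⟨hs, hst⟩)).trans le_sup_left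

lemma measurable_W_filtW (j : Fin d) {s : ℝ≥0} {t : ℝ} (hst : (s : ℝ) ≤ t) :
    Measurable[filtW W P t] (W j s) := by
  have h := measurable_vecW_filtW (W := W) (P := P) s.2 hst
  have h2 : W j s = (fun x : EuclideanSpace ℝ (Fin d) => x j) ∘ vecW W s := by
    ext ω; simp [vecW]
  rw [h2]
  exact Measurable.comp (by fun_prop) h

lemma measurable_pathSum (v : FormalStep d) {t : ℝ} (ht : 0 ≤ t) :
    Measurable[filtW W P t] (pathSum W v t) := by
  refine @Finset.measurable_sum _ _ _ _ _ _ (filtW W P t) _ _ fun p _ => ?_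
  refine Measurable.const_mul (measurable_W_filtW p.1 ?_) _
  simp [ht]

lemma pathSum_ae_eq (hW : IsStdBrownian W P) (v : FormalStep d) {t : ℝ} (ht : 0 ≤ t) :
    pathSum W v t =ᵐ[P] wiener hW ((Ioc 0 t).indicator (stepMap d v)) := by
  have hmem : ∀ w : FormalStep d, MemLp (stepMap d w) 2 posVol := fun w => Lp.memLp _
  have hw : ∀ w : FormalStep d, wiener hW (stepMap d w) = brownMap hW w := fun w => by
    rw [wiener_of_memLp hW (hmem w), ← wienerL_stepMap]; rw [Lp.toLp_coeFn (stepMap d w) (hmem w)]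
  have h1 : (Ioc 0 t).indicator (stepMap d v) =ᵐ[posVol]
      (stepMap d v - stepMap d (FormalStep.tail t.toNNReal v) : ℝ → EuclideanSpace ℝ (Fin d)) := by
    filter_upwards [coeFn_stepMap_tail t.toNNReal v, ae_restrict_mem measurableSet_Ioi] with x hx hx0
    have hx0 : 0 < x := hx0
    rw [Pi.sub_apply, hx]
    have hc : ((t.toNNReal : ℝ≥0) : ℝ) = t := Real.coe_toNNReal t ht
    simp only [indicator, mem_Ioc, hx0, true_and, hc, mem_Ioi]
    by_cases h : x ≤ t
    · rw [if_pos h, if_neg (not_lt.2 h), sub_zero]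
    · rw [if_neg h, if_pos (not_le.1 h), sub_self]
  rw [wiener_congr hW h1]
  filter_upwards [wiener_sub hW (hmem v) (hmem (FormalStep.tail t.toNNReal v)),
    coeFn_brownMap hW v, coeFn_brownMap_tail hW t.toNNReal v] with ω h2 h3 h4
  rw [h2, Pi.sub_apply, hw, hw, h3, h4, pathSum]
  simp only [tailSum, Finsupp.sum]
  rw [← Finset.sum_sub_distrib]
  refine Finset.sum_congr rfl fun p _ => ?_
  ring

lemma memLp_indicator {f : ℝ → EuclideanSpace ℝ (Fin d)} (hf : MemLp f 2 posVol) (a b : ℝ) :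
    MemLp ((Ioc a b).indicator f) 2 posVol := hf.indicator measurableSet_Ioc

lemma indicator_Ioc_sub {E : Type*} [AddCommGroup E] (f : ℝ → E) {s t : ℝ} (hs : 0 ≤ s)
    (hst : s ≤ t) :
    (Ioc s t).indicator f = (Ioc 0 t).indicator f - (Ioc 0 s).indicator f := by
  ext1 x
  by_cases h1 : s < x
  · simp [indicator, h1, hs.trans_lt h1, not_le.2 h1]
  · have h2 : x ≤ t := (not_lt.1 h1).trans hst
    simp [indicator, not_lt.1 h1, h2]

lemma wiener_Ioc_sub (hW : IsStdBrownian W P) {f : ℝ → EuclideanSpace ℝ (Fin d)}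
    (hf : MemLp f 2 posVol) {s t : ℝ} (hs : 0 ≤ s) (hst : s ≤ t) :
    wiener hW ((Ioc s t).indicator f) =ᵐ[P]
      wiener hW ((Ioc 0 t).indicator f) - wiener hW ((Ioc 0 s).indicator f) := by
  rw [indicator_Ioc_sub f hs hst]
  exact wiener_sub hW (memLp_indicator hf _ _) (memLp_indicator hf _ _)

lemma integrable_pathSum (hW : IsStdBrownian W P) (v : FormalStep d) {t : ℝ} (ht : 0 ≤ t) :
    Integrable (pathSum W v t) P :=
  ((memLp_wiener hW (memLp_indicator (Lp.memLp (stepMap d v)) 0 t)).integrable (by norm_num)).congr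
    (pathSum_ae_eq hW v ht).symm

/-- The filtration of the Brownian motion along an increasing sequence of times. -/
def seqFiltration (hW : IsStdBrownian W P) (τ : ℕ → ℝ) (hτ : Monotone τ) :
    Filtration ℕ (inferInstance : MeasurableSpace Ω) where
  seq k := filtW W P (τ k)
  mono' _ _ h := filtW_mono (hτ h)
  le' k := filtW_le hW (τ k)

/-- An increment is the Wiener integral of a function vanishing up to `τ k`, so it has mean zero on
every event of the past. -/
lemma martingale_pathSum (hW : IsStdBrownian W P) (v : FormalStep d) (τ : ℕ → ℝ) (hτ : Monotone τ)
    (h0 : 0 ≤ τ 0) : Martingale (fun k => pathSum W v (τ k)) (seqFiltration hW τ hτ) P := by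
  have hpos : ∀ k, 0 ≤ τ k := fun k => h0.trans (hτ (Nat.zero_le k))
  refine martingale_of_setIntegral_eq_succ
    (fun k => (measurable_pathSum v (hpos k)).stronglyMeasurable)
    (fun k => integrable_pathSum hW v (hpos k)) fun k A hA => ?_
  have hA' : MeasurableSet A := filtW_le hW (τ k) A hA
  have hmem : MemLp (stepMap d v) 2 posVol := Lp.memLp _
  rw [eq_comm, ← sub_eq_zero, ← integral_sub (integrable_pathSum hW v (hpos _)).integrableOn
    (integrable_pathSum hW v (hpos _)).integrableOn]
  have h1 : ∫ ω in A, (pathSum W v (τ (k + 1)) ω - pathSum W v (τ k) ω) ∂P =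
      ∫ ω in A, wiener hW ((Ioc (τ k) (τ (k + 1))).indicator (stepMap d v)) ω ∂P := by
    refine integral_congr_ae (ae_restrict_of_ae ?_)
    filter_upwards [pathSum_ae_eq hW v (hpos (k + 1)), pathSum_ae_eq hW v (hpos k),
      wiener_Ioc_sub hW hmem (hpos k) (hτ (Nat.le_succ k))] with ω h2 h3 h4
    rw [h2, h3, h4, Pi.sub_apply]
  have h2 := integral_mul_wiener hW (memLp_indicator hmem (τ k) (τ (k + 1))) (hpos k)
    (zeroUpTo_indicator_Ioc le_rfl) (η := A.indicator fun _ => 1)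
    (Measurable.indicator measurable_const hA) measurable_id
  simp only [id_eq] at h2
  rw [integral_wiener hW (memLp_indicator hmem _ _), mul_zero] at h2
  rw [h1, ← integral_indicator hA', ← h2]
  refine integral_congr_ae (ae_of_all _ fun ω => ?_)
  by_cases h : ω ∈ A <;> simp [h]

/-- Doob's maximal inequality for the submartingale `|pathSum|`, written as the supremum of a
martingale and its negative; the first moment is bounded by the second through the isometry. -/
lemma measure_exists_pathSum_ge_le (hW : IsStdBrownian W P) (v : FormalStep d) (τ : ℕ → ℝ)
    (hτ : Monotone τ) (h0 : 0 ≤ τ 0) (ε : ℝ≥0) (N : ℕ) :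
    ε * P {ω | ∃ k ≤ N, (ε : ℝ) ≤ |pathSum W v (τ k) ω|} ≤ ENNReal.ofReal ‖stepMap d v‖ := by
  have hM := martingale_pathSum hW v τ hτ h0
  have hsub := hM.submartingale.sup hM.neg.submartingale
  have habs : ∀ k ω, ((fun k => pathSum W v (τ k)) ⊔ -fun k => pathSum W v (τ k)) k ω =
      |pathSum W v (τ k) ω| := fun k ω => rfl
  have hmax := maximal_ineq hsub (fun k ω => by rw [habs]; exact abs_nonneg _) (ε := ε) N
  have hset : {ω | (ε : ℝ) ≤ (Finset.range (N + 1)).sup' Finset.nonempty_range_add_one fun k =>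
      ((fun k => pathSum W v (τ k)) ⊔ -fun k => pathSum W v (τ k)) k ω} =
      {ω | ∃ k ≤ N, (ε : ℝ) ≤ |pathSum W v (τ k) ω|} := by
    ext ω
    simp only [mem_ofPred_eq, Finset.le_sup'_iff, Finset.mem_range, Nat.lt_succ_iff, habs]
  rw [hset] at hmax
  refine hmax.trans (ENNReal.ofReal_le_ofReal ?_)
  have hpos : 0 ≤ τ N := h0.trans (hτ (Nat.zero_le N))
  have hmem : MemLp (stepMap d v) 2 posVol := Lp.memLp _
  calc _ ≤ ∫ ω, |pathSum W v (τ N) ω| ∂P :=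
        setIntegral_le_integral (integrable_pathSum hW v hpos).abs (ae_of_all _ fun _ => abs_nonneg _)
    _ = (eLpNorm (pathSum W v (τ N)) 1 P).toReal := by
        rw [eLpNorm_one_eq_lintegral_enorm, ← integral_norm_eq_lintegral_enorm
          (integrable_pathSum hW v hpos).1]
        rfl
    _ ≤ (eLpNorm (stepMap d v) 2 posVol).toReal := by
        refine ENNReal.toReal_mono (Lp.eLpNorm_ne_top _) ?_
        refine (eLpNorm_le_eLpNorm_of_exponent_le (q := 2) (by norm_num)
          (integrable_pathSum hW v hpos).1).trans ?_
        rw [eLpNorm_congr_ae (pathSum_ae_eq hW v hpos), eLpNorm_wiener hW (memLp_indicator hmem _ _)]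
        exact eLpNorm_indicator_le _
    _ = ‖stepMap d v‖ := (Lp.norm_def _).symm

lemma exists_dyadic_tendsto {T t : ℝ} (hT : 0 < T) (ht : t ∈ Icc 0 T) :
    ∃ k : ℕ → ℕ, (∀ m, k m ≤ 2 ^ m) ∧ Tendsto (fun m => (k m : ℝ) * (T / 2 ^ m)) atTop (𝓝 t) := by
  refine ⟨fun m => ⌊t / T * 2 ^ m⌋₊, fun m => ?_, ?_⟩
  · refine Nat.floor_le_of_le ?_
    push_cast
    exact mul_le_of_le_one_left (by positivity) ((div_le_one hT).2 ht.2)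
  · have h := (tendsto_nat_floor_mul_div_atTop (R := ℝ) (div_nonneg ht.1 hT.le)).comp
      (tendsto_pow_atTop_atTop_of_one_lt (one_lt_two : (1 : ℝ) < 2))
    have h2 := h.mul_const T
    rw [div_mul_cancel₀ _ hT.ne'] at h2
    refine h2.congr fun m => ?_
    simp only [Function.comp_apply]
    ring

/-- Norm `4^{-n}` against threshold `2^{-n}` leaves probability at most `2^{-n}` on each dyadic
grid. The grids are nested, so the bound survives their union; it is summable and Borel-Cantelli
applies. Path continuity passes from grid points to all of `[0,T]`. -/
lemma ae_eventually_pathSum_le (hW : IsStdBrownian W P) {T : ℝ} (hT : 0 < T)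
    (w : ℕ → FormalStep d) (hw : ∀ n, ‖stepMap d (w n)‖ ≤ (1 / 4) ^ n) :
    ∀ᵐ ω ∂P, ∀ᶠ n in atTop, ∀ t ∈ Icc 0 T, |pathSum W (w n) t ω| ≤ (1 / 2) ^ n := by
  let B : ℕ → ℕ → Set Ω := fun n m =>
    {ω | ∃ k : ℕ, k ≤ 2 ^ m ∧ ((1 / 2 : ℝ≥0) ^ n : ℝ≥0) ≤ |pathSum W (w n) (k * (T / 2 ^ m)) ω|}
  have hB : ∀ n m, P (B n m) ≤ ENNReal.ofReal ((1 / 2) ^ n) := by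
    intro n m
    have h := measure_exists_pathSum_ge_le hW (w n) (fun k => k * (T / 2 ^ m))
      (fun a b hab => by simp only; gcongr) (by simp) ((1 / 2) ^ n) (2 ^ m)
    have h2 := h.trans (ENNReal.ofReal_le_ofReal (hw n))
    have h3 : ENNReal.ofReal ((1 / 4) ^ n) =
        (((1 / 2 : ℝ≥0) ^ n : ℝ≥0) : ℝ≥0∞) * ENNReal.ofReal ((1 / 2) ^ n) := by
      rw [← ENNReal.ofReal_coe_nnreal, ← ENNReal.ofReal_mul (by positivity)]
      congr 1
      push_cast
      rw [← mul_pow]; norm_num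
    rw [h3] at h2
    exact (ENNReal.mul_le_mul_iff_right (ENNReal.coe_ne_zero.2 (by positivity)) ENNReal.coe_ne_top).1 h2
  have hmono : ∀ n, Monotone (B n) := by
    intro n
    refine monotone_nat_of_le_succ fun m ω => ?_
    rintro ⟨k, hk, h⟩
    refine ⟨2 * k, by rw [pow_succ]; omega, ?_⟩
    have : ((2 * k : ℕ) : ℝ) * (T / 2 ^ (m + 1)) = k * (T / 2 ^ m) := by
      rw [pow_succ]; push_cast; field_simp
    rw [this]; exact h
  have hU : ∀ n, P (⋃ m, B n m) ≤ ENNReal.ofReal ((1 / 2) ^ n) := fun n => by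
    rw [(hmono n).measure_iUnion]
    exact iSup_le (hB n)
  have hsum : ∑' n, P (⋃ m, B n m) ≠ ∞ := by
    refine ne_top_of_le_ne_top ?_ (ENNReal.tsum_le_tsum hU)
    rw [← ENNReal.ofReal_tsum_of_nonneg (fun n => by positivity) summable_geometric_two]
    exact ENNReal.ofReal_ne_top
  have hcont : ∀ᵐ ω ∂P, ∀ j, Continuous fun t => W j t ω :=
    ae_all_iff.2 fun j => (hW.brownian j).cont
  filter_upwards [ae_eventually_notMem hsum, hcont] with ω hω hc
  filter_upwards [hω] with n hn t ht
  obtain ⟨k, hk, hlim⟩ := exists_dyadic_tendsto hT ht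
  have h1 := ((continuous_pathSum (w n) hc).abs.tendsto t).comp hlim
  refine le_of_tendsto h1 (Eventually.of_forall fun m => ?_)
  by_contra hcon
  refine hn (mem_iUnion.2 ⟨m, k m, hk m, ?_⟩)
  have := (not_le.1 hcon).le
  simpa using this

/-- The sequence is a telescoping sum whose terms are eventually bounded, uniformly in time, by a
geometric series, so the Weierstrass test gives a continuous limit. -/
lemma ae_exists_limit_pathSum (hW : IsStdBrownian W P) {T : ℝ} (hT : 0 < T)
    (v : ℕ → FormalStep d) (hv : ∀ n, ‖stepMap d (v (n + 1) - v n)‖ ≤ (1 / 4) ^ n) :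
    ∀ᵐ ω ∂P, ∃ L : ℝ → ℝ, ContinuousOn L (Icc 0 T) ∧
      ∀ t ∈ Icc 0 T, Tendsto (fun n => pathSum W (v n) t ω) atTop (𝓝 (L t)) := by
  have hcont : ∀ᵐ ω ∂P, ∀ j, Continuous fun t => W j t ω :=
    ae_all_iff.2 fun j => (hW.brownian j).cont
  filter_upwards [ae_eventually_pathSum_le hW hT _ hv, hcont] with ω hω hc
  obtain ⟨N, hN⟩ := eventually_atTop.1 hω
  have hb : ∀ n, ∀ t ∈ Icc 0 T, ‖pathSum W (v (n + N + 1) - v (n + N)) t ω‖ ≤ (1 / 2) ^ n :=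
    fun n t ht => (hN (n + N) (by omega) t ht).trans
      (pow_le_pow_of_le_one (by norm_num) (by norm_num) (by omega))
  refine ⟨fun t => pathSum W (v N) t ω + ∑' n, pathSum W (v (n + N + 1) - v (n + N)) t ω, ?_, ?_⟩
  · exact (continuous_pathSum (v N) hc).continuousOn.add (continuousOn_tsum
      (fun n => (continuous_pathSum _ hc).continuousOn) summable_geometric_two hb)
  · intro t ht
    have hs : Summable fun n => pathSum W (v (n + N + 1) - v (n + N)) t ω :=
      Summable.of_norm_bounded summable_geometric_two fun n => hb n t ht
    have h1 := (hs.hasSum.tendsto_sum_nat).const_add (pathSum W (v N) t ω)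
    refine (tendsto_add_atTop_iff_nat N).1 (h1.congr fun n => ?_)
    have h2 : ∀ i, pathSum W (v (i + N + 1) - v (i + N)) t ω =
        pathSum W (v (i + 1 + N)) t ω - pathSum W (v (i + N)) t ω := fun i => by
      rw [pathSum_sub]; congr 3; omega
    simp only [h2]
    rw [Finset.sum_range_sub (fun i => pathSum W (v (i + N)) t ω)]
    simp

/-- The running Wiener integral `∫_0^t y' dW` has a version which is continuous and adapted to the
augmented filtration. -/
theorem exists_continuous_version (hW : IsStdBrownian W P) {T : ℝ} (hT : 0 < T)
    {y : ℝ → EuclideanSpace ℝ (Fin d)} (hy : MemLp y 2 posVol) :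
    ∃ M : ℝ → Ω → ℝ, (∀ ω, Continuous fun t => M t ω) ∧
      (∀ t ∈ Icc 0 T, Measurable[filtW W P t] (M t)) ∧
      ∀ t ∈ Icc 0 T, M t =ᵐ[P] wiener hW ((Ioc 0 t).indicator y) := by
  -- Errors of `4^{-n}/4` keep consecutive approximations within `4^{-n}`, the rate needed for
  -- Borel-Cantelli.
  have hv : ∀ n : ℕ, ∃ v : FormalStep d, dist (hy.toLp y) (stepMap d v) < (1 / 4) ^ n / 4 :=
    fun n => (denseRange_stepMap d).exists_dist_lt _ (by positivity)
  choose v hv using hv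
  have hdiff : ∀ n, ‖stepMap d (v (n + 1) - v n)‖ ≤ (1 / 4) ^ n := fun n => by
    rw [map_sub, ← dist_eq_norm]
    have h1 := dist_triangle_left (stepMap d (v (n + 1))) (stepMap d (v n)) (hy.toLp y)
    have h2 := hv (n + 1)
    have h3 := hv n
    have h4 : (0 : ℝ) < (1 / 4) ^ n := by positivity
    rw [pow_succ] at h2
    linarith
  have hlim := ae_exists_limit_pathSum hW hT v hdiff
  -- A measurable null set belongs to the augmented filtration at every time, so setting the version
  -- to zero on `N` preserves adaptedness.
  set N := toMeasurable P {ω | ¬ ∃ L : ℝ → ℝ, ContinuousOn L (Icc 0 T) ∧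
      ∀ t ∈ Icc 0 T, Tendsto (fun n => pathSum W (v n) t ω) atTop (𝓝 (L t))} with hN
  have hN0 : P N = 0 := by rw [hN, measure_toMeasurable]; exact hlim
  have hNm : MeasurableSet N := measurableSet_toMeasurable _ _
  have hgood : ∀ ω, ω ∉ N → ∃ L : ℝ → ℝ, ContinuousOn L (Icc 0 T) ∧
      ∀ t ∈ Icc 0 T, Tendsto (fun n => pathSum W (v n) t ω) atTop (𝓝 (L t)) := by
    intro ω hω
    by_contra h
    exact hω (subset_toMeasurable _ _ h)
  choose! L hLc hLt using hgood
  classical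
  let M : ℝ → Ω → ℝ := fun t ω => if ω ∈ N then 0 else L ω (projIcc 0 T hT.le t)
  have hMt : ∀ t ∈ Icc 0 T, ∀ ω,
      Tendsto (fun n => if ω ∈ N then 0 else pathSum W (v n) t ω) atTop (𝓝 (M t ω)) := by
    intro t ht ω
    by_cases h : ω ∈ N
    · simp [M, h]
    · simpa [M, h, projIcc_of_mem hT.le ht] using hLt ω h t ht
  refine ⟨M, fun ω => ?_, fun t ht => ?_, fun t ht => ?_⟩
  · by_cases h : ω ∈ N
    · simpa [M, h] using continuous_const
    · simp only [M, h, if_false]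
      exact (hLc ω h).comp_continuous (continuous_subtype_val.comp continuous_projIcc)
        fun t => (projIcc 0 T hT.le t).2
  · refine @measurable_of_tendsto_metrizable _ _ (filtW W P t) _ _ _ _ _ _ (fun n => ?_)
      (tendsto_pi_nhds.2 (hMt t ht))
    refine Measurable.ite ?_ measurable_const (measurable_pathSum (v n) ht.1)
    have : MeasurableSpace.generateFrom {A | MeasurableSet A ∧ P A = 0} ≤ filtW W P t := le_sup_right
    exact this _ (MeasurableSpace.measurableSet_generateFrom ⟨hNm, hN0⟩)
  · have hNae : ∀ᵐ ω ∂P, ω ∉ N := measure_eq_zero_iff_ae_notMem.1 hN0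
    have hm : ∀ n, Measurable (pathSum W (v n) t) := fun n =>
      (measurable_pathSum (v n) ht.1).mono (filtW_le hW t) le_rfl
    have h1 : TendstoInMeasure P (fun n => pathSum W (v n) t) atTop (M t) := by
      refine tendstoInMeasure_of_tendsto_ae (fun n => (hm n).aestronglyMeasurable) ?_
      filter_upwards [hNae] with ω hω
      simpa [hω] using hMt t ht ω
    -- The pathwise limit and the `L²` limit are both limits in measure, hence equal almost surely.
    refine tendstoInMeasure_ae_unique h1 (tendstoInMeasure_of_tendsto_eLpNorm (p := 2) (by norm_num)
      (fun n => (hm n).aestronglyMeasurable) (measurable_wiener hW _).aestronglyMeasurable ?_)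
    have hbound : ∀ n, eLpNorm (pathSum W (v n) t - wiener hW ((Ioc 0 t).indicator y)) 2 P ≤
        ENNReal.ofReal ((1 / 4) ^ n / 4) := fun n => by
      have hmem : MemLp (stepMap d (v n)) 2 posVol := Lp.memLp _
      have e1 : pathSum W (v n) t - wiener hW ((Ioc 0 t).indicator y) =ᵐ[P]
          wiener hW ((Ioc 0 t).indicator (stepMap d (v n) - y : ℝ → EuclideanSpace ℝ (Fin d))) := by
        rw [indicator_sub']
        filter_upwards [wiener_sub hW (memLp_indicator hmem 0 t) (memLp_indicator hy 0 t),
          pathSum_ae_eq hW (v n) ht.1] with ω h2 h3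
        rw [h2, Pi.sub_apply, Pi.sub_apply, h3]
      rw [eLpNorm_congr_ae e1, eLpNorm_wiener hW (memLp_indicator (hmem.sub hy) 0 t)]
      refine (eLpNorm_indicator_le _).trans ?_
      have h5 := (hv n).le
      rw [dist_comm, Lp.dist_def] at h5
      have h6 : eLpNorm (stepMap d (v n) - y : ℝ → EuclideanSpace ℝ (Fin d)) 2 posVol =
          eLpNorm (stepMap d (v n) - hy.toLp y : ℝ → EuclideanSpace ℝ (Fin d)) 2 posVol :=
        eLpNorm_congr_ae ((EventuallyEq.refl _ _).sub hy.coeFn_toLp.symm)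
      rw [h6]
      refine (ENNReal.le_ofReal_iff_toReal_le ?_ (by positivity)).2 h5
      exact (hmem.sub (Lp.memLp _)).eLpNorm_ne_top
    refine tendsto_of_tendsto_of_tendsto_of_le_of_le tendsto_const_nhds ?_ (fun _ => zero_le) hbound
    rw [← ENNReal.ofReal_zero]
    refine ENNReal.tendsto_ofReal ?_
    have := (tendsto_pow_atTop_nhds_zero_of_lt_one (r := (1 / 4 : ℝ)) (by norm_num)
      (by norm_num)).div_const 4
    simpa using this

end ContinuousVersion

/-! ### Calculus of absolutely continuous functions and Gronwall's inequality -/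

section Primitive

/-- `F` is absolutely continuous on `[0,T]` with almost everywhere derivative `f`. -/
structure IsPrimitive (T : ℝ) (F f : ℝ → ℝ) : Prop where
  intervalIntegrable : IntervalIntegrable f volume 0 T
  eq_add_integral : ∀ t ∈ Icc 0 T, F t = F 0 + ∫ s in (0 : ℝ)..t, f s

variable {T : ℝ} {F f G g : ℝ → ℝ}

lemma absolutelyContinuousOnInterval_congr {a b : ℝ} (hF : AbsolutelyContinuousOnInterval F a b)
    (h : ∀ t ∈ uIcc a b, G t = F t) : AbsolutelyContinuousOnInterval G a b := by
  rw [absolutelyContinuousOnInterval_iff] at hF ⊢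
  intro ε hε
  obtain ⟨δ, hδ, hE⟩ := hF ε hε
  refine ⟨δ, hδ, fun E h1 h2 => ?_⟩
  rw [Finset.sum_congr rfl fun i hi => by rw [h _ (h1.1 i hi).1, h _ (h1.1 i hi).2]]
  exact hE E h1 h2

/-- `F` is bounded on the interval, and a `C¹` function is Lipschitz on a compact interval
containing its values. -/
lemma absolutelyContinuousOnInterval_comp {a b : ℝ} (hF : AbsolutelyContinuousOnInterval F a b)
    {φ : ℝ → ℝ} (hφ : ContDiff ℝ 1 φ) : AbsolutelyContinuousOnInterval (fun t => φ (F t)) a b := by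
  obtain ⟨C, hC⟩ := hF.exists_bound
  obtain ⟨K, hK⟩ := (hφ.contDiffOn (s := Icc (-C) C)).exists_lipschitzOnWith (by decide)
    (convex_Icc _ _) isCompact_Icc
  have hmem : ∀ t ∈ uIcc a b, F t ∈ Icc (-C) C := fun t ht => abs_le.1 (hC t ht)
  rw [absolutelyContinuousOnInterval_iff] at hF ⊢
  intro ε hε
  obtain ⟨δ, hδ, hE⟩ := hF (ε / (K + 1)) (by positivity)
  refine ⟨δ, hδ, fun E h1 h2 => ?_⟩
  have h3 := hE E h1 h2
  rw [lt_div_iff₀ (by positivity)] at h3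
  calc _ ≤ ∑ i ∈ Finset.range E.1, K * dist (F (E.2 i).1) (F (E.2 i).2) :=
        Finset.sum_le_sum fun i hi => hK.dist_le_mul _ (hmem _ (h1.1 i hi).1) _ (hmem _ (h1.1 i hi).2)
    _ ≤ _ := by
        rw [← Finset.mul_sum]
        nlinarith [K.2, Finset.sum_nonneg (s := Finset.range E.1)
          (f := fun i => dist (F (E.2 i).1) (F (E.2 i).2)) fun _ _ => dist_nonneg]
    _ < ε := h3

namespace IsPrimitive

lemma absolutelyContinuous (hT : 0 ≤ T) (hF : IsPrimitive T F f) :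
    AbsolutelyContinuousOnInterval F 0 T := by
  have h1 := hF.intervalIntegrable.absolutelyContinuousOnInterval_intervalIntegral
    (c := 0) left_mem_uIcc
  have h2 : AbsolutelyContinuousOnInterval (fun _ : ℝ => F 0) 0 T :=
    (LipschitzWith.const (F 0)).lipschitzOnWith.absolutelyContinuousOnInterval
  refine absolutelyContinuousOnInterval_congr (h2.add h1) fun t ht => ?_
  rw [uIcc_of_le hT] at ht
  exact hF.eq_add_integral t ht

lemma ae_hasDerivAt (hT : 0 ≤ T) (hF : IsPrimitive T F f) :
    ∀ᵐ t, t ∈ Ioo 0 T → HasDerivAt F (f t) t := by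
  filter_upwards [hF.intervalIntegrable.ae_hasDerivAt_integral] with t ht h
  rw [uIcc_of_le hT] at ht
  have h1 := (ht ⟨h.1.le, h.2.le⟩ 0 ⟨le_rfl, hT⟩).const_add (F 0)
  refine h1.congr_of_eventuallyEq ?_
  filter_upwards [Ioo_mem_nhds h.1 h.2] with s hs
  exact hF.eq_add_integral s ⟨hs.1.le, hs.2.le⟩

lemma of_absolutelyContinuous (hT : 0 ≤ T) (hF : AbsolutelyContinuousOnInterval F 0 T)
    (hd : ∀ᵐ t, t ∈ Ioo 0 T → HasDerivAt F (f t) t) : IsPrimitive T F f := by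
  have hne : ∀ᵐ t : ℝ, t ≠ T := by simp [ae_iff, measure_singleton]
  have hae : ∀ᵐ t, t ∈ Ioc 0 T → deriv F t = f t := by
    filter_upwards [hd, hne] with t ht h1 h2
    exact (ht ⟨h2.1, lt_of_le_of_ne h2.2 h1⟩).deriv
  refine ⟨?_, fun t ht => ?_⟩
  · refine hF.intervalIntegrable_deriv.congr_ae ?_
    rw [uIoc_of_le hT]
    exact (ae_restrict_iff' measurableSet_Ioc).2 hae
  · have h1 : AbsolutelyContinuousOnInterval F 0 t := hF.mono (by
      rw [uIcc_of_le hT, uIcc_of_le ht.1]; exact Icc_subset_Icc_right ht.2)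
    have h2 : ∫ s in (0 : ℝ)..t, f s = ∫ s in (0 : ℝ)..t, deriv F s := by
      refine intervalIntegral.integral_congr_ae ?_
      filter_upwards [hae] with s hs h
      rw [uIoc_of_le ht.1] at h
      exact (hs ⟨h.1, h.2.trans ht.2⟩).symm
    rw [h2, h1.integral_deriv_eq_sub]; ring

lemma of_intervalIntegrable (hf : IntervalIntegrable f volume 0 T) (c : ℝ) :
    IsPrimitive T (fun t => c + ∫ s in (0 : ℝ)..t, f s) f :=
  ⟨hf, fun t _ => by simp⟩

lemma continuousOn (hT : 0 ≤ T) (hF : IsPrimitive T F f) : ContinuousOn F (Icc 0 T) := by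
  have := (hF.absolutelyContinuous hT).continuousOn
  rwa [uIcc_of_le hT] at this

lemma mul (hT : 0 ≤ T) (hF : IsPrimitive T F f) (hG : IsPrimitive T G g) :
    IsPrimitive T (fun t => F t * G t) (fun t => f t * G t + F t * g t) := by
  refine of_absolutelyContinuous hT
    ((hF.absolutelyContinuous hT).fun_mul (hG.absolutelyContinuous hT)) ?_
  filter_upwards [hF.ae_hasDerivAt hT, hG.ae_hasDerivAt hT] with t h1 h2 h
  exact (h1 h).mul (h2 h)

lemma exp (hT : 0 ≤ T) (hF : IsPrimitive T F f) :
    IsPrimitive T (fun t => Real.exp (F t)) (fun t => Real.exp (F t) * f t) := by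
  refine of_absolutelyContinuous hT (absolutelyContinuousOnInterval_comp
    (hF.absolutelyContinuous hT) Real.contDiff_exp) ?_
  filter_upwards [hF.ae_hasDerivAt hT] with t h1 h
  exact (h1 h).exp

lemma neg (hF : IsPrimitive T F f) : IsPrimitive T (fun t => -F t) (fun t => -f t) := by
  refine ⟨hF.intervalIntegrable.neg, fun t ht => ?_⟩
  rw [hF.eq_add_integral t ht, intervalIntegral.integral_neg]; ring

lemma const_mul (c : ℝ) (hF : IsPrimitive T F f) :
    IsPrimitive T (fun t => c * F t) (fun t => c * f t) := by
  refine ⟨hF.intervalIntegrable.const_mul c, fun t ht => ?_⟩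
  rw [hF.eq_add_integral t ht, intervalIntegral.integral_const_mul]; ring

lemma mono {t : ℝ} (ht : t ∈ Icc 0 T) (hF : IsPrimitive T F f) : IsPrimitive t F f :=
  ⟨hF.intervalIntegrable.mono_set (by
    rw [uIcc_of_le (ht.1.trans ht.2), uIcc_of_le ht.1]; exact Icc_subset_Icc_right ht.2),
    fun s hs => hF.eq_add_integral s ⟨hs.1, hs.2.trans ht.2⟩⟩

end IsPrimitive

/-- Gronwall's inequality with an integrable kernel. -/
lemma eq_zero_of_le_integral_mul {κ : ℝ → ℝ} (hκ : IntervalIntegrable κ volume 0 T)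
    (hκ0 : ∀ t ∈ Icc 0 T, 0 ≤ κ t) (hg : IntervalIntegrable (fun t => κ t * g t) volume 0 T)
    (hg0 : ∀ t ∈ Icc 0 T, 0 ≤ g t)
    (h : ∀ t ∈ Icc 0 T, g t ≤ ∫ s in (0 : ℝ)..t, κ s * g s) : ∀ t ∈ Icc 0 T, g t = 0 := by
  intro t ht
  have hT : 0 ≤ T := ht.1.trans ht.2
  have h1 := IsPrimitive.of_intervalIntegrable hg 0
  -- Integrating factor: the derivative of `(∫ κ g) exp(-∫ κ)` is `κ (g - ∫ κ g) exp(-∫ κ)`, which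
  -- the hypothesis makes nonpositive.
  have h2 := (IsPrimitive.of_intervalIntegrable hκ 0).neg.exp hT
  have h3 := (h1.mul hT h2).eq_add_integral t ht
  simp only [zero_add, intervalIntegral.integral_same, neg_zero, Real.exp_zero, mul_one] at h3
  have h4 : (∫ s in (0 : ℝ)..t, κ s * g s * Real.exp (-∫ u in (0 : ℝ)..s, κ u) +
      (∫ u in (0 : ℝ)..s, κ u * g u) * (Real.exp (-∫ u in (0 : ℝ)..s, κ u) * -κ s)) ≤ 0 := by
    rw [intervalIntegral.integral_of_le ht.1]
    refine setIntegral_nonpos measurableSet_Ioc fun s hs => ?_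
    have hs' : s ∈ Icc 0 T := ⟨hs.1.le, hs.2.trans ht.2⟩
    have h5 := mul_le_mul_of_nonneg_left (h s hs') (hκ0 s hs')
    nlinarith [Real.exp_pos (-∫ u in (0 : ℝ)..s, κ u)]
  rw [← h3] at h4
  have h5 : (∫ s in (0 : ℝ)..t, κ s * g s) ≤ 0 :=
    nonpos_of_mul_nonpos_left h4 (Real.exp_pos _)
  exact le_antisymm ((h t ht).trans h5) (hg0 t ht)

end Primitive

/-! ### The stochastic exponential: martingale property and pairings -/

section ExpMart

set_option linter.unusedSectionVars false

variable {Ω : Type*} [MeasurableSpace Ω] {P : Measure Ω} [IsProbabilityMeasure P] {d : ℕ}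
  {W : Fin d → ℝ≥0 → Ω → ℝ}

lemma integral_posVol_indicator (h : ℝ → ℝ) {a b : ℝ} (ha : 0 ≤ a) (hab : a ≤ b) :
    ∫ s, (Ioc a b).indicator h s ∂posVol = ∫ s in a..b, h s := by
  rw [integral_indicator measurableSet_Ioc, posVol, Measure.restrict_restrict measurableSet_Ioc,
    inter_eq_self_of_subset_left (show Ioc a b ⊆ Ioi 0 from fun s hs => ha.trans_lt hs.1),
    intervalIntegral.integral_of_le hab]

variable {y : ℝ → EuclideanSpace ℝ (Fin d)}

lemma integral_norm_indicator_sq {a b : ℝ} (ha : 0 ≤ a) (hab : a ≤ b) :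
    ∫ s, ‖(Ioc a b).indicator y s‖ ^ 2 ∂posVol = ∫ s in a..b, ‖y s‖ ^ 2 := by
  rw [← integral_posVol_indicator _ ha hab]
  refine integral_congr_ae (ae_of_all _ fun s => ?_)
  by_cases h : s ∈ Ioc a b <;> simp [h]

lemma integral_inner_indicator (f : ℝ → EuclideanSpace ℝ (Fin d)) {a b : ℝ} (ha : 0 ≤ a)
    (hab : a ≤ b) :
    ∫ s, inner ℝ (f s) ((Ioc a b).indicator y s) ∂posVol = ∫ s in a..b, inner ℝ (f s) (y s) := by
  rw [← integral_posVol_indicator _ ha hab]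
  refine integral_congr_ae (ae_of_all _ fun s => ?_)
  by_cases h : s ∈ Ioc a b <;> simp [h]

lemma intervalIntegrable_of_posVol {h : ℝ → ℝ} (hh : Integrable h posVol) {a b : ℝ} (ha : 0 ≤ a)
    (hab : a ≤ b) : IntervalIntegrable h volume a b := by
  rw [intervalIntegrable_iff_integrableOn_Ioc_of_le hab]
  exact IntegrableOn.mono_set hh fun s hs => ha.trans_lt hs.1

lemma integrable_norm_sq (hy : MemLp y 2 posVol) : Integrable (fun s => ‖y s‖ ^ 2) posVol :=
  (memLp_two_iff_integrable_sq_norm hy.1).1 hy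

lemma intervalIntegrable_norm_sq (hy : MemLp y 2 posVol) {a b : ℝ} (ha : 0 ≤ a) (hab : a ≤ b) :
    IntervalIntegrable (fun s => ‖y s‖ ^ 2) volume a b :=
  intervalIntegrable_of_posVol (integrable_norm_sq hy) ha hab

/-- The stochastic exponential of `∫_0^t y' dW`. -/
def expMart (hW : IsStdBrownian W P) (y : ℝ → EuclideanSpace ℝ (Fin d)) (t : ℝ) (ω : Ω) : ℝ :=
  Real.exp (wiener hW ((Ioc 0 t).indicator y) ω - (∫ s in (0 : ℝ)..t, ‖y s‖ ^ 2) / 2)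

variable (hW : IsStdBrownian W P)

/-- `wiener` is just a representative of an `L²` class, with no adaptedness built in. The
independence lemmas need factors measurable with respect to the past, which the continuous version
supplies. -/
lemma exists_measurable_filtW_ae_eq (hy : MemLp y 2 posVol) {t : ℝ} (ht : 0 ≤ t) :
    ∃ N : Ω → ℝ, Measurable[filtW W P t] N ∧ N =ᵐ[P] wiener hW ((Ioc 0 t).indicator y) := by
  obtain ⟨M, -, h1, h2⟩ := exists_continuous_version hW (show 0 < t + 1 by linarith) hy
  exact ⟨M t, h1 t ⟨ht, by linarith⟩, h2 t ⟨ht, by linarith⟩⟩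

lemma exists_measurable_filtW_expMart (hy : MemLp y 2 posVol) {t : ℝ} (ht : 0 ≤ t) :
    ∃ N : Ω → ℝ, Measurable[filtW W P t] N ∧ N =ᵐ[P] expMart hW y t := by
  obtain ⟨N, h1, h2⟩ := exists_measurable_filtW_ae_eq hW hy ht
  refine ⟨fun ω => Real.exp (N ω - (∫ s in (0 : ℝ)..t, ‖y s‖ ^ 2) / 2),
    (h1.sub_const _).exp, ?_⟩
  filter_upwards [h2] with ω h
  rw [expMart, h]

lemma measurable_expMart (t : ℝ) : Measurable (expMart hW y t) :=
  ((measurable_wiener hW _).sub_const _).exp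

lemma memLp_expMart (hy : MemLp y 2 posVol) (t : ℝ) : MemLp (expMart hW y t) 2 P := by
  have h := (memLp_exp_wiener hW (memLp_indicator hy 0 t)).const_mul
    (Real.exp (-((∫ s in (0 : ℝ)..t, ‖y s‖ ^ 2) / 2)))
  convert h using 1
  ext ω
  rw [expMart, ← Real.exp_add]; ring_nf

lemma expMart_zero (hy : MemLp y 2 posVol) : expMart hW y 0 =ᵐ[P] fun _ => 1 := by
  have h : wiener hW ((Ioc 0 0).indicator y) =ᵐ[P] 0 :=
    wiener_eq_zero hW (memLp_indicator hy 0 0) (by simp)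
  filter_upwards [h] with ω h
  rw [expMart, h]; simp

lemma expMart_eq_mul (hy : MemLp y 2 posVol) {s t : ℝ} (hs : 0 ≤ s) (hst : s ≤ t) :
    expMart hW y t =ᵐ[P] fun ω => expMart hW y s ω *
      (Real.exp (wiener hW ((Ioc s t).indicator y) ω) *
        Real.exp (-((∫ u in s..t, ‖y u‖ ^ 2) / 2))) := by
  filter_upwards [wiener_Ioc_sub hW hy hs hst] with ω h
  rw [expMart, expMart, h, ← Real.exp_add, ← Real.exp_add, Pi.sub_apply,
    ← intervalIntegral.integral_add_adjacent_intervals (intervalIntegrable_norm_sq hy le_rfl hs)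
      (intervalIntegrable_norm_sq hy hs hst)]
  ring_nf

/-- The martingale property in weak form: the factor of the exponential over `(s,t]` is independent
of the past and has mean one. -/
lemma integral_mul_expMart (hy : MemLp y 2 posVol) {s t : ℝ} (hs : 0 ≤ s) (hst : s ≤ t)
    {η : Ω → ℝ} (hη : Measurable[filtW W P s] η) :
    ∫ ω, η ω * expMart hW y t ω ∂P = ∫ ω, η ω * expMart hW y s ω ∂P := by
  obtain ⟨N, hN, hNe⟩ := exists_measurable_filtW_expMart hW hy hs
  have hf := memLp_indicator hy s t
  have h1 := integral_mul_wiener hW hf hs (zeroUpTo_indicator_Ioc le_rfl) (hη.mul hN)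
    (h := fun z => Real.exp z * Real.exp (-((∫ u in s..t, ‖y u‖ ^ 2) / 2))) (by fun_prop)
  rw [integral_mul_const, integral_exp_wiener hW hf, integral_norm_indicator_sq hs hst,
    ← Real.exp_add, add_neg_cancel, Real.exp_zero, mul_one] at h1
  calc _ = ∫ ω, (η * N) ω * (Real.exp (wiener hW ((Ioc s t).indicator y) ω) *
        Real.exp (-((∫ u in s..t, ‖y u‖ ^ 2) / 2))) ∂P := by
        refine integral_congr_ae ?_
        filter_upwards [expMart_eq_mul hW hy hs hst, hNe] with ω h2 h3
        rw [h2, Pi.mul_apply, h3, mul_assoc]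
    _ = ∫ ω, (η * N) ω ∂P := h1
    _ = _ := by
        refine integral_congr_ae ?_
        filter_upwards [hNe] with ω h3
        rw [Pi.mul_apply, h3]

lemma integral_expMart (hy : MemLp y 2 posVol) {t : ℝ} (ht : 0 ≤ t) :
    ∫ ω, expMart hW y t ω ∂P = 1 := by
  have h := integral_mul_expMart hW hy le_rfl ht (η := fun _ => 1) measurable_const
  simp only [one_mul] at h
  rw [h, integral_congr_ae (expMart_zero hW hy)]; simp

lemma integral_expMart_mul_self (hy : MemLp y 2 posVol) {t : ℝ} (ht : 0 ≤ t) :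
    ∫ ω, expMart hW y t ω * expMart hW y t ω ∂P = Real.exp (∫ s in (0 : ℝ)..t, ‖y s‖ ^ 2) := by
  have h := mgf_wiener hW (memLp_indicator hy 0 t) 2
  rw [integral_norm_indicator_sq le_rfl ht, mgf] at h
  have h2 : ∀ ω, expMart hW y t ω * expMart hW y t ω =
      Real.exp (2 * wiener hW ((Ioc 0 t).indicator y) ω) *
        Real.exp (-∫ s in (0 : ℝ)..t, ‖y s‖ ^ 2) := fun ω => by
    rw [expMart, ← Real.exp_add, ← Real.exp_add]; ring_nf
  simp only [h2]
  rw [integral_mul_const, h, ← Real.exp_add]; ring_nf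

lemma integral_expMart_mul (hy : MemLp y 2 posVol) {s t : ℝ} (hs : 0 ≤ s) (hst : s ≤ t) :
    ∫ ω, expMart hW y s ω * expMart hW y t ω ∂P = Real.exp (∫ u in (0 : ℝ)..s, ‖y u‖ ^ 2) := by
  obtain ⟨N, hN, hNe⟩ := exists_measurable_filtW_expMart hW hy hs
  have e : ∀ r, ∫ ω, expMart hW y s ω * expMart hW y r ω ∂P = ∫ ω, N ω * expMart hW y r ω ∂P :=
    fun r => integral_congr_ae (by filter_upwards [hNe] with ω h; rw [h])
  rw [e, integral_mul_expMart hW hy hs hst hN, ← e, integral_expMart_mul_self hW hy hs]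

variable {f g : ℝ → EuclideanSpace ℝ (Fin d)}

/-- If `a ≤ s`, split the exponential at `a`: the part after `a` is independent of the past and
`integral_wiener_mul_exp` evaluates it, while starting the time integral at 0 costs nothing because
`f` vanishes before `a`. If `s ≤ a`, both sides are zero. -/
lemma integral_mul_wiener_mul_expMart (hy : MemLp y 2 posVol) (hf : MemLp f 2 posVol) {a s : ℝ}
    (ha : 0 ≤ a) (hf0 : ZeroUpTo a f) (hs : 0 ≤ s) {η : Ω → ℝ} (hη : Measurable[filtW W P a] η) :
    ∫ ω, η ω * wiener hW f ω * expMart hW y s ω ∂P =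
      (∫ ω, η ω * expMart hW y a ω ∂P) * ∫ u in (0 : ℝ)..s, inner ℝ (f u) (y u) := by
  rcases le_total a s with has | hsa
  · obtain ⟨N, hN, hNe⟩ := exists_measurable_filtW_expMart hW hy ha
    have hy' := memLp_indicator hy a s
    have h1 := integral_mul_wiener_pair hW hf hy' ha hf0 (zeroUpTo_indicator_Ioc le_rfl)
      (hη.mul hN) (h := fun z => z.1 * Real.exp z.2 * Real.exp (-((∫ u in a..s, ‖y u‖ ^ 2) / 2)))
      (by fun_prop)
    rw [integral_mul_const, integral_wiener_mul_exp hW hy' hf, integral_norm_indicator_sq ha has,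
      mul_assoc, ← Real.exp_add, add_neg_cancel, Real.exp_zero, mul_one] at h1
    have h0 : ∫ u, inner ℝ (f u) ((Ioc a s).indicator y u) ∂posVol =
        ∫ u, inner ℝ (f u) ((Ioc 0 s).indicator y u) ∂posVol := by
      refine integral_congr_ae ?_
      filter_upwards [hf0, ae_restrict_mem measurableSet_Ioi] with u h2 h3
      have h3 : 0 < u := h3
      by_cases h : u ≤ a
      · simp [h2 h]
      · simp [indicator, h3, not_le.1 h]
    rw [h0, integral_inner_indicator f le_rfl hs] at h1
    calc _ = ∫ ω, (η * N) ω * (wiener hW f ω * Real.exp (wiener hW ((Ioc a s).indicator y) ω) *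
          Real.exp (-((∫ u in a..s, ‖y u‖ ^ 2) / 2))) ∂P := by
          refine integral_congr_ae ?_
          filter_upwards [expMart_eq_mul hW hy ha has, hNe] with ω h2 h3
          rw [h2, Pi.mul_apply, h3]; ring
      _ = _ := h1
      _ = _ := by
          congr 1
          refine integral_congr_ae ?_
          filter_upwards [hNe] with ω h3
          rw [Pi.mul_apply, h3]
  · obtain ⟨N, hN, hNe⟩ := exists_measurable_filtW_expMart hW hy hs
    have hN' : Measurable[filtW W P a] N := hN.mono (filtW_mono hsa) le_rfl
    have h1 := integral_mul_wiener hW hf ha hf0 (hη.mul hN') measurable_id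
    simp only [id_eq] at h1
    rw [integral_wiener hW hf, mul_zero] at h1
    have h0 : ∫ u in (0 : ℝ)..s, inner ℝ (f u) (y u) = 0 := by
      rw [← integral_inner_indicator f le_rfl hs]
      refine (integral_congr_ae ?_).trans (integral_zero _ _)
      filter_upwards [hf0] with u h2
      by_cases h : u ≤ s
      · simp [h2 (h.trans hsa)]
      · simp [indicator, h]
    rw [h0, mul_zero, ← h1]
    refine integral_congr_ae ?_
    filter_upwards [hNe] with ω h3
    rw [Pi.mul_apply, h3]; ring

lemma integral_mul_wiener_mul_wiener (hf : MemLp f 2 posVol) (hg : MemLp g 2 posVol) {a : ℝ}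
    (ha : 0 ≤ a) (hf0 : ZeroUpTo a f) (hg0 : ZeroUpTo a g) {η η' : Ω → ℝ}
    (hη : Measurable[filtW W P a] η) (hη' : Measurable[filtW W P a] η') :
    ∫ ω, (η ω * wiener hW f ω) * (η' ω * wiener hW g ω) ∂P =
      (∫ ω, η ω * η' ω ∂P) * ∫ u, inner ℝ (f u) (g u) ∂posVol := by
  have h1 := integral_mul_wiener_pair hW hf hg ha hf0 hg0 (hη.mul hη') (h := fun z => z.1 * z.2)
    (by fun_prop)
  rw [integral_wiener_mul hW hf hg] at h1
  simp only [Pi.mul_apply] at h1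
  rw [← h1]
  exact integral_congr_ae (ae_of_all _ fun ω => by ring)

lemma integral_mul_wiener_eq_zero (hg : MemLp g 2 posVol) {a : ℝ} (ha : 0 ≤ a)
    (hg0 : ZeroUpTo a g) {η U V : Ω → ℝ} (hη : Measurable[filtW W P a] η)
    (hU : Measurable[filtW W P a] U) (hV : V =ᵐ[P] U) :
    ∫ ω, V ω * (η ω * wiener hW g ω) ∂P = 0 := by
  have h1 := integral_mul_wiener hW hg ha hg0 (hU.mul hη) measurable_id
  simp only [id_eq] at h1
  rw [integral_wiener hW hg, mul_zero] at h1
  rw [← h1]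
  refine integral_congr_ae ?_
  filter_upwards [hV] with ω h
  rw [h, Pi.mul_apply]; ring

end ExpMart

/-! ### Time integrals of processes bounded in L² -/

section TimeIntegral

set_option linter.unusedSectionVars false

/-- Cauchy-Schwarz with weight `|a|`: the quadratic in `l` is nonnegative because it dominates `∫
|a| (|X| - |l|)²`, so its discriminant is nonpositive. -/
lemma sq_integral_mul_le {β : Type*} [MeasurableSpace β] {ν : Measure β} {a X : β → ℝ}
    (ha : Integrable a ν) (h1 : Integrable (fun s => a s * X s) ν)
    (h2 : Integrable (fun s => a s * X s ^ 2) ν) :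
    (∫ s, a s * X s ∂ν) ^ 2 ≤ (∫ s, |a s| ∂ν) * ∫ s, |a s| * X s ^ 2 ∂ν := by
  have h3 : Integrable (fun s => |a s| * X s ^ 2) ν := by
    refine h2.abs.congr (ae_of_all _ fun s => ?_)
    simp only [abs_mul, abs_pow, sq_abs]
  have h4 : ∀ l : ℝ, 0 ≤ (∫ s, |a s| ∂ν) * (l * l) + -2 * (∫ s, a s * X s ∂ν) * l +
      ∫ s, |a s| * X s ^ 2 ∂ν := by
    intro l
    have h5 : ∫ s, (|a s| * (l * l) + -2 * (a s * X s) * l + |a s| * X s ^ 2) ∂ν =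
        (∫ s, |a s| ∂ν) * (l * l) + -2 * (∫ s, a s * X s ∂ν) * l + ∫ s, |a s| * X s ^ 2 ∂ν := by
      have i1 : Integrable (fun s => |a s| * (l * l)) ν := ha.abs.mul_const _
      have i2 : Integrable (fun s => -2 * (a s * X s) * l) ν := (h1.const_mul _).mul_const _
      have i3 : Integrable (fun s => |a s| * (l * l) + -2 * (a s * X s) * l) ν := i1.add i2
      rw [integral_add i3 h3, integral_add i1 i2, integral_mul_const, integral_mul_const,
        integral_const_mul]
    rw [← h5]
    refine integral_nonneg fun s => ?_
    have h6 : a s * X s * l ≤ |a s| * (|X s| * |l|) := by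
      rw [← abs_mul, ← abs_mul, ← mul_assoc]; exact le_abs_self _
    have h7 : 0 ≤ |a s| * (|X s| - |l|) ^ 2 := by positivity
    have h8 : |a s| * (|X s| - |l|) ^ 2 =
        |a s| * X s ^ 2 - 2 * (|a s| * (|X s| * |l|)) + |a s| * (l * l) := by
      rw [sub_sq, sq_abs, sq_abs]; ring
    simp only [Pi.zero_apply]
    linarith
  have h5 := discrim_le_zero h4
  rw [discrim] at h5
  nlinarith

variable {Ω : Type*} [MeasurableSpace Ω] {P : Measure Ω} [IsProbabilityMeasure P]
  {T : ℝ} {a : ℝ → ℝ} {X : ℝ → Ω → ℝ}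

/-- A jointly measurable process on `[0,T]`, bounded in `L²`. -/
structure IsL2Process (P : Measure Ω) (T : ℝ) (X : ℝ → Ω → ℝ) : Prop where
  measurable : Measurable (Function.uncurry X)
  memLp : ∀ s ∈ Icc 0 T, MemLp (X s) 2 P
  bounded : ∃ C : ℝ, ∀ s ∈ Icc 0 T, ∫ ω, X s ω ^ 2 ∂P ≤ C

lemma integrable_mul_uncurry (ha : IntervalIntegrable a volume 0 T) (hT : 0 ≤ T)
    {Y : ℝ → Ω → ℝ} (hY : AEStronglyMeasurable (Function.uncurry Y)
      ((volume.restrict (Ioc 0 T)).prod P)) (hYi : ∀ s ∈ Icc 0 T, Integrable (Y s) P) {C : ℝ}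
    (hC : ∀ s ∈ Icc 0 T, ∫ ω, |Y s ω| ∂P ≤ C) :
    Integrable (fun p : ℝ × Ω => a p.1 * Y p.1 p.2) ((volume.restrict (Ioc 0 T)).prod P) := by
  have ha' : Integrable a (volume.restrict (Ioc 0 T)) :=
    (intervalIntegrable_iff_integrableOn_Ioc_of_le hT).1 ha
  have hm : AEStronglyMeasurable (fun p : ℝ × Ω => a p.1 * Y p.1 p.2)
      ((volume.restrict (Ioc 0 T)).prod P) := ha'.1.comp_fst.mul hY
  rw [integrable_prod_iff hm]
  refine ⟨?_, ?_⟩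
  · filter_upwards [ae_restrict_mem measurableSet_Ioc] with s hs
    exact (hYi s ⟨hs.1.le, hs.2⟩).const_mul _
  · refine (ha'.abs.mul_const C).mono' hm.norm.integral_prod_right' ?_
    filter_upwards [ae_restrict_mem measurableSet_Ioc] with s hs
    simp only [norm_mul, Real.norm_eq_abs, integral_const_mul]
    rw [abs_abs, abs_of_nonneg (integral_nonneg fun _ => abs_nonneg _)]
    exact mul_le_mul_of_nonneg_left (hC s ⟨hs.1.le, hs.2⟩) (abs_nonneg _)

namespace IsL2Process

lemma mono {t : ℝ} (ht : t ≤ T) (hX : IsL2Process P T X) : IsL2Process P t X :=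
  ⟨hX.measurable, fun s hs => hX.memLp s ⟨hs.1, hs.2.trans ht⟩,
    hX.bounded.imp fun _ hC s hs => hC s ⟨hs.1, hs.2.trans ht⟩⟩

lemma sub {Y : ℝ → Ω → ℝ} (hX : IsL2Process P T X) (hY : IsL2Process P T Y) :
    IsL2Process P T (fun s ω => X s ω - Y s ω) := by
  obtain ⟨C, hC⟩ := hX.bounded
  obtain ⟨D, hD⟩ := hY.bounded
  refine ⟨hX.measurable.sub hY.measurable, fun s hs => (hX.memLp s hs).sub (hY.memLp s hs),
    2 * C + 2 * D, fun s hs => ?_⟩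
  have h1 := (hX.memLp s hs).integrable_sq
  have h2 := (hY.memLp s hs).integrable_sq
  calc _ ≤ ∫ ω, (2 * X s ω ^ 2 + 2 * Y s ω ^ 2) ∂P :=
        integral_mono ((hX.memLp s hs).sub (hY.memLp s hs)).integrable_sq
          ((h1.const_mul 2).add (h2.const_mul 2))
          fun ω => by simp only [Pi.sub_apply]; nlinarith [sq_nonneg (X s ω + Y s ω)]
    _ = 2 * ∫ ω, X s ω ^ 2 ∂P + 2 * ∫ ω, Y s ω ^ 2 ∂P := by
        rw [integral_add (h1.const_mul 2) (h2.const_mul 2), integral_const_mul, integral_const_mul]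
    _ ≤ _ := by linarith [hC s hs, hD s hs]

lemma integrable_mul_sq (hX : IsL2Process P T X) (hT : 0 ≤ T)
    (ha : IntervalIntegrable a volume 0 T) :
    Integrable (fun p : ℝ × Ω => a p.1 * X p.1 p.2 ^ 2) ((volume.restrict (Ioc 0 T)).prod P) := by
  obtain ⟨C, hC⟩ := hX.bounded
  refine integrable_mul_uncurry ha hT (Y := fun s ω => X s ω ^ 2)
    (hX.measurable.pow_const 2).aestronglyMeasurable (fun s hs => (hX.memLp s hs).integrable_sq)
    (C := C) fun s hs => ?_
  simp only [abs_pow, sq_abs]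
  exact hC s hs

lemma integrable_mul_mul (hX : IsL2Process P T X) (hT : 0 ≤ T)
    (ha : IntervalIntegrable a volume 0 T) {U : Ω → ℝ} (hU : MemLp U 2 P) :
    Integrable (fun p : ℝ × Ω => a p.1 * (U p.2 * X p.1 p.2))
      ((volume.restrict (Ioc 0 T)).prod P) := by
  obtain ⟨C, hC⟩ := hX.bounded
  refine integrable_mul_uncurry ha hT (Y := fun s ω => U ω * X s ω)
    (hU.1.comp_snd.mul hX.measurable.aestronglyMeasurable)
    (fun s hs => hU.integrable_mul (hX.memLp s hs))
    (C := (∫ ω, U ω ^ 2 ∂P) + C) fun s hs => ?_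
  have h1 := hU.integrable_sq
  have h2 := (hX.memLp s hs).integrable_sq
  calc _ ≤ ∫ ω, (U ω ^ 2 + X s ω ^ 2) ∂P := by
        refine integral_mono (hU.integrable_mul (hX.memLp s hs)).abs (h1.add h2) fun ω => ?_
        simp only [abs_mul]
        nlinarith [sq_nonneg (|U ω| - |X s ω|), sq_abs (U ω), sq_abs (X s ω), sq_nonneg (U ω),
          sq_nonneg (X s ω)]
    _ = (∫ ω, U ω ^ 2 ∂P) + ∫ ω, X s ω ^ 2 ∂P := integral_add h1 h2
    _ ≤ _ := by linarith [hC s hs]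

lemma integral_mul_timeIntegral (hX : IsL2Process P T X) (hT : 0 ≤ T)
    (ha : IntervalIntegrable a volume 0 T) {U : Ω → ℝ} (hU : MemLp U 2 P) :
    ∫ ω, U ω * (∫ s in (0 : ℝ)..T, X s ω * a s) ∂P =
      ∫ s in (0 : ℝ)..T, a s * ∫ ω, U ω * X s ω ∂P := by
  have h := integral_integral_swap (f := fun s ω => a s * (U ω * X s ω))
    (hX.integrable_mul_mul hT ha hU)
  rw [intervalIntegral.integral_of_le hT]
  simp only [integral_const_mul] at h
  rw [h]
  refine integral_congr_ae (ae_of_all _ fun ω => ?_)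
  simp only
  rw [intervalIntegral.integral_of_le hT, ← integral_const_mul]
  exact integral_congr_ae (ae_of_all _ fun s => by ring)

lemma stronglyMeasurable_timeIntegral (hX : IsL2Process P T X) (hT : 0 ≤ T)
    (ha : IntervalIntegrable a volume 0 T) :
    AEStronglyMeasurable (fun ω => ∫ s in (0 : ℝ)..T, X s ω * a s) P := by
  have ha' : Integrable a (volume.restrict (Ioc 0 T)) :=
    (intervalIntegrable_iff_integrableOn_Ioc_of_le hT).1 ha
  have hm : AEStronglyMeasurable (fun p : ℝ × Ω => X p.1 p.2 * a p.1)
      ((volume.restrict (Ioc 0 T)).prod P) :=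
    AEStronglyMeasurable.mul hX.measurable.aestronglyMeasurable ha'.1.comp_fst
  simp only [intervalIntegral.integral_of_le hT]
  exact hm.prod_swap.integral_prod_right'

lemma ae_integrable (hX : IsL2Process P T X) (hT : 0 ≤ T)
    (ha : IntervalIntegrable a volume 0 T) :
    ∀ᵐ ω ∂P, IntervalIntegrable (fun s => X s ω * a s) volume 0 T := by
  filter_upwards [(hX.integrable_mul_mul hT ha (memLp_const (1 : ℝ))).prod_left_ae] with ω h
  rw [intervalIntegrable_iff_integrableOn_Ioc_of_le hT]
  exact h.congr (ae_of_all _ fun s => by ring)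

lemma integrable_integral_sq (hX : IsL2Process P T X) (hT : 0 ≤ T)
    (ha : IntervalIntegrable a volume 0 T) :
    IntervalIntegrable (fun s => a s * ∫ ω, X s ω ^ 2 ∂P) volume 0 T := by
  rw [intervalIntegrable_iff_integrableOn_Ioc_of_le hT]
  have := (hX.integrable_mul_sq hT ha).integral_prod_left
  simp only [integral_const_mul] at this
  exact this

/-- Weighted Cauchy-Schwarz along each path, followed by Fubini. The moment bound is what Gronwall's
argument needs for the drift term. -/
lemma memLp_timeIntegral_and (hX : IsL2Process P T X) (hT : 0 ≤ T)
    (ha : IntervalIntegrable a volume 0 T) :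
    MemLp (fun ω => ∫ s in (0 : ℝ)..T, X s ω * a s) 2 P ∧
      ∫ ω, (∫ s in (0 : ℝ)..T, X s ω * a s) ^ 2 ∂P ≤
        (∫ s in (0 : ℝ)..T, |a s|) * ∫ s in (0 : ℝ)..T, |a s| * ∫ ω, X s ω ^ 2 ∂P := by
  have ha' : Integrable a (volume.restrict (Ioc 0 T)) :=
    (intervalIntegrable_iff_integrableOn_Ioc_of_le hT).1 ha
  have h1 := hX.integrable_mul_sq hT ha.abs
  have hle : ∀ᵐ ω ∂P, (∫ s in (0 : ℝ)..T, X s ω * a s) ^ 2 ≤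
      (∫ s in (0 : ℝ)..T, |a s|) * ∫ s in Ioc 0 T, |a s| * X s ω ^ 2 := by
    filter_upwards [(hX.integrable_mul_sq hT ha).prod_left_ae, hX.ae_integrable hT ha] with ω h2 h3
    rw [intervalIntegrable_iff_integrableOn_Ioc_of_le hT] at h3
    rw [intervalIntegral.integral_of_le hT, intervalIntegral.integral_of_le hT]
    simp only [mul_comm (X _ ω) (a _)] at h3 ⊢
    exact sq_integral_mul_le ha' h3 h2
  have h4 := (h1.integral_prod_right).const_mul (∫ s in (0 : ℝ)..T, |a s|)
  have hm := hX.stronglyMeasurable_timeIntegral hT ha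
  have h5 : Integrable (fun ω => (∫ s in (0 : ℝ)..T, X s ω * a s) ^ 2) P := by
    refine h4.mono' (hm.pow 2) ?_
    filter_upwards [hle] with ω h
    rwa [Real.norm_eq_abs, abs_of_nonneg (sq_nonneg _)]
  refine ⟨(memLp_two_iff_integrable_sq hm).2 h5, (integral_mono_ae h5 h4 hle).trans_eq ?_⟩
  rw [integral_const_mul, ← integral_integral_swap (f := fun s ω => |a s| * X s ω ^ 2) h1,
    intervalIntegral.integral_of_le hT, intervalIntegral.integral_of_le hT]
  simp only [integral_const_mul]

lemma memLp_timeIntegral (hX : IsL2Process P T X) (hT : 0 ≤ T)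
    (ha : IntervalIntegrable a volume 0 T) :
    MemLp (fun ω => ∫ s in (0 : ℝ)..T, X s ω * a s) 2 P :=
  (hX.memLp_timeIntegral_and hT ha).1

lemma integral_timeIntegral_sq_le (hX : IsL2Process P T X) (hT : 0 ≤ T)
    (ha : IntervalIntegrable a volume 0 T) :
    ∫ ω, (∫ s in (0 : ℝ)..T, X s ω * a s) ^ 2 ∂P ≤
        (∫ s in (0 : ℝ)..T, |a s|) * ∫ s in (0 : ℝ)..T, |a s| * ∫ ω, X s ω ^ 2 ∂P :=
  (hX.memLp_timeIntegral_and hT ha).2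

end IsL2Process

end TimeIntegral

/-! ### The martingale part of explicit wealth, by duality instead of Itô's formula -/

section Residual

set_option linter.unusedSectionVars false

lemma IsPrimitive.stopped {T s : ℝ} {F f : ℝ → ℝ} (hF : IsPrimitive T F f) (hs : s ∈ Icc 0 T) :
    IsPrimitive T (fun u => F (min s u)) ((Iic s).indicator f) := by
  have hT : 0 ≤ T := hs.1.trans hs.2
  refine ⟨?_, fun u hu => ?_⟩
  · rw [intervalIntegrable_iff_integrableOn_Ioc_of_le hT]
    exact ((intervalIntegrable_iff_integrableOn_Ioc_of_le hT).1 hF.intervalIntegrable).indicator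
      measurableSet_Iic
  · rw [min_eq_right hs.1, hF.eq_add_integral _ ⟨le_min hs.1 hu.1, (min_le_left _ _).trans hs.2⟩,
      intervalIntegral.integral_of_le hu.1, setIntegral_indicator measurableSet_Iic,
      intervalIntegral.integral_of_le (le_min hs.1 hu.1), Ioc_inter_Iic, min_comm]

lemma integral_indicator_Iic {s t : ℝ} (f : ℝ → ℝ) (hs : s ∈ Icc 0 t) :
    ∫ u in (0 : ℝ)..t, (Iic s).indicator f u = ∫ u in (0 : ℝ)..s, f u := by
  rw [intervalIntegral.integral_of_le (hs.1.trans hs.2), setIntegral_indicator measurableSet_Iic,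
    intervalIntegral.integral_of_le hs.1, Ioc_inter_Iic, min_eq_right hs.2]

variable {Ω : Type*} [MeasurableSpace Ω] {P : Measure Ω} [IsProbabilityMeasure P] {d : ℕ}
  {W : Fin d → ℝ≥0 → Ω → ℝ}

/-- `X_t - X_0 - ∫_0^t X_s a_s ds`, where `x` stands for `X_0`. -/
def residual (X : ℝ → Ω → ℝ) (a : ℝ → ℝ) (x t : ℝ) (ω : Ω) : ℝ :=
  X t ω - x - ∫ s in (0 : ℝ)..t, X s ω * a s

/-- `X` is a version of `m_t ℰ(∫ y' dW)_t`, where `m' = m a`. -/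
structure IsExpSolution (hW : IsStdBrownian W P) (T : ℝ) (y : ℝ → EuclideanSpace ℝ (Fin d))
    (a m : ℝ → ℝ) (X : ℝ → Ω → ℝ) : Prop where
  memLp : MemLp y 2 posVol
  measurable : Measurable (Function.uncurry X)
  intervalIntegrable : IntervalIntegrable a volume 0 T
  primitive : IsPrimitive T m (fun s => m s * a s)
  ae_eq : ∀ t ∈ Icc 0 T, X t =ᵐ[P] fun ω => m t * expMart hW y t ω

namespace IsExpSolution

variable {hW : IsStdBrownian W P} {T t : ℝ} {y : ℝ → EuclideanSpace ℝ (Fin d)}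
  {a m : ℝ → ℝ} {X : ℝ → Ω → ℝ}

lemma mono (h : IsExpSolution hW T y a m X) (ht : t ∈ Icc 0 T) : IsExpSolution hW t y a m X :=
  ⟨h.memLp, h.measurable, h.intervalIntegrable.mono_set (by
    rw [uIcc_of_le (ht.1.trans ht.2), uIcc_of_le ht.1]; exact Icc_subset_Icc_right ht.2),
    h.primitive.mono ht, fun s hs => h.ae_eq s ⟨hs.1, hs.2.trans ht.2⟩⟩

lemma integral_mul (h : IsExpSolution hW T y a m X) (ht : t ∈ Icc 0 T) (U : Ω → ℝ) :
    ∫ ω, U ω * X t ω ∂P = m t * ∫ ω, U ω * expMart hW y t ω ∂P := by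
  rw [← integral_const_mul]
  refine integral_congr_ae ?_
  filter_upwards [h.ae_eq t ht] with ω hω
  rw [hω]; ring

lemma integral_sq (h : IsExpSolution hW T y a m X) (ht : t ∈ Icc 0 T) :
    ∫ ω, X t ω ^ 2 ∂P = m t ^ 2 * Real.exp (∫ s in (0 : ℝ)..t, ‖y s‖ ^ 2) := by
  rw [← integral_expMart_mul_self hW h.memLp ht.1, ← integral_const_mul]
  refine integral_congr_ae ?_
  filter_upwards [h.ae_eq t ht] with ω hω
  rw [hω]; ring

lemma primitive_exp (h : IsExpSolution hW T y a m X) (hT : 0 ≤ T) :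
    IsPrimitive T (fun t => Real.exp (∫ s in (0 : ℝ)..t, ‖y s‖ ^ 2))
      (fun t => Real.exp (∫ s in (0 : ℝ)..t, ‖y s‖ ^ 2) * ‖y t‖ ^ 2) := by
  have := (IsPrimitive.of_intervalIntegrable
    (intervalIntegrable_norm_sq h.memLp le_rfl hT) 0).exp hT
  simpa using this

lemma isL2 (h : IsExpSolution hW T y a m X) (hT : 0 ≤ T) : IsL2Process P T X := by
  refine ⟨h.measurable, fun s hs => ?_, ?_⟩
  · exact ((memLp_expMart hW h.memLp s).const_mul (m s)).ae_eq (h.ae_eq s hs).symm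
  · have hc : ContinuousOn (fun t => m t ^ 2 * Real.exp (∫ s in (0 : ℝ)..t, ‖y s‖ ^ 2)) (Icc 0 T) :=
      ((h.primitive.continuousOn hT).pow 2).mul ((h.primitive_exp hT).continuousOn hT)
    obtain ⟨C, hC⟩ := isCompact_Icc.exists_bound_of_continuousOn hc
    refine ⟨C, fun s hs => ?_⟩
    rw [h.integral_sq hs]
    exact (le_abs_self _).trans (hC s hs)

lemma memLp_residual (h : IsExpSolution hW T y a m X) (hT : 0 ≤ T) (x : ℝ) :
    MemLp (residual X a x T) 2 P :=
  (((h.isL2 hT).memLp T ⟨hT, le_rfl⟩).sub (memLp_const x)).sub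
    ((h.isL2 hT).memLp_timeIntegral hT h.intervalIntegrable)

/-- Put `h(s) = E[U E_s]`, so that `E[U X_s] = m_s h(s)`. In the product rule `(m h)' = m a h + m
k`, the first term integrates to exactly what the drift part of the residual subtracts, leaving `∫ m
k`. -/
lemma integral_mul_residual (h : IsExpSolution hW T y a m X) (hT : 0 ≤ T) {U : Ω → ℝ}
    (hU : MemLp U 2 P) {k : ℝ → ℝ}
    (hk : IsPrimitive T (fun s => ∫ ω, U ω * expMart hW y s ω ∂P) k) :
    ∫ ω, U ω * residual X a (m 0) T ω ∂P = ∫ s in (0 : ℝ)..T, m s * k s := by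
  have hX := h.isL2 hT
  have i1 : Integrable (fun ω => U ω * X T ω) P := hU.integrable_mul (hX.memLp T ⟨hT, le_rfl⟩)
  have i2 : Integrable (fun ω => U ω * m 0) P := (hU.integrable (by norm_num)).mul_const _
  have i3 : Integrable (fun ω => U ω * ∫ s in (0 : ℝ)..T, X s ω * a s) P :=
    hU.integrable_mul (hX.memLp_timeIntegral hT h.intervalIntegrable)
  have e1 : ∫ ω, U ω * residual X a (m 0) T ω ∂P = ∫ ω, U ω * X T ω ∂P - (∫ ω, U ω ∂P) * m 0 -
      ∫ ω, U ω * (∫ s in (0 : ℝ)..T, X s ω * a s) ∂P := by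
    have i12 : Integrable (fun ω => U ω * X T ω - U ω * m 0) P := i1.sub i2
    rw [← integral_mul_const, ← integral_sub i1 i2, ← integral_sub i12 i3]
    refine integral_congr_ae (ae_of_all _ fun ω => ?_)
    simp only [residual]; ring
  have e2 : ∫ ω, U ω * expMart hW y 0 ω ∂P = ∫ ω, U ω ∂P := by
    refine integral_congr_ae ?_
    filter_upwards [expMart_zero hW h.memLp] with ω hω
    rw [hω, mul_one]
  have e3 := (h.primitive.mul hT hk).eq_add_integral T ⟨hT, le_rfl⟩
  have e4 : ∫ s in (0 : ℝ)..T, a s * ∫ ω, U ω * X s ω ∂P =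
      ∫ s in (0 : ℝ)..T, m s * a s * ∫ ω, U ω * expMart hW y s ω ∂P := by
    refine intervalIntegral.integral_congr fun s hs => ?_
    rw [uIcc_of_le hT] at hs
    rw [h.integral_mul hs]; ring
  rw [intervalIntegral.integral_add
    (h.primitive.intervalIntegrable.mul_continuousOn (by
      rw [uIcc_of_le hT]; exact hk.continuousOn hT))
    (hk.intervalIntegrable.continuousOn_mul (by
      rw [uIcc_of_le hT]; exact h.primitive.continuousOn hT)), e2] at e3
  rw [e1, h.integral_mul ⟨hT, le_rfl⟩, e3,
    hX.integral_mul_timeIntegral hT h.intervalIntegrable hU, e4]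
  ring

lemma intervalIntegrable_residual_kernel (h : IsExpSolution hW T y a m X) (hT : 0 ≤ T) :
    IntervalIntegrable (fun s => m s * (Real.exp (∫ u in (0 : ℝ)..s, ‖y u‖ ^ 2) * ‖y s‖ ^ 2))
      volume 0 T :=
  (h.primitive_exp hT).intervalIntegrable.continuousOn_mul (by
    rw [uIcc_of_le hT]; exact h.primitive.continuousOn hT)

/-- Duality with `U = E_t`: by the martingale property `E[E_t E_s] = exp(∫_0^{min t s} ‖y‖²)`, whose
derivative in `s` is cut off after `t`. -/
lemma integral_residual_mul_expMart (h : IsExpSolution hW T y a m X) (ht : t ∈ Icc 0 T) :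
    ∫ ω, residual X a (m 0) T ω * expMart hW y t ω ∂P =
      ∫ s in (0 : ℝ)..t, m s * (Real.exp (∫ u in (0 : ℝ)..s, ‖y u‖ ^ 2) * ‖y s‖ ^ 2) := by
  have hT : 0 ≤ T := ht.1.trans ht.2
  have hk := (h.primitive_exp hT).stopped ht
  have hk' : IsPrimitive T (fun s => ∫ ω, expMart hW y t ω * expMart hW y s ω ∂P)
      ((Iic t).indicator fun s => Real.exp (∫ u in (0 : ℝ)..s, ‖y u‖ ^ 2) * ‖y s‖ ^ 2) := by
    have e : ∀ s, 0 ≤ s → ∫ ω, expMart hW y t ω * expMart hW y s ω ∂P =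
        Real.exp (∫ u in (0 : ℝ)..(min t s), ‖y u‖ ^ 2) := by
      intro s hs
      rcases le_total t s with hts | hts
      · rw [min_eq_left hts, integral_expMart_mul hW h.memLp ht.1 hts]
      · rw [min_eq_right hts, ← integral_expMart_mul hW h.memLp hs hts]
        simp only [mul_comm]
    refine ⟨hk.intervalIntegrable, fun s hs => ?_⟩
    rw [e s hs.1, e 0 le_rfl]
    exact hk.eq_add_integral s hs
  have e := h.integral_mul_residual hT (memLp_expMart hW h.memLp t) hk'
  rw [← integral_indicator_Iic _ ht, integral_congr_ae (ae_of_all P fun ω => mul_comm _ _), e]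
  refine intervalIntegral.integral_congr fun s _ => ?_
  by_cases hs : s ∈ Iic t <;> simp [hs]

/-- Itô's isometry for the residual. -/
lemma integral_residual_sq (h : IsExpSolution hW T y a m X) (hT : 0 ≤ T) :
    ∫ ω, residual X a (m 0) T ω ^ 2 ∂P =
      ∫ s in (0 : ℝ)..T, (∫ ω, X s ω ^ 2 ∂P) * ‖y s‖ ^ 2 := by
  -- Duality is now applied with `U` the residual itself; its pairings with `E_s` are known from the
  -- preceding lemma.
  have hk : IsPrimitive T (fun s => ∫ ω, residual X a (m 0) T ω * expMart hW y s ω ∂P)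
      (fun s => m s * (Real.exp (∫ u in (0 : ℝ)..s, ‖y u‖ ^ 2) * ‖y s‖ ^ 2)) := by
    refine ⟨h.intervalIntegrable_residual_kernel hT, fun s hs => ?_⟩
    rw [h.integral_residual_mul_expMart hs, h.integral_residual_mul_expMart ⟨le_rfl, hT⟩]
    simp
  have e := h.integral_mul_residual hT (h.memLp_residual hT (m 0)) hk
  simp only [pow_two (residual X a (m 0) T _)]
  rw [e]
  refine intervalIntegral.integral_congr fun s hs => ?_
  rw [uIcc_of_le hT] at hs
  rw [h.integral_sq hs]; ring

/-- Duality with `U` one term of a simple integral. The constant `E[η E_r]` may be replaced by `E[η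
E_s]` for `s > r` by the martingale property, and for `s ≤ r` the factor `f` vanishes. -/
lemma integral_mul_wiener_mul_residual (h : IsExpSolution hW T y a m X) (hT : 0 ≤ T)
    {f : ℝ → EuclideanSpace ℝ (Fin d)} (hf : MemLp f 2 posVol) {r : ℝ} (hr : 0 ≤ r)
    (hf0 : ZeroUpTo r f) {η : Ω → ℝ} (hη : Measurable[filtW W P r] η)
    (hU : MemLp (fun ω => η ω * wiener hW f ω) 2 P) :
    ∫ ω, η ω * wiener hW f ω * residual X a (m 0) T ω ∂P =
      ∫ s in (0 : ℝ)..T, (∫ ω, η ω * X s ω ∂P) * inner ℝ (f s) (y s) := by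
  have hi : IntervalIntegrable (fun s => inner ℝ (f s) (y s)) volume 0 T :=
    intervalIntegrable_of_posVol (integrable_inner_of_memLp hf h.memLp) le_rfl hT
  have hk : IsPrimitive T (fun s => ∫ ω, η ω * wiener hW f ω * expMart hW y s ω ∂P)
      (fun s => (∫ ω, η ω * expMart hW y r ω ∂P) * inner ℝ (f s) (y s)) := by
    refine ⟨hi.const_mul _, fun s hs => ?_⟩
    rw [integral_mul_wiener_mul_expMart hW h.memLp hf hr hf0 hs.1 hη,
      integral_mul_wiener_mul_expMart hW h.memLp hf hr hf0 le_rfl hη,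
      intervalIntegral.integral_const_mul]
    simp
  rw [h.integral_mul_residual hT hU hk]
  refine intervalIntegral.integral_congr_ae ?_
  have h0 := (ae_restrict_iff' measurableSet_Ioi).1 hf0
  filter_upwards [h0] with s hs0 hs
  rw [uIoc_of_le hT] at hs
  rw [h.integral_mul ⟨hs.1.le, hs.2⟩]
  by_cases hsr : s ≤ r
  · rw [hs0 hs.1 hsr]; simp
  · rw [integral_mul_expMart hW h.memLp hr (not_le.1 hsr).le hη]; ring

end IsExpSolution

end Residual

/-! ### Exact distance from the residual to integrals of simple processes -/

section Isometry

set_option linter.unusedSectionVars false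

variable {Ω : Type*} [MeasurableSpace Ω] {P : Measure Ω} [IsProbabilityMeasure P] {d : ℕ}
  {W : Fin d → ℝ≥0 → Ω → ℝ} {hW : IsStdBrownian W P} {T : ℝ} {y : ℝ → EuclideanSpace ℝ (Fin d)}
  {a m : ℝ → ℝ} {X : ℝ → Ω → ℝ}

lemma memLp_bounded_mul {η U : Ω → ℝ} (hη : Measurable η) {C : ℝ} (hC : ∀ ω, |η ω| ≤ C)
    (hU : MemLp U 2 P) : MemLp (fun ω => η ω * U ω) 2 P :=
  hU.of_le_mul (c := C) (hη.aestronglyMeasurable.mul hU.1) (ae_of_all _ fun ω => by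
    rw [norm_mul]
    exact mul_le_mul_of_nonneg_right (hC ω) (norm_nonneg _))

lemma memLp_of_bounded {η : Ω → ℝ} (hη : Measurable η) {C : ℝ} (hC : ∀ ω, |η ω| ≤ C) :
    MemLp η 2 P := MemLp.of_bound hη.aestronglyMeasurable C (ae_of_all _ hC)

/-- A finite family of products of an `F_r`-measurable bounded variable with a function of time
vanishing up to `r`, whose stochastic integrals satisfy the isometry pairwise. -/
structure IsElementaryFamily (hW : IsStdBrownian W P) (T : ℝ) {ι : Type*} (S : Finset ι)
    (r : ι → ℝ) (η : ι → Ω → ℝ) (f : ι → ℝ → EuclideanSpace ℝ (Fin d)) : Prop where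
  nonneg : ∀ p ∈ S, 0 ≤ r p
  adapted : ∀ p ∈ S, Measurable[filtW W P (r p)] (η p)
  bounded : ∀ p ∈ S, ∃ C : ℝ, ∀ ω, |η p ω| ≤ C
  memLp : ∀ p ∈ S, MemLp (f p) 2 posVol
  zeroUpTo : ∀ p ∈ S, ZeroUpTo (r p) (f p)
  support : ∀ p ∈ S, (Ioc 0 T).indicator (f p) = f p
  pair : ∀ p ∈ S, ∀ q ∈ S, ∫ ω, (η p ω * wiener hW (f p) ω) * (η q ω * wiener hW (f q) ω) ∂P =
    (∫ ω, η p ω * η q ω ∂P) * ∫ u, inner ℝ (f p u) (f q u) ∂posVol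

variable {ι : Type*} {S : Finset ι} {r : ι → ℝ} {η : ι → Ω → ℝ}
  {f : ι → ℝ → EuclideanSpace ℝ (Fin d)}

lemma norm_sum_smul_sub_sq (c : ι → ℝ) (u : ι → EuclideanSpace ℝ (Fin d)) (b : ℝ)
    (v : EuclideanSpace ℝ (Fin d)) :
    ‖(∑ p ∈ S, c p • u p) - b • v‖ ^ 2 = (∑ p ∈ S, ∑ q ∈ S, c p * c q * inner ℝ (u p) (u q)) -
      2 * (∑ p ∈ S, c p * b * inner ℝ (u p) v) + b ^ 2 * ‖v‖ ^ 2 := by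
  rw [norm_sub_sq_real, ← real_inner_self_eq_norm_sq (∑ p ∈ S, c p • u p), sum_inner, sum_inner,
    norm_smul, mul_pow, Real.norm_eq_abs, sq_abs]
  simp only [inner_sum, real_inner_smul_left, real_inner_smul_right]
  congr 1
  congr 1
  · refine Finset.sum_congr rfl fun p _ => Finset.sum_congr rfl fun q _ => by ring
  · congr 1
    refine Finset.sum_congr rfl fun p _ => by ring

lemma intervalIntegrable_finsetSum {κ : Type*} {S : Finset κ} {g : κ → ℝ → ℝ} {a b : ℝ}
    (h : ∀ i ∈ S, IntervalIntegrable (g i) volume a b) :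
    IntervalIntegrable (fun s => ∑ i ∈ S, g i s) volume a b := by
  have := IntervalIntegrable.sum S h
  simpa [Finset.sum_fn] using! this

namespace IsElementaryFamily

lemma memLp_term (h : IsElementaryFamily hW T S r η f) {p : ι} (hp : p ∈ S) :
    MemLp (fun ω => η p ω * wiener hW (f p) ω) 2 P := by
  obtain ⟨C, hC⟩ := h.bounded p hp
  exact memLp_bounded_mul ((h.adapted p hp).mono (filtW_le hW _) le_rfl) hC
    (memLp_wiener hW (h.memLp p hp))

lemma memLp_coeff (h : IsElementaryFamily hW T S r η f) {p : ι} (hp : p ∈ S) :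
    MemLp (η p) 2 P := by
  obtain ⟨C, hC⟩ := h.bounded p hp
  exact memLp_of_bounded ((h.adapted p hp).mono (filtW_le hW _) le_rfl) hC

lemma integral_pair (h : IsElementaryFamily hW T S r η f) (hT : 0 ≤ T) {p q : ι} (hp : p ∈ S)
    (hq : q ∈ S) : ∫ ω, (η p ω * wiener hW (f p) ω) * (η q ω * wiener hW (f q) ω) ∂P =
      ∫ s in (0 : ℝ)..T, (∫ ω, η p ω * η q ω ∂P) * inner ℝ (f p s) (f q s) := by
  rw [h.pair p hp q hq, intervalIntegral.integral_const_mul, ← integral_inner_indicator _ le_rfl hT,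
    h.support q hq]

lemma integral_norm_sq_eq (hX : IsExpSolution hW T y a m X) (h : IsElementaryFamily hW T S r η f)
    {s : ℝ} (hs : s ∈ Icc 0 T) :
    ∫ ω, ‖(∑ p ∈ S, η p ω • f p s) - X s ω • y s‖ ^ 2 ∂P =
      (∑ p ∈ S, ∑ q ∈ S, (∫ ω, η p ω * η q ω ∂P) * inner ℝ (f p s) (f q s)) -
      2 * (∑ p ∈ S, (∫ ω, η p ω * X s ω ∂P) * inner ℝ (f p s) (y s)) +
      (∫ ω, X s ω ^ 2 ∂P) * ‖y s‖ ^ 2 := by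
  have hXs := (hX.isL2 (hs.1.trans hs.2)).memLp s hs
  have i1 : ∀ p ∈ S, ∀ q ∈ S, Integrable (fun ω => η p ω * η q ω * inner ℝ (f p s) (f q s)) P :=
    fun p hp q hq => ((h.memLp_coeff hp).integrable_mul (h.memLp_coeff hq)).mul_const _
  have i2 : ∀ p ∈ S, Integrable (fun ω => η p ω * X s ω * inner ℝ (f p s) (y s)) P :=
    fun p hp => ((h.memLp_coeff hp).integrable_mul hXs).mul_const _
  have i3 : Integrable (fun ω => X s ω ^ 2 * ‖y s‖ ^ 2) P := hXs.integrable_sq.mul_const _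
  have i1' : Integrable (fun ω => ∑ p ∈ S, ∑ q ∈ S, η p ω * η q ω * inner ℝ (f p s) (f q s)) P :=
    integrable_finsetSum _ fun p hp => integrable_finsetSum _ fun q hq => i1 p hp q hq
  have i2' : Integrable (fun ω => 2 * ∑ p ∈ S, η p ω * X s ω * inner ℝ (f p s) (y s)) P :=
    (integrable_finsetSum _ i2).const_mul 2
  have i12 : Integrable (fun ω => (∑ p ∈ S, ∑ q ∈ S, η p ω * η q ω * inner ℝ (f p s) (f q s)) -
      2 * ∑ p ∈ S, η p ω * X s ω * inner ℝ (f p s) (y s)) P := i1'.sub i2'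
  simp only [norm_sum_smul_sub_sq]
  rw [integral_add i12 i3, integral_sub i1' i2', integral_const_mul,
    integral_finsetSum _ fun p hp => integrable_finsetSum _ fun q hq => i1 p hp q hq,
    integral_finsetSum _ i2, integral_mul_const]
  congr 1
  congr 1
  · refine Finset.sum_congr rfl fun p hp => ?_
    rw [integral_finsetSum _ fun q hq => i1 p hp q hq]
    exact Finset.sum_congr rfl fun q _ => integral_mul_const _ _
  · congr 1
    exact Finset.sum_congr rfl fun q _ => integral_mul_const _ _

/-- Expand both squares. Simple-simple, simple-residual and residual-residual products match term by
term through the pairing field, the duality computation and Itô's isometry for the residual. -/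
theorem integral_sub_residual_sq (hX : IsExpSolution hW T y a m X) (hT : 0 ≤ T)
    (h : IsElementaryFamily hW T S r η f) :
    ∫ ω, ((∑ p ∈ S, η p ω * wiener hW (f p) ω) - residual X a (m 0) T ω) ^ 2 ∂P =
      ∫ s in (0 : ℝ)..T, ∫ ω, ‖(∑ p ∈ S, η p ω • f p s) - X s ω • y s‖ ^ 2 ∂P := by
  have hL := hX.isL2 hT
  have hI := hX.memLp_residual hT (m 0)
  set I := residual X a (m 0) T with hIdef
  have e1 : ∫ s in (0 : ℝ)..T, ∫ ω, ‖(∑ p ∈ S, η p ω • f p s) - X s ω • y s‖ ^ 2 ∂P =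
      ∫ s in (0 : ℝ)..T, ((∑ p ∈ S, ∑ q ∈ S, (∫ ω, η p ω * η q ω ∂P) * inner ℝ (f p s) (f q s)) -
      2 * (∑ p ∈ S, (∫ ω, η p ω * X s ω ∂P) * inner ℝ (f p s) (y s)) +
      (∫ ω, X s ω ^ 2 ∂P) * ‖y s‖ ^ 2) := by
    refine intervalIntegral.integral_congr fun s hs => ?_
    rw [uIcc_of_le hT] at hs
    exact integral_norm_sq_eq hX h hs
  have j0 : ∀ p ∈ S, ∀ g, MemLp g 2 posVol →
      IntervalIntegrable (fun s => inner ℝ (f p s) (g s)) volume 0 T := fun p hp g hg =>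
    intervalIntegrable_of_posVol (integrable_inner_of_memLp (h.memLp p hp) hg) le_rfl hT
  have j1 : ∀ p ∈ S, ∀ q ∈ S, IntervalIntegrable
      (fun s => (∫ ω, η p ω * η q ω ∂P) * inner ℝ (f p s) (f q s)) volume 0 T :=
    fun p hp q hq => (j0 p hp _ (h.memLp q hq)).const_mul _
  have j2 : ∀ p ∈ S, IntervalIntegrable
      (fun s => (∫ ω, η p ω * X s ω ∂P) * inner ℝ (f p s) (y s)) volume 0 T := fun p hp => by
    have h1 := (hL.integrable_mul_mul hT (j0 p hp _ hX.memLp) (h.memLp_coeff hp)).integral_prod_left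
    simp only [integral_const_mul] at h1
    rw [intervalIntegrable_iff_integrableOn_Ioc_of_le hT]
    exact h1.congr (ae_of_all _ fun s => mul_comm _ _)
  have j3 : IntervalIntegrable (fun s => (∫ ω, X s ω ^ 2 ∂P) * ‖y s‖ ^ 2) volume 0 T := by
    simp only [mul_comm _ (‖y _‖ ^ 2)]
    exact hL.integrable_integral_sq hT (intervalIntegrable_norm_sq hX.memLp le_rfl hT)
  have j1' : IntervalIntegrable (fun s => ∑ p ∈ S, ∑ q ∈ S,
      (∫ ω, η p ω * η q ω ∂P) * inner ℝ (f p s) (f q s)) volume 0 T :=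
    intervalIntegrable_finsetSum fun p hp => intervalIntegrable_finsetSum fun q hq => j1 p hp q hq
  have j2' : IntervalIntegrable (fun s => 2 * ∑ p ∈ S,
      (∫ ω, η p ω * X s ω ∂P) * inner ℝ (f p s) (y s)) volume 0 T :=
    (intervalIntegrable_finsetSum j2).const_mul 2
  rw [e1, intervalIntegral.integral_add (j1'.sub j2') j3, intervalIntegral.integral_sub j1' j2',
    intervalIntegral.integral_const_mul, intervalIntegral.integral_finsetSum j2,
    intervalIntegral.integral_finsetSum fun p hp => intervalIntegrable_finsetSum fun q hq =>
      j1 p hp q hq, ← hX.integral_residual_sq hT, ← hIdef]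
  have i1 : ∀ p ∈ S, ∀ q ∈ S, Integrable
      (fun ω => (η p ω * wiener hW (f p) ω) * (η q ω * wiener hW (f q) ω)) P :=
    fun p hp q hq => (h.memLp_term hp).integrable_mul (h.memLp_term hq)
  have i2 : ∀ p ∈ S, Integrable (fun ω => η p ω * wiener hW (f p) ω * I ω) P :=
    fun p hp => (h.memLp_term hp).integrable_mul hI
  have i1' : Integrable (fun ω => ∑ p ∈ S, ∑ q ∈ S,
      (η p ω * wiener hW (f p) ω) * (η q ω * wiener hW (f q) ω)) P :=
    integrable_finsetSum _ fun p hp => integrable_finsetSum _ fun q hq => i1 p hp q hq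
  have i2' : Integrable (fun ω => 2 * ∑ p ∈ S, η p ω * wiener hW (f p) ω * I ω) P :=
    (integrable_finsetSum _ i2).const_mul 2
  have i12 : Integrable (fun ω => (∑ p ∈ S, ∑ q ∈ S,
      (η p ω * wiener hW (f p) ω) * (η q ω * wiener hW (f q) ω)) -
      2 * ∑ p ∈ S, η p ω * wiener hW (f p) ω * I ω) P := i1'.sub i2'
  have e2 : ∀ ω, ((∑ p ∈ S, η p ω * wiener hW (f p) ω) - I ω) ^ 2 =
      (∑ p ∈ S, ∑ q ∈ S, (η p ω * wiener hW (f p) ω) * (η q ω * wiener hW (f q) ω)) -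
      2 * (∑ p ∈ S, η p ω * wiener hW (f p) ω * I ω) + I ω ^ 2 := fun ω => by
    rw [← Finset.sum_mul_sum, ← Finset.sum_mul]; ring
  simp only [e2]
  rw [integral_add i12 hI.integrable_sq, integral_sub i1' i2', integral_const_mul,
    integral_finsetSum _ fun p hp => integrable_finsetSum _ fun q hq => i1 p hp q hq,
    integral_finsetSum _ i2]
  congr 1
  congr 1
  · refine Finset.sum_congr rfl fun p hp => ?_
    rw [integral_finsetSum _ fun q hq => i1 p hp q hq,
      intervalIntegral.integral_finsetSum fun q hq => j1 p hp q hq]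
    exact Finset.sum_congr rfl fun q hq => h.integral_pair hT hp hq
  · congr 1
    exact Finset.sum_congr rfl fun p hp => hX.integral_mul_wiener_mul_residual hT (h.memLp p hp)
      (h.nonneg p hp) (h.zeroUpTo p hp) (h.adapted p hp) (h.memLp_term hp)

end IsElementaryFamily

namespace SimpleProcess

variable (G : SimpleProcess W P)

/-- The deterministic factor of a component of a simple process, stopped at `T`. -/
def stepFun (T : ℝ) (p : ℕ × Fin d) : ℝ → EuclideanSpace ℝ (Fin d) :=
  (Ioc (min (G.t p.1) T) (min (G.t (p.1 + 1)) T)).indicator fun _ => EuclideanSpace.single p.2 1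

lemma t_nonneg (i : ℕ) : 0 ≤ G.t i := G.nonneg.trans (G.mono (Nat.zero_le i))

lemma mem_Ioc_min {T s : ℝ} (hs : s ∈ Ioc 0 T) (i : ℕ) :
    s ∈ Ioc (min (G.t i) T) (min (G.t (i + 1)) T) ↔ s ∈ Ioc (G.t i) (G.t (i + 1)) := by
  simp only [mem_Ioc, min_lt_iff, le_min_iff, hs.2, and_true, not_lt.2 hs.2, or_false]

lemma sum_smul_stepFun {s : ℝ} (hs : s ∈ Ioc 0 T) (ω : Ω) :
    ∑ p ∈ Finset.range G.n ×ˢ (Finset.univ : Finset (Fin d)), G.ξ p.1 ω p.2 • G.stepFun T p s =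
      G.eval s ω := by
  rw [eval, Finset.sum_product]
  refine Finset.sum_congr rfl fun i _ => ?_
  by_cases h : s ∈ Ioc (G.t i) (G.t (i + 1))
  · simp only [stepFun, indicator_of_mem ((G.mem_Ioc_min hs i).2 h), indicator_of_mem h]
    ext j
    simp [Pi.single_apply]
  · have h' := (G.mem_Ioc_min hs i).not.2 h
    simp only [stepFun, indicator_of_notMem h', indicator_of_notMem h, smul_zero,
      Finset.sum_const_zero]

lemma sum_wiener_stepFun (hT : 0 ≤ T) :
    (fun ω => ∑ p ∈ Finset.range G.n ×ˢ (Finset.univ : Finset (Fin d)),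
      G.ξ p.1 ω p.2 * wiener hW (G.stepFun T p) ω) =ᵐ[P] G.integral T := by
  have h : ∀ᵐ ω ∂P, ∀ p : ℕ × Fin d, wiener hW (G.stepFun T p) ω =
      W p.2 (min (G.t (p.1 + 1)) T).toNNReal ω - W p.2 (min (G.t p.1) T).toNNReal ω :=
    ae_all_iff.2 fun p => wiener_indicator_Ioc hW p.2 (le_min (G.t_nonneg _) hT)
      (min_le_min_right _ (G.mono (Nat.le_succ _)))
  filter_upwards [h] with ω hω
  rw [integral, Finset.sum_product]
  refine Finset.sum_congr rfl fun i _ => ?_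
  rw [PiLp.inner_apply]
  refine Finset.sum_congr rfl fun j _ => ?_
  rw [hω]
  simp [vecW, mul_comm]

/-- Terms on the same interval share a base time, so their coefficients factor out by independence.
For different intervals the earlier term is measurable before the later one starts, giving zero
expectation, and disjointness makes the time integral zero as well. -/
lemma isElementaryFamily (hW : IsStdBrownian W P) (hT : 0 ≤ T) :
    IsElementaryFamily hW T (Finset.range G.n ×ˢ (Finset.univ : Finset (Fin d)))
      (fun p => G.t p.1) (fun p ω => G.ξ p.1 ω p.2) (G.stepFun T) := by
  have hmem : ∀ p, MemLp (G.stepFun T p) 2 posVol := fun p => memLp_indicator_Ioc _ _ _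
  have hadapt : ∀ p : ℕ × Fin d, Measurable[filtW W P (G.t p.1)] fun ω => G.ξ p.1 ω p.2 := by
    intro p
    exact Measurable.comp (g := fun x : EuclideanSpace ℝ (Fin d) => x p.2) (by fun_prop)
      (G.adapted p.1)
  have hzero : ∀ p, ZeroUpTo (G.t p.1) (G.stepFun T p) := by
    intro p
    rcases le_total (G.t p.1) T with h | h
    -- Stopping at `T` moves the base point only when `T ≤ t_i`, and then the stopped interval is
    -- empty.
    · exact zeroUpTo_indicator_Ioc (by rw [min_eq_left h])
    · refine ae_of_all _ fun s _ => indicator_of_notMem (fun hs => ?_) _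
      rw [min_eq_right h] at hs
      exact absurd (hs.2.trans (min_le_right _ _)) (not_le.2 hs.1)
  have hlt : ∀ p q : ℕ × Fin d, p.1 < q.1 →
      ∫ ω, (G.ξ p.1 ω p.2 * wiener hW (G.stepFun T p) ω) *
        (G.ξ q.1 ω q.2 * wiener hW (G.stepFun T q) ω) ∂P = 0 ∧
      ∫ u, inner ℝ (G.stepFun T p u) (G.stepFun T q u) ∂posVol = 0 := by
    intro p q hpq
    have hle : G.t (p.1 + 1) ≤ G.t q.1 := G.mono hpq
    constructor
    · have e := wiener_indicator_Ioc hW p.2 (le_min (G.t_nonneg p.1) hT)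
        (min_le_min_right T (G.mono (Nat.le_succ p.1)))
      have hm : ∀ s, 0 ≤ s → s ≤ G.t q.1 → Measurable[filtW W P (G.t q.1)] (W p.2 s.toNNReal) :=
        fun s hs hsq => measurable_W_filtW p.2 (by rwa [Real.coe_toNNReal s hs])
      refine integral_mul_wiener_eq_zero hW (hmem q) (G.t_nonneg q.1) (hzero q) (hadapt q)
        (U := fun ω => G.ξ p.1 ω p.2 * (W p.2 (min (G.t (p.1 + 1)) T).toNNReal ω -
          W p.2 (min (G.t p.1) T).toNNReal ω)) ?_ ?_
      · refine Measurable.mul ((hadapt p).mono (filtW_mono (G.mono hpq.le)) le_rfl)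
          (Measurable.sub (hm _ (le_min (G.t_nonneg _) hT) ((min_le_left _ _).trans hle))
            (hm _ (le_min (G.t_nonneg _) hT) ((min_le_left _ _).trans (G.mono hpq.le))))
      · filter_upwards [e] with ω hω
        rw [stepFun, hω]
    · refine (integral_congr_ae (ae_of_all _ fun u => ?_)).trans (integral_zero _ _)
      by_cases h : u ∈ Ioc (min (G.t p.1) T) (min (G.t (p.1 + 1)) T)
      · have h' : u ∉ Ioc (min (G.t q.1) T) (min (G.t (q.1 + 1)) T) := fun h' =>
          absurd (h.2.trans (min_le_min_right T hle)) (not_le.2 h'.1)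
        simp [stepFun, indicator_of_notMem h']
      · simp [stepFun, indicator_of_notMem h]
  refine ⟨fun p _ => G.t_nonneg _, fun p _ => hadapt p, fun p _ => ?_, fun p _ => hmem p,
    fun p _ => hzero p, fun p _ => ?_, fun p _ q _ => ?_⟩
  · obtain ⟨C, hC⟩ := G.bounded
    exact ⟨C, fun ω => (PiLp.norm_apply_le (G.ξ p.1 ω) p.2).trans (hC _ _)⟩
  · rw [stepFun, indicator_indicator, inter_eq_self_of_subset_right]
    exact fun s hs => ⟨(le_min (G.t_nonneg _) hT).trans_lt hs.1, hs.2.trans (min_le_right _ _)⟩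
  · rcases lt_trichotomy p.1 q.1 with h | h | h
    · rw [(hlt p q h).1, (hlt p q h).2, mul_zero]
    · exact integral_mul_wiener_mul_wiener hW (hmem p) (hmem q) (G.t_nonneg p.1) (hzero p)
        (by rw [h]; exact hzero q) (hadapt p) (by rw [h]; exact hadapt q)
    · rw [integral_congr_ae (ae_of_all P fun ω => mul_comm _ _), (hlt q p h).1,
        integral_congr_ae (ae_of_all posVol fun u => real_inner_comm _ _), (hlt q p h).2, mul_zero]

lemma memLp_integral (hW : IsStdBrownian W P) (hT : 0 ≤ T) : MemLp (G.integral T) 2 P :=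
  (memLp_finsetSum _ fun _ hp => (G.isElementaryFamily hW hT).memLp_term hp).ae_eq
    (G.sum_wiener_stepFun hT)

theorem integral_sub_residual_sq (hX : IsExpSolution hW T y a m X) (hT : 0 ≤ T) :
    ∫ ω, (G.integral T ω - residual X a (m 0) T ω) ^ 2 ∂P =
      ∫ s in (0 : ℝ)..T, ∫ ω, ‖G.eval s ω - X s ω • y s‖ ^ 2 ∂P := by
  have h := (G.isElementaryFamily hW hT).integral_sub_residual_sq hX hT
  have e1 : ∫ ω, (G.integral T ω - residual X a (m 0) T ω) ^ 2 ∂P =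
      ∫ ω, ((∑ p ∈ Finset.range G.n ×ˢ (Finset.univ : Finset (Fin d)),
        G.ξ p.1 ω p.2 * wiener hW (G.stepFun T p) ω) - residual X a (m 0) T ω) ^ 2 ∂P := by
    refine integral_congr_ae ?_
    filter_upwards [G.sum_wiener_stepFun (hW := hW) hT] with ω hω
    rw [← hω]
  rw [e1, h, intervalIntegral.integral_of_le hT, intervalIntegral.integral_of_le hT]
  refine setIntegral_congr_fun measurableSet_Ioc fun s hs => ?_
  simp only [G.sum_smul_stepFun hs]

end SimpleProcess

end Isometry

/-! ### Approximating the integrand by simple processes -/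

section Density

set_option linter.unusedSectionVars false

lemma eLpNorm_two_eq {β E : Type*} [MeasurableSpace β] [NormedAddCommGroup E] {ν : Measure β}
    {F : β → E} (hF : MemLp F 2 ν) :
    eLpNorm F 2 ν = ENNReal.ofReal (Real.sqrt (∫ b, ‖F b‖ ^ 2 ∂ν)) := by
  rw [hF.eLpNorm_eq_integral_rpow_norm (by norm_num) (by norm_num), Real.sqrt_eq_rpow]
  norm_num

lemma tendsto_eLpNorm_two_zero {β E : Type*} [MeasurableSpace β] [NormedAddCommGroup E]
    {ν : Measure β} {F : ℕ → β → E} {g : β → ℝ} (hF : ∀ n, AEStronglyMeasurable (F n) ν)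
    (hg : MemLp g 2 ν) (hb : ∀ n, ∀ᵐ b ∂ν, ‖F n b‖ ≤ g b)
    (hlim : ∀ᵐ b ∂ν, Tendsto (fun n => F n b) atTop (𝓝 0)) :
    Tendsto (fun n => eLpNorm (F n) 2 ν) atTop (𝓝 0) := by
  have hmem : ∀ n, MemLp (F n) 2 ν := fun n => hg.of_le (hF n) (by
    filter_upwards [hb n] with b h
    exact h.trans (le_abs_self _))
  have h1 : Tendsto (fun n => ∫ b, ‖F n b‖ ^ 2 ∂ν) atTop (𝓝 (∫ _, (0 : ℝ) ∂ν)) := by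
    refine tendsto_integral_of_dominated_convergence (fun b => g b ^ 2)
      (fun n => (hF n).norm.pow 2) hg.integrable_sq (fun n => ?_) ?_
    · filter_upwards [hb n] with b h
      rw [norm_pow, norm_norm]
      exact pow_le_pow_left₀ (norm_nonneg _) h 2
    · filter_upwards [hlim] with b h
      simpa using h.norm.pow 2
  rw [integral_zero] at h1
  have h2 := ENNReal.tendsto_ofReal ((Real.continuous_sqrt.tendsto 0).comp h1)
  rw [Real.sqrt_zero, ENNReal.ofReal_zero] at h2
  exact h2.congr fun n => (eLpNorm_two_eq (hmem n)).symm

variable {Ω : Type*} [MeasurableSpace Ω] {P : Measure Ω} [IsProbabilityMeasure P] {d : ℕ}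
  {W : Fin d → ℝ≥0 → Ω → ℝ} {T : ℝ} {y : ℝ → EuclideanSpace ℝ (Fin d)} {X : ℝ → Ω → ℝ}

/-- The product of Lebesgue measure on `[0,T]` and `P`. -/
def timeProd (P : Measure Ω) (T : ℝ) : Measure (ℝ × Ω) := (volume.restrict (Icc 0 T)).prod P

lemma timeProd_eq (P : Measure Ω) (T : ℝ) :
    timeProd P T = (volume.restrict (Ioc 0 T)).prod P := by
  rw [timeProd, Measure.restrict_congr_set Ioc_ae_eq_Icc]

instance : IsFiniteMeasure (timeProd P T) := by rw [timeProd]; infer_instance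

lemma ae_timeProd_of_forall {p : ℝ × Ω → Prop} (h : ∀ s ∈ Ioc 0 T, ∀ ω, p (s, ω)) :
    ∀ᵐ z ∂timeProd P T, p z := by
  have h1 : ∀ᵐ z : ℝ × Ω ∂timeProd P T, z.1 ∈ Ioc 0 T := by
    rw [timeProd_eq]
    exact Measure.quasiMeasurePreserving_fst.ae (ae_restrict_mem measurableSet_Ioc)
  filter_upwards [h1] with z hz
  exact h z.1 hz z.2

lemma SimpleProcess.measurable_eval (hW : IsStdBrownian W P) (G : SimpleProcess W P) :
    Measurable fun p : ℝ × Ω => G.eval p.1 p.2 := by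
  unfold SimpleProcess.eval
  refine Finset.measurable_sum _ fun i _ => ?_
  have h : (fun p : ℝ × Ω => (Ioc (G.t i) (G.t (i + 1))).indicator (fun _ => G.ξ i p.2) p.1) =
      (Prod.fst ⁻¹' Ioc (G.t i) (G.t (i + 1))).indicator fun p => G.ξ i p.2 := by
    ext1 p
    by_cases h : p.1 ∈ Ioc (G.t i) (G.t (i + 1)) <;> simp [indicator, h]
  rw [h]
  exact (((G.adapted i).mono (filtW_le hW _) le_rfl).comp measurable_snd).indicator
    (measurable_fst measurableSet_Ioc)

lemma SimpleProcess.memLp_eval (hW : IsStdBrownian W P) (G : SimpleProcess W P) :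
    MemLp (fun p : ℝ × Ω => G.eval p.1 p.2) 2 (timeProd P T) := by
  obtain ⟨C, hC⟩ := G.bounded
  refine MemLp.of_bound (G.measurable_eval hW).aestronglyMeasurable (∑ _i ∈ Finset.range G.n, C)
    (ae_of_all _ fun p => (norm_sum_le _ _).trans (Finset.sum_le_sum fun i _ => ?_))
  exact (norm_indicator_le_norm_self _ _).trans (hC i p.2)

lemma memLp_smul_process (hX : IsL2Process P T X) (hT : 0 ≤ T)
    (hy : MemLp y 2 (volume.restrict (Icc 0 T))) :
    MemLp (fun p : ℝ × Ω => X p.1 p.2 • y p.1) 2 (timeProd P T) := by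
  have hm : AEStronglyMeasurable (fun p : ℝ × Ω => X p.1 p.2 • y p.1) (timeProd P T) :=
    AEStronglyMeasurable.smul hX.measurable.aestronglyMeasurable hy.1.comp_fst
  rw [memLp_two_iff_integrable_sq_norm hm, timeProd_eq]
  rw [Measure.restrict_congr_set Ioc_ae_eq_Icc.symm] at hy
  have h := hX.integrable_mul_sq hT (a := fun s => ‖y s‖ ^ 2)
    ((intervalIntegrable_iff_integrableOn_Ioc_of_le hT).2
      ((memLp_two_iff_integrable_sq_norm hy.1).1 hy))
  refine h.congr (ae_of_all _ fun p => ?_)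
  simp only [norm_smul, mul_pow, Real.norm_eq_abs, sq_abs]
  ring

lemma integral_timeProd_norm_sq {F : ℝ → Ω → EuclideanSpace ℝ (Fin d)} (hT : 0 ≤ T)
    (hF : MemLp (fun p : ℝ × Ω => F p.1 p.2) 2 (timeProd P T)) :
    ∫ p, ‖F p.1 p.2‖ ^ 2 ∂timeProd P T = ∫ s in (0 : ℝ)..T, ∫ ω, ‖F s ω‖ ^ 2 ∂P := by
  have h := (memLp_two_iff_integrable_sq_norm hF.1).1 hF
  rw [timeProd_eq] at h ⊢
  rw [intervalIntegral.integral_of_le hT, integral_prod _ h]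

lemma eLpNorm_smul_process_le (hX : IsL2Process P T X) (hT : 0 ≤ T) {C : ℝ} (hC0 : 0 ≤ C)
    (hC : ∀ s ∈ Icc 0 T, ∫ ω, X s ω ^ 2 ∂P ≤ C ^ 2)
    (hy : MemLp y 2 (volume.restrict (Icc 0 T))) :
    eLpNorm (fun p : ℝ × Ω => X p.1 p.2 • y p.1) 2 (timeProd P T) ≤
      ENNReal.ofReal C * eLpNorm y 2 (volume.restrict (Icc 0 T)) := by
  have hm := memLp_smul_process hX hT hy
  rw [eLpNorm_two_eq hm, integral_timeProd_norm_sq (F := fun s ω => X s ω • y s) hT hm,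
    eLpNorm_two_eq hy, ← ENNReal.ofReal_mul hC0]
  refine ENNReal.ofReal_le_ofReal ?_
  rw [← Real.sqrt_sq hC0, ← Real.sqrt_mul (sq_nonneg C)]
  refine Real.sqrt_le_sqrt ?_
  have hy2 := (memLp_two_iff_integrable_sq_norm hy.1).1 hy
  rw [Measure.restrict_congr_set Ioc_ae_eq_Icc.symm] at hy2 ⊢
  rw [intervalIntegral.integral_of_le hT, ← integral_const_mul]
  simp only [norm_smul, mul_pow, Real.norm_eq_abs, sq_abs, integral_mul_const]
  have h1 := hX.integrable_integral_sq hT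
    ((intervalIntegrable_iff_integrableOn_Ioc_of_le hT).2 hy2)
  rw [intervalIntegrable_iff_integrableOn_Ioc_of_le hT] at h1
  refine setIntegral_mono_on (h1.congr (ae_of_all _ fun s => mul_comm _ _)) (hy2.const_mul _)
    measurableSet_Ioc fun s hs => ?_
  exact mul_le_mul_of_nonneg_right (hC s ⟨hs.1.le, hs.2⟩) (sq_nonneg _)

/-- `H` belongs to the `L²([0,T] × Ω)`-closure of the simple processes. -/
def IsSimpleLimit (W : Fin d → ℝ≥0 → Ω → ℝ) (P : Measure Ω) (T : ℝ)
    (H : ℝ × Ω → EuclideanSpace ℝ (Fin d)) : Prop :=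
  ∀ ε : ℝ, 0 < ε → ∃ G : SimpleProcess W P,
    eLpNorm (fun p : ℝ × Ω => G.eval p.1 p.2 - H p) 2 (timeProd P T) ≤ ENNReal.ofReal ε

lemma IsSimpleLimit.of_approx (hW : IsStdBrownian W P) {H : ℝ × Ω → EuclideanSpace ℝ (Fin d)}
    (hH : AEStronglyMeasurable H (timeProd P T))
    (h : ∀ ε : ℝ, 0 < ε → ∃ H', AEStronglyMeasurable H' (timeProd P T) ∧ IsSimpleLimit W P T H' ∧
      eLpNorm (fun p => H' p - H p) 2 (timeProd P T) ≤ ENNReal.ofReal ε) :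
    IsSimpleLimit W P T H := by
  intro ε hε
  obtain ⟨H', hm, h1, h2⟩ := h (ε / 2) (half_pos hε)
  obtain ⟨G, hG⟩ := h1 (ε / 2) (half_pos hε)
  refine ⟨G, ?_⟩
  have h3 := eLpNorm_add_le (p := 2) (f := fun p : ℝ × Ω => G.eval p.1 p.2 - H' p)
    (g := fun p => H' p - H p) ((G.measurable_eval hW).aestronglyMeasurable.sub hm) (hm.sub hH)
    (by norm_num)
  have h4 : ((fun p : ℝ × Ω => G.eval p.1 p.2 - H' p) + fun p => H' p - H p) =
      fun p => G.eval p.1 p.2 - H p := by ext1 p; simp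
  rw [h4] at h3
  refine h3.trans ((add_le_add hG h2).trans_eq ?_)
  rw [← ENNReal.ofReal_add (half_pos hε).le (half_pos hε).le, add_halves]

lemma IsSimpleLimit.of_tendsto (hW : IsStdBrownian W P) {H : ℝ × Ω → EuclideanSpace ℝ (Fin d)}
    (hH : AEStronglyMeasurable H (timeProd P T)) (H' : ℕ → ℝ × Ω → EuclideanSpace ℝ (Fin d))
    (hm : ∀ n, AEStronglyMeasurable (H' n) (timeProd P T)) (h : ∀ n, IsSimpleLimit W P T (H' n))
    (hlim : Tendsto (fun n => eLpNorm (fun p => H' n p - H p) 2 (timeProd P T)) atTop (𝓝 0)) :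
    IsSimpleLimit W P T H := by
  refine .of_approx hW hH fun ε hε => ?_
  obtain ⟨n, hn⟩ := ((tendsto_order.1 hlim).2 _ (ENNReal.ofReal_pos.2 hε)).exists
  exact ⟨H' n, hm n, h n, hn.le⟩

/-- The simple process sampling `K` along the grid of mesh `T / (N + 1)`. -/
def sample (hT : 0 < T) (K : ℝ → Ω → EuclideanSpace ℝ (Fin d))
    (hK : ∀ t, 0 ≤ t → Measurable[filtW W P t] (K t)) (hb : ∃ C : ℝ, ∀ t ω, ‖K t ω‖ ≤ C)
    (N : ℕ) : SimpleProcess W P where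
  n := N + 1
  t i := i * (T / (N + 1))
  ξ i := K (i * (T / (N + 1)))
  mono i j h := mul_le_mul_of_nonneg_right (Nat.cast_le.2 h) (by positivity)
  nonneg := by simp
  adapted i := hK _ (by positivity)
  bounded := hb.imp fun _ hC _ ω => hC _ ω

lemma exists_sample_eval_eq (hT : 0 < T) (K : ℝ → Ω → EuclideanSpace ℝ (Fin d))
    (hK : ∀ t, 0 ≤ t → Measurable[filtW W P t] (K t)) (hb : ∃ C : ℝ, ∀ t ω, ‖K t ω‖ ≤ C)
    (N : ℕ) {s : ℝ} (hs : s ∈ Ioc 0 T) :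
    ∃ u, |u - s| ≤ T / (N + 1) ∧ ∀ ω, (sample (W := W) (P := P) hT K hK hb N).eval s ω = K u ω := by
  set δ := T / (N + 1) with hδ
  have hδ0 : 0 < δ := by positivity
  have hNδ : (N + 1 : ℝ) * δ = T := by rw [hδ]; field_simp
  -- Cells are open on the left and closed on the right, so the one containing `s` has index `⌈s/δ⌉
  -- - 1`; positivity of `s` makes this a natural number.
  obtain ⟨k, hk⟩ : ∃ k, ⌈s / δ⌉₊ = k + 1 :=
    Nat.exists_eq_succ_of_ne_zero (Nat.ceil_pos.2 (div_pos hs.1 hδ0)).ne'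
  have h1 : s ≤ ((k + 1 : ℕ) : ℝ) * δ := by
    rw [← hk, ← div_le_iff₀ hδ0]; exact Nat.le_ceil _
  have h2 : (k : ℝ) * δ < s := by
    rw [← lt_div_iff₀ hδ0]
    exact Nat.lt_ceil.1 (by omega)
  have hkN : k < N + 1 := by
    by_contra hcon
    have h3 : ((N + 1 : ℕ) : ℝ) ≤ k := Nat.cast_le.2 (not_lt.1 hcon)
    have h4 := mul_le_mul_of_nonneg_right h3 hδ0.le
    push_cast at h4
    rw [hNδ] at h4
    linarith [hs.2]
  refine ⟨k * δ, ?_, fun ω => ?_⟩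
  · push_cast at h1
    rw [abs_le]; constructor <;> nlinarith
  · rw [SimpleProcess.eval]
    change ∑ i ∈ Finset.range (N + 1), (Ioc ((i : ℝ) * δ) (((i + 1 : ℕ) : ℝ) * δ)).indicator
      (fun _ => K (i * δ) ω) s = K (k * δ) ω
    rw [Finset.sum_eq_single_of_mem k (Finset.mem_range.2 hkN)]
    · exact indicator_of_mem (s := Ioc ((k : ℝ) * δ) (((k + 1 : ℕ) : ℝ) * δ)) ⟨h2, h1⟩ _
    · intro i _ hik
      refine indicator_of_notMem (fun hi => ?_) _
      rcases lt_or_gt_of_ne hik with h | h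
      · have h5 : ((i + 1 : ℕ) : ℝ) ≤ k := Nat.cast_le.2 h
        have := mul_le_mul_of_nonneg_right h5 hδ0.le
        linarith [hi.2]
      · have h5 : ((k + 1 : ℕ) : ℝ) ≤ i := Nat.cast_le.2 h
        have := mul_le_mul_of_nonneg_right h5 hδ0.le
        linarith [hi.1]

/-- Left-endpoint samples converge pointwise by continuity, and boundedness allows dominated
convergence. -/
lemma isSimpleLimit_of_bounded (hW : IsStdBrownian W P) (hT : 0 < T)
    (K : ℝ → Ω → EuclideanSpace ℝ (Fin d)) (hK : ∀ t, 0 ≤ t → Measurable[filtW W P t] (K t))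
    (hb : ∃ C : ℝ, ∀ t ω, ‖K t ω‖ ≤ C) (hc : ∀ ω, Continuous fun t => K t ω)
    (hm : Measurable (Function.uncurry K)) : IsSimpleLimit W P T fun p => K p.1 p.2 := by
  have hlim : Tendsto (fun N => eLpNorm (fun p : ℝ × Ω =>
      (sample (W := W) (P := P) hT K hK hb N).eval p.1 p.2 - K p.1 p.2) 2 (timeProd P T))
      atTop (𝓝 0) := by
    obtain ⟨C, hC⟩ := hb
    refine tendsto_eLpNorm_two_zero (g := fun _ => 2 * C) (fun N =>
      ((SimpleProcess.measurable_eval hW _).sub hm).aestronglyMeasurable) (memLp_const _)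
      (fun N => ae_timeProd_of_forall fun s hs ω => ?_) (ae_timeProd_of_forall fun s hs ω => ?_)
    · obtain ⟨u, -, hu⟩ := exists_sample_eval_eq hT K hK ⟨C, hC⟩ N hs
      simp only
      rw [hu]
      linarith [norm_sub_le (K u ω) (K s ω), hC u ω, hC s ω]
    · have h1 : ∀ N : ℕ, ∃ u, |u - s| ≤ T / (N + 1) ∧ ∀ ω,
          (sample (W := W) (P := P) hT K hK ⟨C, hC⟩ N).eval s ω = K u ω :=
        fun N => exists_sample_eval_eq hT K hK ⟨C, hC⟩ N hs
      choose u hu1 hu2 using h1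
      have h2 : Tendsto (fun N : ℕ => T / ((N : ℝ) + 1)) atTop (𝓝 0) :=
        tendsto_const_div_atTop_nhds_zero_nat T |>.comp (tendsto_add_atTop_nat 1) |>.congr
          fun N => by simp
      have h3 : Tendsto u atTop (𝓝 s) := by
        rw [tendsto_iff_dist_tendsto_zero]
        exact squeeze_zero (fun _ => dist_nonneg) hu1 h2
      have h4 := (((hc ω).tendsto s).comp h3).sub_const (K s ω)
      rw [sub_self] at h4
      exact h4.congr fun N => by simp only [Function.comp_apply]; rw [hu2]
  intro ε hε
  obtain ⟨n, hn⟩ := ((tendsto_order.1 hlim).2 _ (ENNReal.ofReal_pos.2 hε)).exists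
  exact ⟨_, hn.le⟩

/-- Clipping `X` at `±n` reduces to a bounded process; the clipped values eventually equal `X` and
are dominated by it. -/
lemma isSimpleLimit_smul_continuous (hW : IsStdBrownian W P) (hT : 0 < T)
    (hX : IsL2Process P T X) (hXc : ∀ ω, Continuous fun t => X t ω)
    (hXa : ∀ t, 0 ≤ t → Measurable[filtW W P t] (X t))
    {g : ℝ → EuclideanSpace ℝ (Fin d)} (hg : Continuous g) {C : ℝ} (hC : ∀ s, ‖g s‖ ≤ C) :
    IsSimpleLimit W P T fun p => X p.1 p.2 • g p.1 := by
  have hC0 : 0 ≤ C := (norm_nonneg _).trans (hC 0)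
  let clip : ℕ → ℝ → ℝ := fun n x => max (-n) (min x n)
  have hclip_c : ∀ n, Continuous (clip n) := fun n => by fun_prop
  have hclip_b : ∀ n x, |clip n x| ≤ n := fun n x => by
    have : (0 : ℝ) ≤ n := Nat.cast_nonneg n
    exact abs_le.2 ⟨le_max_left _ _, max_le (by linarith) (min_le_right _ _)⟩
  have hclip_lim : ∀ x, ∀ᶠ n in atTop, clip n x = x := fun x => by
    obtain ⟨N, hN⟩ := exists_nat_ge |x|
    filter_upwards [eventually_ge_atTop N] with n hn
    have h1 : |x| ≤ n := hN.trans (Nat.cast_le.2 hn)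
    have h2 := abs_le.1 h1
    simp only [clip]
    rw [min_eq_left h2.2, max_eq_right h2.1]
  have hclip_le : ∀ n x, |clip n x| ≤ |x| := fun n x => by
    have : (0 : ℝ) ≤ n := Nat.cast_nonneg n
    rw [abs_le]
    constructor
    · rcases le_total x n with h | h
      · simp only [clip]; rw [min_eq_left h]; exact (neg_abs_le x).trans (le_max_right _ _)
      · simp only [clip]; rw [min_eq_right h]
        exact (neg_nonpos.2 (abs_nonneg x)).trans (this.trans (le_max_right _ _))
    · exact max_le (by linarith [abs_nonneg x]) ((min_le_left _ _).trans (le_abs_self x))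
  have hmX : ∀ n, Measurable (Function.uncurry fun t ω => clip n (X t ω) • g t) := fun n =>
    Measurable.smul ((hclip_c n).measurable.comp hX.measurable) (hg.measurable.comp measurable_fst)
  have hgm : MemLp g 2 (volume.restrict (Icc 0 T)) :=
    MemLp.of_bound hg.aestronglyMeasurable C (ae_of_all _ hC)
  have hXg := memLp_smul_process hX hT.le hgm
  refine .of_tendsto hW hXg.1 (fun n p => clip n (X p.1 p.2) • g p.1)
    (fun n => (hmX n).aestronglyMeasurable) (fun n => ?_) ?_
  · refine isSimpleLimit_of_bounded hW hT (fun t ω => clip n (X t ω) • g t) (fun t ht => ?_)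
      ⟨n * C, fun t ω => ?_⟩ (fun ω => ((hclip_c n).comp (hXc ω)).smul hg) (hmX n)
    · exact (Measurable.comp (hclip_c n).measurable (hXa t ht)).smul_const _
    · rw [norm_smul]
      exact mul_le_mul (hclip_b n _) (hC t) (norm_nonneg _) (Nat.cast_nonneg n)
  · refine tendsto_eLpNorm_two_zero (g := fun p => 2 * ‖X p.1 p.2 • g p.1‖)
      (fun n => (hmX n).aestronglyMeasurable.sub hXg.1) (hXg.norm.const_mul 2)
      (fun n => ae_of_all _ fun p => ?_) (ae_of_all _ fun p => ?_)
    · rw [← sub_smul, norm_smul, norm_smul, ← mul_assoc]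
      refine mul_le_mul_of_nonneg_right ?_ (norm_nonneg _)
      rw [Real.norm_eq_abs, Real.norm_eq_abs]
      linarith [abs_sub (clip n (X p.1 p.2)) (X p.1 p.2), hclip_le n (X p.1 p.2)]
    · refine tendsto_const_nhds.congr' ?_
      filter_upwards [hclip_lim (X p.1 p.2)] with n hn
      rw [hn, sub_self]

theorem isSimpleLimit_smul (hW : IsStdBrownian W P) (hT : 0 < T)
    (hX : IsL2Process P T X) (hXc : ∀ ω, Continuous fun t => X t ω)
    (hXa : ∀ t, 0 ≤ t → Measurable[filtW W P t] (X t))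
    (hy : MemLp y 2 (volume.restrict (Icc 0 T))) :
    IsSimpleLimit W P T fun p => X p.1 p.2 • y p.1 := by
  refine .of_approx hW (memLp_smul_process hX hT.le hy).1 fun ε hε => ?_
  obtain ⟨C, hC⟩ := hX.bounded
  have hC0 : 0 ≤ C := (integral_nonneg fun _ => sq_nonneg _).trans (hC 0 ⟨le_rfl, hT.le⟩)
  -- `√C` bounds the `L²` norm of `X_s` uniformly in `s`, so it multiplies the error in `y`; the
  -- added 1 keeps the quotient meaningful when `C = 0`.
  obtain ⟨g, hg, hgm⟩ := hy.exists_boundedContinuous_eLpNorm_sub_le (by norm_num)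
    (ε := ENNReal.ofReal (ε / (Real.sqrt C + 1))) (ENNReal.ofReal_pos.2 (by positivity)).ne'
  refine ⟨fun p => X p.1 p.2 • g p.1, (memLp_smul_process hX hT.le hgm).1,
    isSimpleLimit_smul_continuous hW hT hX hXc hXa g.continuous fun s => g.norm_coe_le_norm s, ?_⟩
  have h1 := eLpNorm_smul_process_le hX hT.le (C := Real.sqrt C) (Real.sqrt_nonneg _)
    (by rwa [Real.sq_sqrt hC0]) (hy.sub hgm)
  have h2 : eLpNorm (fun p : ℝ × Ω => X p.1 p.2 • g p.1 - X p.1 p.2 • y p.1) 2 (timeProd P T) =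
      eLpNorm (fun p : ℝ × Ω => X p.1 p.2 • (y - g) p.1) 2 (timeProd P T) := by
    rw [← eLpNorm_neg]
    congr 1
    ext1 p
    rw [Pi.neg_apply, neg_sub, Pi.sub_apply, smul_sub]
  rw [h2]
  refine h1.trans ((mul_le_mul_right hg _).trans ?_)
  rw [← ENNReal.ofReal_mul (Real.sqrt_nonneg _)]
  refine ENNReal.ofReal_le_ofReal ?_
  rw [mul_div_assoc', div_le_iff₀ (by positivity)]
  nlinarith

end Density

/-! ### Measurability and boundedness of càdlàg coefficients -/

section Cadlag

/-- By right continuity `f` is the limit of its values at grid points decreasing to `t`; rounding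
strictly upwards keeps those points on the right of `t`. -/
lemma IsCadlag.aestronglyMeasurable {f : ℝ → ℝ} (hf : IsCadlag f) (T : ℝ) :
    AEStronglyMeasurable f (volume.restrict (Icc 0 T)) := by
  have hm : ∀ n : ℕ, Measurable fun t : ℝ => f ((⌊t * (n + 1)⌋ + 1 : ℤ) / (n + 1)) := fun n =>
    (measurable_from_top (f := fun k : ℤ => f ((k + 1 : ℤ) / (n + 1)))).comp
      (Int.measurable_floor.comp (measurable_id.mul_const _))
  refine (aemeasurable_of_tendsto_metrizable_ae atTop (fun n => (hm n).aemeasurable)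
    ?_).aestronglyMeasurable
  filter_upwards [ae_restrict_mem measurableSet_Icc] with t ht
  have hpos : ∀ n : ℕ, (0 : ℝ) < n + 1 := fun n => by positivity
  have h1 : ∀ n : ℕ, t ≤ (⌊t * (n + 1)⌋ + 1 : ℤ) / (n + 1) := fun n => by
    rw [le_div_iff₀ (hpos n)]
    push_cast
    exact (Int.lt_floor_add_one _).le
  have h2 : ∀ n : ℕ, ((⌊t * (n + 1)⌋ + 1 : ℤ) : ℝ) / (n + 1) ≤ t + 1 / (n + 1) := fun n => by
    rw [div_le_iff₀ (hpos n), add_mul, div_mul_cancel₀ _ (hpos n).ne']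
    push_cast
    linarith [Int.floor_le (t * (n + 1))]
  have h3 : Tendsto (fun n : ℕ => ((⌊t * (n + 1)⌋ + 1 : ℤ) : ℝ) / (n + 1)) atTop (𝓝 t) := by
    refine tendsto_of_tendsto_of_tendsto_of_le_of_le tendsto_const_nhds ?_ h1 h2
    simpa using tendsto_one_div_add_atTop_nhds_zero_nat (𝕜 := ℝ) |>.const_add t
  exact (hf.1 t ht.1).tendsto.comp (tendsto_nhdsWithin_iff.2 ⟨h3, Eventually.of_forall h1⟩)

/-- One-sided limits bound `f` near every point, and compactness makes the bound uniform. -/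
lemma IsCadlag.exists_bound {f : ℝ → ℝ} (hf : IsCadlag f) (T : ℝ) :
    ∃ C : ℝ, ∀ t ∈ Icc 0 T, |f t| ≤ C := by
  refine isCompact_Icc.induction_on (p := fun s => ∃ C : ℝ, ∀ t ∈ s, |f t| ≤ C)
    ⟨0, fun t ht => absurd ht (notMem_empty t)⟩ (fun s t hst ⟨C, hC⟩ => ⟨C, fun u hu => hC u (hst hu)⟩)
    ?_ ?_
  · rintro s t ⟨C, hC⟩ ⟨D, hD⟩
    exact ⟨max C D, fun u hu => hu.elim (fun h => (hC u h).trans (le_max_left _ _))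
      fun h => (hD u h).trans (le_max_right _ _)⟩
  · intro t ht
    have hb : ∀ {l : Filter ℝ} {L : ℝ}, Tendsto f l (𝓝 L) → ∀ᶠ u in l, |f u| ≤ |L| + 1 := by
      intro l L h
      filter_upwards [(h.abs.eventually (eventually_lt_nhds (lt_add_one |L|)))] with u hu using hu.le
    have hr := hb (hf.1 t ht.1).tendsto
    rcases eq_or_lt_of_le ht.1 with h0 | h0
    · subst h0
      exact ⟨_, nhdsWithin_mono _ Icc_subset_Ici_self hr, |f 0| + 1, fun u hu => hu⟩
    · obtain ⟨L, hL⟩ := hf.2 t h0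
      have hl := hb hL
      have hn : ∀ᶠ u in 𝓝 t, |f u| ≤ max (|f t| + 1) (|L| + 1) := by
        rw [← nhdsLT_sup_nhdsGE t]
        exact eventually_sup.2 ⟨hl.mono fun u hu => hu.trans (le_max_right _ _),
          hr.mono fun u hu => hu.trans (le_max_left _ _)⟩
      exact ⟨_, mem_nhdsWithin_of_mem_nhds hn, _, fun u hu => hu⟩

lemma IsCadlag.integrableOn {f : ℝ → ℝ} (hf : IsCadlag f) (T : ℝ) : IntegrableOn f (Icc 0 T) := by
  obtain ⟨C, hC⟩ := hf.exists_bound T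
  refine Integrable.of_bound (hf.aestronglyMeasurable T) C ?_
  filter_upwards [ae_restrict_mem measurableSet_Icc] with t ht using hC t ht

end Cadlag

/-! ### Existence and uniqueness of the wealth process -/

section WealthProcess

set_option linter.unusedSectionVars false

variable {Ω : Type*} [MeasurableSpace Ω] {P : Measure Ω} [IsProbabilityMeasure P] {d : ℕ}
  {W : Fin d → ℝ≥0 → Ω → ℝ} {M : Market d} {T x : ℝ} {c : Control d}

/-- The drift `r - v + y'θ` of the logarithmic wealth equation. -/
def drift (M : Market d) (c : Control d) (s : ℝ) : ℝ := M.r s - c.v s + inner ℝ (c.y s) (M.θ s)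

/-- The mean wealth. -/
def meanWealth (M : Market d) (x : ℝ) (c : Control d) (t : ℝ) : ℝ :=
  x * Real.exp (∫ s in (0 : ℝ)..t, drift M c s)

/-- The diffusion coefficient, restricted to `[0,T]`. -/
def cutoff (T : ℝ) (y : ℝ → EuclideanSpace ℝ (Fin d)) : ℝ → EuclideanSpace ℝ (Fin d) :=
  (Icc 0 T).indicator y

lemma meanWealth_zero : meanWealth M x c 0 = x := by simp [meanWealth]

lemma meanWealth_pos (hx : 0 < x) (t : ℝ) : 0 < meanWealth M x c t :=
  mul_pos hx (Real.exp_pos _)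

lemma intervalIntegrable_of_Icc {f : ℝ → ℝ} (hT : 0 ≤ T) (hf : IntegrableOn f (Icc 0 T)) :
    IntervalIntegrable f volume 0 T :=
  (intervalIntegrable_iff_integrableOn_Icc_of_le hT).2 hf

lemma intervalIntegrable_inner {f g : ℝ → EuclideanSpace ℝ (Fin d)} (hT : 0 ≤ T)
    (hf : SqIntegrable T f) (hg : SqIntegrable T g) :
    IntervalIntegrable (fun s => inner ℝ (f s) (g s)) volume 0 T :=
  intervalIntegrable_of_Icc hT (integrable_inner_of_memLp hf hg)

lemma intervalIntegrable_drift (hT : 0 ≤ T) (hθ : SqIntegrable T M.θ) (hc : c.IsAdmissible T) :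
    IntervalIntegrable (drift M c) volume 0 T :=
  ((intervalIntegrable_of_Icc hT (M.cadlag_r.integrableOn T)).sub
    (intervalIntegrable_of_Icc hT hc.integrable)).add
    (intervalIntegrable_inner hT hc.sq_integrable hθ)

lemma isPrimitive_meanWealth (hT : 0 ≤ T) (hθ : SqIntegrable T M.θ) (hc : c.IsAdmissible T) :
    IsPrimitive T (meanWealth M x c) (fun s => meanWealth M x c s * drift M c s) := by
  have h := ((IsPrimitive.of_intervalIntegrable
    (intervalIntegrable_drift hT hθ hc) 0).exp hT).const_mul x
  simpa [meanWealth, mul_assoc] using! h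

lemma memLp_cutoff {y : ℝ → EuclideanSpace ℝ (Fin d)} (hy : SqIntegrable T y) :
    MemLp (cutoff T y) 2 posVol :=
  ((memLp_indicator_iff_restrict measurableSet_Icc).2 hy).mono_measure Measure.restrict_le_self

lemma cutoff_of_mem {y : ℝ → EuclideanSpace ℝ (Fin d)} {s : ℝ} (hs : s ∈ Icc 0 T) :
    cutoff T y s = y s := indicator_of_mem hs _

lemma continuous_clamp {T : ℝ} : Continuous fun t : ℝ => max 0 (min T t) := by fun_prop

lemma clamp_mem {T : ℝ} (hT : 0 ≤ T) (t : ℝ) : max 0 (min T t) ∈ Icc 0 T :=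
  ⟨le_max_left _ _, max_le hT (min_le_left _ _)⟩

lemma clamp_of_mem {T t : ℝ} (ht : t ∈ Icc 0 T) : max 0 (min T t) = t := by
  rw [min_eq_right ht.2, max_eq_right ht.1]

lemma IsExpSolution.eLpNorm_integral_sub {hW : IsStdBrownian W P}
    {y : ℝ → EuclideanSpace ℝ (Fin d)} {a m : ℝ → ℝ} {X : ℝ → Ω → ℝ}
    (hX : IsExpSolution hW T y a m X) (hT : 0 ≤ T) (G : SimpleProcess W P) :
    eLpNorm (fun ω => G.integral T ω - residual X a (m 0) T ω) 2 P =
      eLpNorm (fun p : ℝ × Ω => G.eval p.1 p.2 - X p.1 p.2 • y p.1) 2 (timeProd P T) := by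
  have hy : MemLp y 2 (volume.restrict (Icc 0 T)) := by
    rw [Measure.restrict_congr_set Ioc_ae_eq_Icc.symm]
    exact hX.memLp.mono_measure (Measure.restrict_mono (fun s hs => hs.1) le_rfl)
  have h1 := (G.memLp_integral hW hT).sub (hX.memLp_residual hT (m 0))
  have h2 := (G.memLp_eval hW (T := T)).sub (memLp_smul_process (hX.isL2 hT) hT hy)
  have e := G.integral_sub_residual_sq hX hT
  rw [← integral_timeProd_norm_sq (F := fun s ω => G.eval s ω - X s ω • y s) hT h2] at e
  have h3 := eLpNorm_two_eq h1
  have h4 := eLpNorm_two_eq h2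
  simp only [Pi.sub_apply, Real.norm_eq_abs, sq_abs] at h3 h4
  rw [e] at h3
  exact h3.trans h4.symm

lemma eLpNorm_timeProd_mono {E : Type*} [NormedAddCommGroup E] {t : ℝ} (ht : t ≤ T)
    (F : ℝ × Ω → E) : eLpNorm F 2 (timeProd P t) ≤ eLpNorm F 2 (timeProd P T) :=
  eLpNorm_mono_measure F (Measure.prod_mono
    (Measure.restrict_mono (Icc_subset_Icc_right ht) le_rfl) le_rfl)

lemma eLpNorm_timeProd_congr {E : Type*} [NormedAddCommGroup E] {F F' : ℝ × Ω → E}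
    (h : ∀ s ∈ Ioc 0 T, ∀ ω, F (s, ω) = F' (s, ω)) :
    eLpNorm F 2 (timeProd P T) = eLpNorm F' 2 (timeProd P T) :=
  eLpNorm_congr_ae (ae_timeProd_of_forall h)

/-- Mean times stochastic exponential, built on the continuous Wiener integral and frozen outside
`[0,T]` so that paths are continuous everywhere, which also gives joint measurability. By the exact
distance formula, simple processes approximating `X y` have integrals converging to the residual at
every `t`, so the residual is the Itô integral. -/
theorem exists_wealth (hW : IsStdBrownian W P) (hT : 0 < T) (hθ : SqIntegrable T M.θ)
    (hx : 0 < x) (hc : c.IsAdmissible T) :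
    ∃ X, IsWealth W P M T x c X ∧
      IsExpSolution hW T (cutoff T c.y) (drift M c) (meanWealth M x c) X := by
  have hy := memLp_cutoff hc.sq_integrable
  obtain ⟨N, hNc, hNa, hNe⟩ := exists_continuous_version hW hT hy
  set p : ℝ → ℝ := fun t => max 0 (min T t) with hp
  have hpm : ∀ t, p t ∈ Icc 0 T := clamp_mem hT.le
  have hpt : ∀ t, 0 ≤ t → p t ≤ t := fun t ht => max_le ht (min_le_right _ _)
  have hm := isPrimitive_meanWealth (x := x) hT.le hθ hc
  have hq := (IsPrimitive.of_intervalIntegrable (intervalIntegrable_norm_sq hy le_rfl hT.le) 0)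
  simp only [zero_add] at hq
  let X : ℝ → Ω → ℝ := fun t ω => meanWealth M x c (p t) *
    Real.exp (N (p t) ω - (∫ s in (0 : ℝ)..(p t), ‖cutoff T c.y s‖ ^ 2) / 2)
  have hXc : ∀ ω, Continuous fun t => X t ω := fun ω =>
    ((hm.continuousOn hT.le).comp_continuous continuous_clamp hpm).mul
      (Real.continuous_exp.comp (((hNc ω).comp continuous_clamp).sub
        (((hq.continuousOn hT.le).comp_continuous continuous_clamp hpm).div_const 2)))
  have hXa : ∀ t, 0 ≤ t → Measurable[filtW W P t] (X t) := by
    intro t ht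
    exact (((((hNa _ (hpm t)).mono (filtW_mono (hpt t ht)) le_rfl).sub_const _).exp).const_mul _)
  have hXm : ∀ t, Measurable (X t) := fun t =>
    ((((hNa _ (hpm t)).mono (filtW_le hW _) le_rfl).sub_const _).exp).const_mul _
  have hsol : IsExpSolution hW T (cutoff T c.y) (drift M c) (meanWealth M x c) X := by
    refine ⟨hy, measurable_uncurry_of_continuous_of_measurable hXc hXm,
      intervalIntegrable_drift hT.le hθ hc, hm, fun t ht => ?_⟩
    filter_upwards [hNe t ht] with ω hω
    simp only [X, hp, clamp_of_mem ht, expMart, hω]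
  have hL := hsol.isL2 hT.le
  refine ⟨X, ⟨fun t ht => hXa t ht.1, ae_of_all _ fun ω => (hXc ω).continuousOn,
    ae_of_all _ fun ω t _ => mul_pos (meanWealth_pos hx _) (Real.exp_pos _), ?_,
    residual X (drift M c) x, ?_, fun t _ => ae_of_all _ fun ω => ?_⟩, hsol⟩
  · obtain ⟨C, hC⟩ := hL.bounded
    refine ⟨(Real.sqrt C).toNNReal, fun t ht => ?_⟩
    rw [eLpNorm_two_eq (hL.memLp t ht)]
    refine ENNReal.ofReal_le_ofReal (Real.sqrt_le_sqrt ?_)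
    simpa using hC t ht
  · have hlim := isSimpleLimit_smul hW hT hL hXc hXa hc.sq_integrable
    choose G hG using fun n : ℕ => hlim (1 / (n + 1)) (by positivity)
    have h0 : Tendsto (fun n : ℕ => ENNReal.ofReal (1 / (n + 1))) atTop (𝓝 0) := by
      have := ENNReal.tendsto_ofReal (tendsto_one_div_add_atTop_nhds_zero_nat (𝕜 := ℝ))
      simpa using this
    refine ⟨G, tendsto_of_tendsto_of_tendsto_of_le_of_le tendsto_const_nhds h0
      (fun _ => zero_le) hG, fun t ht => ?_⟩
    refine tendsto_of_tendsto_of_tendsto_of_le_of_le tendsto_const_nhds h0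
      (fun _ => zero_le) fun n => ?_
    have h1 := (hsol.mono ht).eLpNorm_integral_sub ht.1 (G n)
    rw [meanWealth_zero] at h1
    simp only
    rw [h1]
    refine (eLpNorm_timeProd_mono ht.2 _).trans ((eLpNorm_timeProd_congr ?_).trans_le (hG n))
    intro s hs ω
    simp only
    rw [cutoff_of_mem ⟨hs.1.le, hs.2⟩]
  · simp only [residual, drift]; ring

/-- A wealth process is indistinguishable from a jointly measurable one. -/
lemma IsWealth.exists_modification (hW : IsStdBrownian W P) (hT : 0 < T) {X : ℝ → Ω → ℝ}
    (hX : IsWealth W P M T x c X) :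
    ∃ X', IsL2Process P T X' ∧ ∀ᵐ ω ∂P, ∀ t ∈ Icc 0 T, X' t ω = X t ω := by
  classical
  set N := toMeasurable P {ω | ¬ ContinuousOn (fun t => X t ω) (Icc 0 T)} with hN
  have hN0 : P N = 0 := by rw [hN, measure_toMeasurable]; exact hX.continuous
  have hNm : MeasurableSet N := measurableSet_toMeasurable _ _
  have hgood : ∀ ω, ω ∉ N → ContinuousOn (fun t => X t ω) (Icc 0 T) := by
    intro ω hω
    by_contra h
    exact hω (subset_toMeasurable _ _ h)
  let X' : ℝ → Ω → ℝ := fun t ω => if ω ∈ N then 0 else X (max 0 (min T t)) ω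
  have hm : ∀ t, Measurable (X' t) := fun t => Measurable.ite hNm measurable_const
    ((hX.adapted _ (clamp_mem hT.le t)).mono (filtW_le hW _) le_rfl)
  have hc : ∀ ω, Continuous fun t => X' t ω := by
    intro ω
    by_cases h : ω ∈ N
    · simpa [X', h] using continuous_const
    · simp only [X', h, if_false]
      exact (hgood ω h).comp_continuous continuous_clamp (clamp_mem hT.le)
  have hae : ∀ᵐ ω ∂P, ∀ t ∈ Icc 0 T, X' t ω = X t ω := by
    filter_upwards [measure_eq_zero_iff_ae_notMem.1 hN0] with ω hω t ht
    simp only [X', hω, if_false, clamp_of_mem ht]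
  obtain ⟨C, hC⟩ := hX.bounded
  have hmem : ∀ t ∈ Icc 0 T, MemLp (X' t) 2 P ∧ eLpNorm (X' t) 2 P ≤ C := by
    intro t ht
    have e : eLpNorm (X' t) 2 P = eLpNorm (X t) 2 P :=
      eLpNorm_congr_ae (hae.mono fun ω h => h t ht)
    have hle := e.trans_le (hC t ht)
    exact ⟨⟨(hm t).aestronglyMeasurable, hle.trans_lt ENNReal.coe_lt_top⟩, hle⟩
  refine ⟨X', ⟨measurable_uncurry_of_continuous_of_measurable hc hm, fun t ht => (hmem t ht).1,
    (C : ℝ) ^ 2, fun t ht => ?_⟩, hae⟩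
  have h1 := (hmem t ht).2
  rw [eLpNorm_two_eq (hmem t ht).1, ENNReal.ofReal_le_coe] at h1
  have h2 : Real.sqrt (∫ ω, ‖X' t ω‖ ^ 2 ∂P) ≤ C := by
    simpa using h1
  rw [Real.sqrt_le_left C.coe_nonneg] at h2
  simpa using h2

/-- The Itô integrals in two wealth equations differ at most by the `L²`-distance of the
integrands. -/
lemma IsItoIntegral.integral_sub_residual_sq_le {hW : IsStdBrownian W P}
    {y : ℝ → EuclideanSpace ℝ (Fin d)} {a m : ℝ → ℝ} {X X' I : ℝ → Ω → ℝ}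
    {H : ℝ → Ω → EuclideanSpace ℝ (Fin d)}
    (hI : IsItoIntegral W P T H I) (hX : IsExpSolution hW T y a m X)
    (hX' : IsL2Process P T X') (hy : MemLp y 2 (volume.restrict (Icc 0 T)))
    (hH : (fun p : ℝ × Ω => H p.1 p.2) =ᵐ[timeProd P T] fun p => X' p.1 p.2 • y p.1)
    {t : ℝ} (ht : t ∈ Icc 0 T) (hIm : AEStronglyMeasurable (I t) P) :
    MemLp (fun ω => I t ω - residual X a (m 0) t ω) 2 P ∧
    ∫ ω, (I t ω - residual X a (m 0) t ω) ^ 2 ∂P ≤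
      ∫ s in (0 : ℝ)..t, ‖y s‖ ^ 2 * ∫ ω, (X' s ω - X s ω) ^ 2 ∂P := by
  obtain ⟨G, hG1, hG2⟩ := hI
  have hT : 0 ≤ T := ht.1.trans ht.2
  have hXt := hX.mono ht
  have hac : timeProd P t ≪ timeProd P T := (Measure.prod_mono
    (Measure.restrict_mono (Icc_subset_Icc_right ht.2) le_rfl) le_rfl).absolutelyContinuous
  have hyt : MemLp y 2 (volume.restrict (Icc 0 t)) :=
    hy.mono_measure (Measure.restrict_mono (Icc_subset_Icc_right ht.2) le_rfl)
  have hD : IsL2Process P t (fun s ω => X' s ω - X s ω) :=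
    (hX'.mono ht.2).sub (hXt.isL2 ht.1)
  have hDm := memLp_smul_process hD ht.1 hyt
  have hXm := memLp_smul_process (hXt.isL2 ht.1) ht.1 hyt
  have hX'm := memLp_smul_process (hX'.mono ht.2) ht.1 hyt
  have hr : MemLp (residual X a (m 0) t) 2 P := hXt.memLp_residual ht.1 (m 0)
  have hle : eLpNorm (fun ω => I t ω - residual X a (m 0) t ω) 2 P ≤
      eLpNorm (fun p : ℝ × Ω => (X' p.1 p.2 - X p.1 p.2) • y p.1) 2 (timeProd P t) := by
    -- Go through the integral of `G n`: it tends to `I t`, and its distance to the residual equals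
    -- that of `G n` to `X y`, which is compared with `X' y` via `H`.
    have hlim : Tendsto (fun n => eLpNorm (fun ω => (G n).integral t ω - I t ω) 2 P +
        (eLpNorm (fun p : ℝ × Ω => (G n).eval p.1 p.2 - H p.1 p.2) 2 (timeProd P T) +
        eLpNorm (fun p : ℝ × Ω => (X' p.1 p.2 - X p.1 p.2) • y p.1) 2 (timeProd P t))) atTop
        (𝓝 (0 + (0 + eLpNorm (fun p : ℝ × Ω => (X' p.1 p.2 - X p.1 p.2) • y p.1) 2
          (timeProd P t)))) := (hG2 t ht).add (hG1.add tendsto_const_nhds)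
    rw [zero_add, zero_add] at hlim
    refine ge_of_tendsto hlim (Eventually.of_forall fun n => ?_)
    have hGm := ((G n).memLp_integral hW ht.1).1
    have hGe := ((G n).memLp_eval hW (T := t)).1
    have h1 := eLpNorm_sub_le (p := 2) (hGm.sub hr.1) (hGm.sub hIm) (by norm_num)
    have e1 : ((G n).integral t - residual X a (m 0) t - ((G n).integral t - I t)) =
        fun ω => I t ω - residual X a (m 0) t ω := by ext ω; simp
    rw [e1] at h1
    have h2 := hXt.eLpNorm_integral_sub ht.1 (G n)
    have h3 := eLpNorm_add_le (p := 2)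
      (f := fun p : ℝ × Ω => (G n).eval p.1 p.2 - X' p.1 p.2 • y p.1) (hGe.sub hX'm.1) hDm.1
      (by norm_num)
    have e2 : ((fun p : ℝ × Ω => (G n).eval p.1 p.2 - X' p.1 p.2 • y p.1) +
        fun p : ℝ × Ω => (X' p.1 p.2 - X p.1 p.2) • y p.1) =
        fun p : ℝ × Ω => (G n).eval p.1 p.2 - X p.1 p.2 • y p.1 := by
      ext1 p
      simp [sub_smul]
    have h4 : eLpNorm (fun p : ℝ × Ω => (G n).eval p.1 p.2 - X' p.1 p.2 • y p.1) 2
        (timeProd P t) ≤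
        eLpNorm (fun p : ℝ × Ω => (G n).eval p.1 p.2 - H p.1 p.2) 2 (timeProd P T) := by
      refine le_trans (le_of_eq (eLpNorm_congr_ae ?_)) (eLpNorm_timeProd_mono ht.2 _)
      filter_upwards [hac.ae_le hH] with p hp
      rw [hp]
    rw [e2, ← h2] at h3
    rw [add_comm]
    exact h1.trans (add_le_add (h3.trans (add_le_add h4 le_rfl)) le_rfl)
  have hmem : MemLp (fun ω => I t ω - residual X a (m 0) t ω) 2 P :=
    ⟨hIm.sub hr.1, hle.trans_lt hDm.2⟩
  refine ⟨hmem, ?_⟩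
  rw [eLpNorm_two_eq hmem, eLpNorm_two_eq hDm, integral_timeProd_norm_sq
    (F := fun s ω => (X' s ω - X s ω) • y s) ht.1 hDm,
    ENNReal.ofReal_le_ofReal_iff (Real.sqrt_nonneg _)] at hle
  have hnn : 0 ≤ ∫ s in (0 : ℝ)..t, ∫ ω, ‖(X' s ω - X s ω) • y s‖ ^ 2 ∂P :=
    intervalIntegral.integral_nonneg ht.1 fun s _ => integral_nonneg fun _ => sq_nonneg _
  have h5 := (Real.sqrt_le_sqrt_iff hnn).1 hle
  simp only [Real.norm_eq_abs, sq_abs, norm_smul, mul_pow, integral_mul_const] at h5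
  simpa only [mul_comm] using h5

/-- Uniqueness: the difference from the explicit solution is a time integral of itself plus a
difference of Itô integrals. Bounding both in mean square by the earlier mean square differences
sets up Gronwall's inequality. -/
theorem IsWealth.ae_eq (hW : IsStdBrownian W P) (hT : 0 < T) (hθ : SqIntegrable T M.θ)
    (hx : 0 < x) (hc : c.IsAdmissible T) {X : ℝ → Ω → ℝ} (hX : IsWealth W P M T x c X) {t : ℝ}
    (ht : t ∈ Icc 0 T) :
    X t =ᵐ[P] fun ω => meanWealth M x c t * expMart hW (cutoff T c.y) t ω := by
  obtain ⟨X₀, -, hX₀⟩ := exists_wealth hW hT hθ hx hc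
  obtain ⟨X', hX', hae⟩ := hX.exists_modification hW hT
  obtain ⟨I, hI, heq⟩ := hX.equation
  set a := drift M c with ha
  have hai := hX₀.intervalIntegrable
  have hL₀ := hX₀.isL2 hT.le
  have hD := hX'.sub hL₀
  have hcut : ∀ s ∈ Icc 0 T, cutoff T c.y s = c.y s := fun s hs => cutoff_of_mem hs
  have hy : MemLp (cutoff T c.y) 2 (volume.restrict (Icc 0 T)) :=
    hc.sq_integrable.ae_eq (by
      filter_upwards [ae_restrict_mem measurableSet_Icc] with s hs using (hcut s hs).symm)
  have hres : ∀ t ∈ Icc 0 T, I t =ᵐ[P] residual X' a x t := by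
    intro t ht
    filter_upwards [heq t ht, hae] with ω h1 h2
    have h3 : ∫ s in (0 : ℝ)..t, X' s ω * a s =
        ∫ s in (0 : ℝ)..t, X s ω * (M.r s - c.v s + inner ℝ (c.y s) (M.θ s)) := by
      refine intervalIntegral.integral_congr fun s hs => ?_
      rw [uIcc_of_le ht.1] at hs
      simp only [ha, drift, h2 s ⟨hs.1, hs.2.trans ht.2⟩]
    rw [residual, h3, h2 t ht, h1]; ring
  have hIm : ∀ t ∈ Icc 0 T, AEStronglyMeasurable (I t) P := fun t ht => by
    have hai' := (hX₀.mono ht).intervalIntegrable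
    exact (((((hX'.memLp t ht).1.sub aestronglyMeasurable_const)).sub
      ((hX'.mono ht.2).stronglyMeasurable_timeIntegral ht.1 hai')).congr (hres t ht).symm)
  have hH : (fun p : ℝ × Ω => X p.1 p.2 • c.y p.1) =ᵐ[timeProd P T]
      fun p => X' p.1 p.2 • cutoff T c.y p.1 := by
    have h1 : ∀ᵐ p : ℝ × Ω ∂timeProd P T, ∀ t ∈ Icc 0 T, X' t p.2 = X t p.2 :=
      Measure.quasiMeasurePreserving_snd.ae hae
    have h2 : ∀ᵐ p : ℝ × Ω ∂timeProd P T, p.1 ∈ Ioc 0 T := ae_timeProd_of_forall fun s hs _ => hs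
    filter_upwards [h1, h2] with p h1 h2
    rw [h1 p.1 ⟨h2.1.le, h2.2⟩, hcut p.1 ⟨h2.1.le, h2.2⟩]
  have hsq := intervalIntegrable_norm_sq hX₀.memLp le_rfl hT.le
  set K := ∫ s in (0 : ℝ)..T, |a s| with hK
  -- The factors 2 come from `(u+v)² ≤ 2u² + 2v²`. The first summand is the weighted Cauchy-Schwarz
  -- bound for the drift, the second the isometry bound for the stochastic part.
  let κ : ℝ → ℝ := fun s => 2 * K * |a s| + 2 * ‖cutoff T c.y s‖ ^ 2
  have hκ : IntervalIntegrable κ volume 0 T := (hai.abs.const_mul _).add (hsq.const_mul 2)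
  have hK0 : 0 ≤ K := intervalIntegral.integral_nonneg hT.le fun _ _ => abs_nonneg _
  have hmain : ∀ t ∈ Icc 0 T, ∫ ω, (X' t ω - X₀ t ω) ^ 2 ∂P = 0 := by
    refine eq_zero_of_le_integral_mul hκ (fun s _ => by positivity)
      (hD.integrable_integral_sq hT.le hκ) (fun s _ => integral_nonneg fun _ => sq_nonneg _) ?_
    intro t ht
    have hDt := hD.mono ht.2
    have hai' := (hX₀.mono ht).intervalIntegrable
    have hsq' := intervalIntegrable_norm_sq hX₀.memLp le_rfl ht.1
    obtain ⟨hm, hle⟩ := hI.integral_sub_residual_sq_le hX₀ hX' hy hH ht (hIm t ht)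
    rw [meanWealth_zero] at hm hle
    have hJ := hDt.integral_timeIntegral_sq_le ht.1 hai'
    have hJm := hDt.memLp_timeIntegral ht.1 hai'
    have hdec : ∀ᵐ ω ∂P, X' t ω - X₀ t ω = (∫ s in (0 : ℝ)..t, (X' s ω - X₀ s ω) * a s) +
        (I t ω - residual X₀ a x t ω) := by
      filter_upwards [hres t ht, (hX'.mono ht.2).ae_integrable ht.1 hai',
        (hL₀.mono ht.2).ae_integrable ht.1 hai'] with ω h1 h2 h3
      simp only [sub_mul]
      rw [h1, residual, residual, intervalIntegral.integral_sub h2 h3]; ring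
    have hgi : IntervalIntegrable (fun s => |a s| * ∫ ω, (X' s ω - X₀ s ω) ^ 2 ∂P) volume 0 t :=
      hDt.integrable_integral_sq ht.1 hai'.abs
    have hgi2 : IntervalIntegrable (fun s => ‖cutoff T c.y s‖ ^ 2 *
      ∫ ω, (X' s ω - X₀ s ω) ^ 2 ∂P) volume 0 t := hDt.integrable_integral_sq ht.1 hsq'
    have hgpos : 0 ≤ ∫ s in (0 : ℝ)..t, |a s| * ∫ ω, (X' s ω - X₀ s ω) ^ 2 ∂P :=
      intervalIntegral.integral_nonneg ht.1 fun s _ =>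
        mul_nonneg (abs_nonneg _) (integral_nonneg fun _ => sq_nonneg _)
    have hKt : ∫ s in (0 : ℝ)..t, |a s| ≤ K :=
      intervalIntegral.integral_mono_interval le_rfl ht.1 ht.2
        (ae_of_all _ fun _ => abs_nonneg _) hai.abs
    calc ∫ ω, (X' t ω - X₀ t ω) ^ 2 ∂P
        ≤ ∫ ω, (2 * (∫ s in (0 : ℝ)..t, (X' s ω - X₀ s ω) * a s) ^ 2 +
          2 * (I t ω - residual X₀ a x t ω) ^ 2) ∂P := by
          refine integral_mono_ae (hDt.memLp t ⟨ht.1, le_rfl⟩).integrable_sq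
            ((hJm.integrable_sq.const_mul 2).add (hm.integrable_sq.const_mul 2)) ?_
          filter_upwards [hdec] with ω h
          simp only [h]
          nlinarith [sq_nonneg ((∫ s in (0 : ℝ)..t, (X' s ω - X₀ s ω) * a s) -
            (I t ω - residual X₀ a x t ω))]
      _ = 2 * ∫ ω, (∫ s in (0 : ℝ)..t, (X' s ω - X₀ s ω) * a s) ^ 2 ∂P +
          2 * ∫ ω, (I t ω - residual X₀ a x t ω) ^ 2 ∂P := by
          rw [integral_add (hJm.integrable_sq.const_mul 2) (hm.integrable_sq.const_mul 2),
            integral_const_mul, integral_const_mul]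
      _ ≤ 2 * (K * ∫ s in (0 : ℝ)..t, |a s| * ∫ ω, (X' s ω - X₀ s ω) ^ 2 ∂P) +
          2 * ∫ s in (0 : ℝ)..t, ‖cutoff T c.y s‖ ^ 2 * ∫ ω, (X' s ω - X₀ s ω) ^ 2 ∂P := by
          have := mul_le_mul_of_nonneg_right hKt hgpos
          linarith
      _ = ∫ s in (0 : ℝ)..t, κ s * ∫ ω, (X' s ω - X₀ s ω) ^ 2 ∂P := by
          rw [← intervalIntegral.integral_const_mul, ← intervalIntegral.integral_const_mul,
            ← intervalIntegral.integral_const_mul,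
            ← intervalIntegral.integral_add ((hgi.const_mul K).const_mul 2) (hgi2.const_mul 2)]
          refine intervalIntegral.integral_congr fun s _ => ?_
          simp only [κ]; ring
  have h0 := (integral_eq_zero_iff_of_nonneg (fun _ => sq_nonneg _)
    (hD.memLp t ht).integrable_sq).1 (hmain t ht)
  filter_upwards [h0, hae, hX₀.ae_eq t ht] with ω h1 h2 h3
  rw [← h3, ← h2 t ht]
  exact sub_eq_zero.1 (pow_eq_zero_iff (two_ne_zero)|>.1 h1)

end WealthProcess

/-! ### Tail estimates for the normal distribution -/

section NormalTail

/-- The unnormalized upper tail `∫_z^∞ e^{-t²/2} dt` of the normal distribution. -/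
def gaussTail (z : ℝ) : ℝ := ∫ t in Ioi z, Real.exp (-t ^ 2 / 2)

lemma integrable_exp_neg_sq : Integrable fun t : ℝ => Real.exp (-t ^ 2 / 2) := by
  have h := integrable_exp_neg_mul_sq (b := 1 / 2) (by norm_num)
  refine h.congr (ae_of_all _ fun t => ?_)
  simp only
  ring_nf

lemma gaussTail_pos (z : ℝ) : 0 < gaussTail z := by
  rw [gaussTail, setIntegral_pos_iff_support_of_nonneg_ae
    (ae_of_all _ fun t => (Real.exp_pos _).le) integrable_exp_neg_sq.integrableOn]
  have h : Function.support (fun t : ℝ => Real.exp (-t ^ 2 / 2)) = univ :=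
    Function.support_eq_univ fun t => (Real.exp_pos _).ne'
  rw [h, univ_inter, Real.volume_Ioi]
  exact ENNReal.zero_lt_top

/-- After translating by `δ`, use `(t+δ)² ≥ t² + 2aδ + δ²` for `t > a`; the surplus factor
`exp(-δ²/2)` gives strictness. -/
lemma gaussTail_add_lt {a δ : ℝ} (hδ : 0 < δ) :
    gaussTail (a + δ) < Real.exp (-(a * δ)) * gaussTail a := by
  have h1 : gaussTail (a + δ) = ∫ t in Ioi a, Real.exp (-(t + δ) ^ 2 / 2) := by
    rw [gaussTail, ← integral_indicator measurableSet_Ioi, ← integral_indicator measurableSet_Ioi,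
      ← integral_add_right_eq_self _ δ]
    refine integral_congr_ae (ae_of_all _ fun t => ?_)
    by_cases h : a < t
    · simp [indicator, h]
    · simp [indicator, h]
  have h2 : ∀ t ∈ Ioi a, Real.exp (-(t + δ) ^ 2 / 2) ≤
      Real.exp (-δ ^ 2 / 2) * (Real.exp (-(a * δ)) * Real.exp (-t ^ 2 / 2)) := fun t ht => by
    have ht : a < t := ht
    rw [← Real.exp_add, ← Real.exp_add]
    refine Real.exp_le_exp.2 ?_
    nlinarith
  have h3 : gaussTail (a + δ) ≤ Real.exp (-δ ^ 2 / 2) * (Real.exp (-(a * δ)) * gaussTail a) := by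
    rw [h1, gaussTail, ← integral_const_mul, ← integral_const_mul]
    refine setIntegral_mono_on ?_ ((integrable_exp_neg_sq.const_mul _).const_mul _).integrableOn
      measurableSet_Ioi h2
    exact (integrable_exp_neg_sq.comp_add_right δ).integrableOn
  refine h3.trans_lt (mul_lt_of_lt_one_left (mul_pos (Real.exp_pos _) (gaussTail_pos a)) ?_)
  rw [Real.exp_lt_one_iff]
  nlinarith [sq_pos_of_pos hδ]

lemma gaussTail_zero : gaussTail 0 = Real.sqrt (2 * Real.pi) / 2 := by
  have h := integral_gaussian_Ioi (1 / 2)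
  rw [gaussTail, ← show Real.pi / (1 / 2) = 2 * Real.pi by ring, ← h]
  refine integral_congr_ae (ae_of_all _ fun t => ?_)
  simp only
  ring_nf

lemma gaussTail_strictAnti : StrictAnti gaussTail := by
  intro a b hab
  rw [gaussTail, gaussTail, ← Ioc_union_Ioi_eq_Ioi hab.le, setIntegral_union
    (Ioc_disjoint_Ioi le_rfl) measurableSet_Ioi integrable_exp_neg_sq.integrableOn
    integrable_exp_neg_sq.integrableOn]
  refine lt_add_of_pos_left _ ?_
  rw [← intervalIntegral.integral_of_le hab.le]
  exact intervalIntegral.intervalIntegral_pos_of_pos_on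
    integrable_exp_neg_sq.intervalIntegrable (fun t _ => Real.exp_pos _) hab

lemma continuous_gaussTail : Continuous gaussTail := by
  have h : ∀ z, gaussTail z = gaussTail 0 - ∫ t in (0 : ℝ)..z, Real.exp (-t ^ 2 / 2) := fun z => by
    rw [gaussTail, gaussTail, ← intervalIntegral.integral_Ioi_sub_Ioi'
      integrable_exp_neg_sq.integrableOn integrable_exp_neg_sq.integrableOn]
    ring
  have h2 : gaussTail = fun z => gaussTail 0 - ∫ t in (0 : ℝ)..z, Real.exp (-t ^ 2 / 2) :=
    funext h
  rw [h2]
  exact continuous_const.sub (intervalIntegral.continuous_primitive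
    (fun a b => integrable_exp_neg_sq.intervalIntegrable) 0)

/-- Completing the square shifts the Gaussian density by `s`; the reflection `u = s - n` turns the
lower tail into an upper one. -/
lemma setIntegral_exp_gaussianReal (s z : ℝ) :
    ∫ n in Iic z, Real.exp (s * n - s ^ 2 / 2) ∂gaussianReal 0 1 =
      (Real.sqrt (2 * Real.pi))⁻¹ * gaussTail (s - z) := by
  rw [← integral_indicator measurableSet_Iic, integral_gaussianReal_eq_integral_smul one_ne_zero,
    gaussTail, ← integral_Ici_eq_integral_Ioi, ← integral_indicator measurableSet_Ici,
    ← integral_sub_left_eq_self _ _ s, ← integral_const_mul]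
  refine integral_congr_ae (ae_of_all _ fun u => ?_)
  by_cases h : s - u ≤ z
  · have h' : s - z ≤ u := by linarith
    simp only [indicator, mem_Iic, mem_Ici, h, h', if_true, smul_eq_mul, gaussianPDFReal,
      NNReal.coe_one, mul_one]
    rw [mul_assoc, ← Real.exp_add]
    ring_nf
  · have h' : ¬ s - z ≤ u := by intro h'; exact h (by linarith)
    simp [indicator, h, h']

lemma gaussianReal_real_Iic (z : ℝ) :
    (gaussianReal 0 1).real (Iic z) = (Real.sqrt (2 * Real.pi))⁻¹ * gaussTail (-z) := by
  have h := setIntegral_exp_gaussianReal 0 z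
  simp only [zero_mul, ne_eq, OfNat.ofNat_ne_zero, not_false_eq_true, zero_pow, zero_div, sub_self,
    Real.exp_zero, zero_sub, setIntegral_const, smul_eq_mul, mul_one] at h
  exact h

lemma sqrt_two_pi_pos : 0 < Real.sqrt (2 * Real.pi) := Real.sqrt_pos.2 (by positivity)

lemma cdf_strictMono : StrictMono (cdf (gaussianReal 0 1)) := by
  intro a b hab
  rw [cdf_eq_real, cdf_eq_real, gaussianReal_real_Iic, gaussianReal_real_Iic]
  exact mul_lt_mul_of_pos_left (gaussTail_strictAnti (neg_lt_neg hab)) (inv_pos.2 sqrt_two_pi_pos)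

lemma continuous_cdf_gaussianReal : Continuous (cdf (gaussianReal 0 1)) := by
  have h : (cdf (gaussianReal 0 1) : ℝ → ℝ) =
      fun z => (Real.sqrt (2 * Real.pi))⁻¹ * gaussTail (-z) :=
    funext fun z => by rw [cdf_eq_real, gaussianReal_real_Iic]
  rw [h]
  exact continuous_const.mul (continuous_gaussTail.comp continuous_neg)

variable {α : ℝ}

lemma cdf_zq (hα0 : 0 < α) (hα1 : α < 1) : cdf (gaussianReal 0 1) (zq α) = α := by
  obtain ⟨a, ha⟩ := ((tendsto_order.1 (tendsto_cdf_atBot (gaussianReal 0 1))).2 α hα0).exists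
  obtain ⟨b, hb⟩ := ((tendsto_order.1 (tendsto_cdf_atTop (gaussianReal 0 1))).1 α hα1).exists
  obtain ⟨z, hz⟩ := mem_range_of_exists_le_of_exists_ge continuous_cdf_gaussianReal
    ⟨a, ha.le⟩ ⟨b, hb.le⟩
  have h : {w : ℝ | α ≤ cdf (gaussianReal 0 1) w} = Ici z := by
    ext w
    rw [mem_ofPred_eq, ← hz, cdf_strictMono.le_iff_le]
    rfl
  rw [zq, h, csInf_Ici, hz]

lemma zq_neg (hα0 : 0 < α) (hα1 : α < 1 / 2) : zq α < 0 := by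
  have h : cdf (gaussianReal 0 1) 0 = 1 / 2 := by
    rw [cdf_eq_real, gaussianReal_real_Iic, neg_zero, gaussTail_zero]
    field_simp [sqrt_two_pi_pos.ne']
  rw [← cdf_strictMono.lt_iff_lt, h, cdf_zq hα0 (by linarith)]
  exact hα1

lemma inv_mul_gaussTail_abs_zq (hα0 : 0 < α) (hα1 : α < 1 / 2) :
    (Real.sqrt (2 * Real.pi))⁻¹ * gaussTail |zq α| = α := by
  rw [abs_of_neg (zq_neg hα0 hα1), ← gaussianReal_real_Iic, ← cdf_eq_real,
    cdf_zq hα0 (by linarith)]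

lemma Fα_eq (α z : ℝ) : Fα α z = gaussTail z / gaussTail |zq α| := rfl

lemma Fα_pos (α z : ℝ) : 0 < Fα α z := div_pos (gaussTail_pos _) (gaussTail_pos _)

lemma log_Fα_abs_zq (α : ℝ) : Real.log (Fα α |zq α|) = 0 := by
  rw [Fα_eq, div_self (gaussTail_pos _).ne', Real.log_one]

/-- A difference form of the bound `(ln F_α)'(z) < -z`. It takes the place of differentiation in all
estimates of `ψ`. -/
lemma log_Fα_add_lt (α : ℝ) {a δ : ℝ} (hδ : 0 < δ) :
    Real.log (Fα α (a + δ)) < Real.log (Fα α a) - a * δ := by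
  rw [Fα_eq, Fα_eq, Real.log_div (gaussTail_pos _).ne' (gaussTail_pos _).ne',
    Real.log_div (gaussTail_pos _).ne' (gaussTail_pos _).ne']
  have h := Real.log_lt_log (gaussTail_pos _) (gaussTail_add_lt (a := a) hδ)
  rw [Real.log_mul (Real.exp_pos _).ne' (gaussTail_pos _).ne', Real.log_exp] at h
  linarith

lemma continuous_log_Fα (α : ℝ) : Continuous fun z => Real.log (Fα α z) := by
  simp only [Fα_eq]
  exact (continuous_gaussTail.div_const _).log fun z =>
    (div_pos (gaussTail_pos _) (gaussTail_pos _)).ne'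

lemma log_Fα_antitone (α : ℝ) : Antitone fun z => Real.log (Fα α z) := fun a b hab => by
  refine Real.log_le_log (Fα_pos _ _) ?_
  rw [Fα_eq, Fα_eq]
  exact div_le_div_of_nonneg_right (gaussTail_strictAnti.antitone hab) (gaussTail_pos _).le

end NormalTail

/-! ### Monotonicity of ψ and the critical value -/

section CriticalValue

variable {d : ℕ} {M : Market d} {T α ζ : ℝ}

lemma normL2_nonneg (T : ℝ) (f : ℝ → EuclideanSpace ℝ (Fin d)) : 0 ≤ normL2 T f :=
  Real.sqrt_nonneg _

/-- From `a` to `b` the linear term gains `‖θ‖(b-a)`, while the logarithm loses more than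
`(|z_α|+a)(b-a)`. -/
lemma psi_strictAntiOn (hα0 : 0 < α) (hα1 : α < 1 / 2) (hz : 2 * normL2 T M.θ ≤ |zq α|) :
    StrictAntiOn (fun ρ => psi M T α ρ 1) (Ici 0) := by
  intro a ha b _ hab
  have ha : 0 ≤ a := ha
  have h := log_Fα_add_lt α (a := |zq α| + a) (sub_pos.2 hab)
  have h0 := normL2_nonneg T M.θ
  have hz0 : 0 < |zq α| := abs_pos.2 (zq_neg hα0 hα1).ne
  simp only [psi, one_pow, mul_one]
  rw [show |zq α| + a + (b - a) = |zq α| + b by ring] at h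
  have h1 : normL2 T M.θ * (b - a) ≤ (|zq α| + a) * (b - a) :=
    mul_le_mul_of_nonneg_right (by linarith) (by linarith)
  linarith

lemma continuous_psi : Continuous fun ρ => psi M T α ρ 1 := by
  simp only [psi, one_pow, mul_one]
  exact (continuous_const.mul continuous_id).add
    ((continuous_log_Fα α).comp (continuous_const.add continuous_id))

lemma psi_zero : psi M T α 0 1 = 0 := by
  simp [psi, log_Fα_abs_zq]

lemma psi_le_neg (hz : 2 * normL2 T M.θ ≤ |zq α|) {ρ : ℝ} (hρ : 0 < ρ) :
    psi M T α ρ 1 ≤ -(|zq α| / 2 * ρ) := by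
  have h := log_Fα_add_lt α (a := |zq α|) hρ
  rw [log_Fα_abs_zq] at h
  simp only [psi, one_pow, mul_one]
  nlinarith

/-- As `1-u² = (1-u)(1+u)`, it suffices that `‖θ‖(1+u) ≤ |z_α| + ρu`; since `1+u` ranges up to 2,
this uses the full strength of `hz`. -/
lemma psi_one_le (hz : 2 * normL2 T M.θ ≤ |zq α|) {ρ u : ℝ} (hρ : 0 ≤ ρ) (hu0 : 0 ≤ u)
    (hu1 : u ≤ 1) : psi M T α ρ 1 ≤ psi M T α ρ u := by
  rcases eq_or_lt_of_le (mul_nonneg hρ (sub_nonneg.2 hu1)) with h0 | hpos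
  · rcases mul_eq_zero.1 h0.symm with h | h
    · subst h; simp [psi]
    · rw [← sub_eq_zero.1 h]
  · have h := log_Fα_add_lt α (a := |zq α| + ρ * u) hpos
    rw [show |zq α| + ρ * u + ρ * (1 - u) = |zq α| + ρ * 1 by ring] at h
    simp only [psi, one_pow, mul_one] at h ⊢
    have h0 := normL2_nonneg T M.θ
    have h1 : normL2 T M.θ * (1 + u) ≤ |zq α| + ρ * u := by nlinarith [mul_nonneg hρ hu0]
    have h2 := mul_le_mul_of_nonneg_right h1 hpos.le
    nlinarith

/-- Existence of the critical value as the zero of `ψ(·,1) - ln(1-ζ)`. -/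
lemma exists_critical (hα0 : 0 < α) (hα1 : α < 1 / 2) (hz : 2 * normL2 T M.θ ≤ |zq α|)
    (hζ0 : 0 < ζ) (hζ1 : ζ < 1) :
    ∃ ρ : ℝ, 0 < ρ ∧ psi M T α ρ 1 = Real.log (1 - ζ) := by
  have hlog : Real.log (1 - ζ) < 0 := Real.log_neg (by linarith) (by linarith)
  have hz0 : 0 < |zq α| := abs_pos.2 (zq_neg hα0 hα1).ne
  -- Chosen so that the upper bound in `psi_le_neg` equals `ln(1-ζ)` at `b`; the intermediate value
  -- theorem then applies on `[0,b]`.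
  set b := -Real.log (1 - ζ) * 2 / |zq α| with hb
  have hb0 : 0 < b := div_pos (by linarith) hz0
  have h1 : psi M T α b 1 ≤ Real.log (1 - ζ) := by
    refine (psi_le_neg hz hb0).trans_eq ?_
    rw [hb]; field_simp
  obtain ⟨ρ, hρ, he⟩ := intermediate_value_Icc' hb0.le (continuous_psi (M := M) (T := T)
    (α := α)).continuousOn ⟨h1, by simp only [psi_zero]; exact hlog.le⟩
  refine ⟨ρ, lt_of_le_of_ne hρ.1 fun h => ?_, he⟩
  rw [← h] at he
  simp only [psi_zero] at he
  linarith

lemma psi_critical_le_iff (hα0 : 0 < α) (hα1 : α < 1 / 2) (hz : 2 * normL2 T M.θ ≤ |zq α|)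
    {ρ ρ' : ℝ} (hρ : 0 ≤ ρ) (hρ' : 0 ≤ ρ') : psi M T α ρ 1 ≤ psi M T α ρ' 1 ↔ ρ' ≤ ρ :=
  (psi_strictAntiOn hα0 hα1 hz).le_iff_ge hρ hρ'

lemma rhoES_eq (hα0 : 0 < α) (hα1 : α < 1 / 2) (hz : 2 * normL2 T M.θ ≤ |zq α|) {ρ : ℝ}
    (hρ : 0 < ρ) (he : psi M T α ρ 1 = Real.log (1 - ζ)) : rhoES M T α ζ = (ρ : EReal) := by
  have hset : {ρ' : ℝ | 0 < ρ' ∧ Real.log (1 - ζ) ≤ psi M T α ρ' 1} = Ioc 0 ρ := by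
    ext ρ'
    rw [mem_ofPred_eq, mem_Ioc, ← he]
    exact and_congr_right fun h => psi_critical_le_iff hα0 hα1 hz hρ.le h.le
  rw [rhoES, hset, if_pos ⟨ρ, hρ, le_rfl⟩]
  refine le_antisymm (sSup_le ?_) (le_sSup ⟨ρ, ⟨hρ, le_rfl⟩, rfl⟩)
  rintro _ ⟨a, ha, rfl⟩
  exact EReal.coe_le_coe_iff.2 ha.2

end CriticalValue

/-! ### Quantiles and lower tail means of log-normal variables -/

section TailMean

set_option linter.unusedSectionVars false

variable {Ω : Type*} [MeasurableSpace Ω] {P : Measure Ω} [IsProbabilityMeasure P] {α : ℝ}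

/-- Quantile and conditional mean depend on the law alone, so wealth may be replaced by a function
of a standard normal variable. -/
lemma tailMean_congr_map {Ω' : Type*} [MeasurableSpace Ω'] {Q : Measure Ω'} {Z : Ω → ℝ} {h : Ω' → ℝ}
    (hZ : Measurable Z) (hh : Measurable h) (e : P.map Z = Q.map h) :
    tailMean P α Z = tailMean Q α h := by
  have h1 : ∀ l, P {ω | Z ω ≤ l} = Q {ω | h ω ≤ l} := fun l => by
    have := congrArg (fun ν => ν (Iic l)) e
    simp only [Measure.map_apply hZ measurableSet_Iic, Measure.map_apply hh measurableSet_Iic] at this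
    exact this
  have h2 : quantile P α Z = quantile Q α h := by simp only [quantile, h1]
  rw [tailMean, tailMean, h2, ProbabilityTheory.cond, ProbabilityTheory.cond, integral_smul_measure,
    integral_smul_measure, h1]
  congr 1
  have h3 : ∫ ω in {ω | Z ω ≤ quantile Q α h}, Z ω ∂P =
      ∫ z in Iic (quantile Q α h), z ∂(P.map Z) :=
    (setIntegral_map measurableSet_Iic (f := fun z : ℝ => z) (by fun_prop) hZ.aemeasurable).symm
  have h4 : ∫ ω in {ω | h ω ≤ quantile Q α h}, h ω ∂Q =
      ∫ z in Iic (quantile Q α h), z ∂(Q.map h) :=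
    (setIntegral_map measurableSet_Iic (f := fun z : ℝ => z) (by fun_prop) hh.aemeasurable).symm
  rw [h3, h4, e]

lemma tailMean_congr_ae {Z Z' : Ω → ℝ} (hZ : Measurable Z) (hZ' : Measurable Z')
    (h : Z =ᵐ[P] Z') : tailMean P α Z = tailMean P α Z' :=
  tailMean_congr_map hZ hZ' (Measure.map_congr h)

lemma ofReal_cdf_zq (hα0 : 0 < α) (hα1 : α < 1 / 2) :
    gaussianReal 0 1 (Iic (zq α)) = ENNReal.ofReal α := by
  rw [← ofReal_cdf, cdf_zq hα0 (by linarith)]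

/-- The lower tail mean of a log-normal variable. -/
lemma tailMean_lognormal (hα0 : 0 < α) (hα1 : α < 1 / 2) {m s : ℝ} (hm : 0 < m) (hs : 0 ≤ s) :
    tailMean (gaussianReal 0 1) α (fun n => m * Real.exp (s * n - s ^ 2 / 2)) =
      m * Fα α (|zq α| + s) := by
  -- For `s = 0` the variable is constant, and conditioning is on the whole space rather than on an
  -- event of probability `α`. For `s > 0` the function is strictly increasing and the event is `n ≤
  -- z_α`.
  rcases eq_or_lt_of_le hs with h0 | hs
  · subst h0
    have hset : {l : ℝ | 0 ≤ l ∧ ENNReal.ofReal α ≤ gaussianReal 0 1 {_n : ℝ | m ≤ l}} = Ici m := by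
      ext l
      by_cases hl : m ≤ l
      · have : ENNReal.ofReal α ≤ 1 := ENNReal.ofReal_le_one.2 (by linarith)
        simp [hl, this, hm.le.trans hl]
      · simp [hl, hα0]
    have hq : quantile (gaussianReal 0 1) α (fun _ : ℝ => m) = m := by
      rw [quantile, hset, csInf_Ici]
    have hF : Fα α |zq α| = 1 := by rw [Fα_eq, div_self (gaussTail_pos _).ne']
    simp only [zero_mul, ne_eq, OfNat.ofNat_ne_zero, not_false_eq_true, zero_pow, zero_div,
      sub_self, Real.exp_zero, mul_one, add_zero, hF]
    rw [tailMean, hq]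
    simp
  · set h : ℝ → ℝ := fun n => m * Real.exp (s * n - s ^ 2 / 2) with hh
    have hmono : StrictMono h := fun a b hab => by
      simp only [hh]
      have := mul_lt_mul_of_pos_left hab hs
      gcongr
    have hcont : Continuous h := by fun_prop
    have hIic : ∀ n, {a | h a ≤ h n} = Iic n := fun n => by
      ext a; simp [hmono.le_iff_le]
    have hq : quantile (gaussianReal 0 1) α h = h (zq α) := by
      have hset : {l : ℝ | 0 ≤ l ∧ ENNReal.ofReal α ≤ gaussianReal 0 1 {n : ℝ | h n ≤ l}} =
          Ici (h (zq α)) := by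
        ext l
        rw [mem_ofPred_eq, mem_Ici]
        constructor
        · rintro ⟨hl0, hl⟩
          by_contra hcon
          rw [not_le] at hcon
          -- The level `l = 0` is not a value of `h`, so it cannot be inverted by the logarithm; its
          -- sublevel set is empty.
          rcases eq_or_lt_of_le hl0 with h0 | hl0
          · subst h0
            have : {n : ℝ | h n ≤ 0} = ∅ := by
              ext n
              simpa using mul_pos hm (Real.exp_pos _)
            rw [this, measure_empty, nonpos_iff_eq_zero, ENNReal.ofReal_eq_zero] at hl
            linarith
          · have hn : h ((Real.log (l / m) + s ^ 2 / 2) / s) = l := by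
              simp only [hh]
              rw [mul_div_cancel₀ _ hs.ne', add_sub_cancel_right, Real.exp_log (div_pos hl0 hm)]
              field_simp
            rw [← hn] at hl hcon
            rw [hIic, ← ofReal_cdf, ENNReal.ofReal_le_ofReal_iff (cdf_nonneg _ _)] at hl
            have h2 := cdf_strictMono (hmono.lt_iff_lt.1 hcon)
            rw [cdf_zq hα0 (by linarith)] at h2
            linarith
        · intro hl
          refine ⟨(mul_pos hm (Real.exp_pos _)).le.trans hl, ?_⟩
          rw [← ofReal_cdf_zq hα0 hα1, ← hIic]
          exact measure_mono fun n hn => le_trans hn hl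
      rw [quantile, hset, csInf_Ici]
    rw [tailMean, hq, hIic, ProbabilityTheory.cond, integral_smul_measure,
      ofReal_cdf_zq hα0 hα1]
    simp only [hh]
    rw [integral_const_mul, setIntegral_exp_gaussianReal, ENNReal.toReal_inv,
      ENNReal.toReal_ofReal hα0.le, Fα_eq, smul_eq_mul, abs_of_neg (zq_neg hα0 hα1)]
    have h1 := inv_mul_gaussTail_abs_zq hα0 hα1
    rw [abs_of_neg (zq_neg hα0 hα1)] at h1
    have h2 := gaussTail_pos (-zq α)
    nth_rewrite 1 [← h1]
    rw [mul_inv, inv_inv]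
    have h3 := sqrt_two_pi_pos
    rw [show s - zq α = -zq α + s by ring]
    field_simp

end TailMean

/-! ### The risk constraint as a deterministic inequality -/

section Risk

set_option linter.unusedSectionVars false

variable {Ω : Type*} [MeasurableSpace Ω] {P : Measure Ω} [IsProbabilityMeasure P] {d : ℕ}
  {W : Fin d → ℝ≥0 → Ω → ℝ} {M : Market d} {T x : ℝ} {c : Control d} {α ζ : ℝ}

lemma integral_cutoff_norm_sq {y : ℝ → EuclideanSpace ℝ (Fin d)} {t : ℝ} (ht : t ∈ Icc 0 T) :
    ∫ s in (0 : ℝ)..t, ‖cutoff T y s‖ ^ 2 = ∫ s in (0 : ℝ)..t, ‖y s‖ ^ 2 := by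
  refine intervalIntegral.integral_congr fun s hs => ?_
  rw [uIcc_of_le ht.1] at hs
  simp only [cutoff_of_mem ⟨hs.1, hs.2.trans ht.2⟩]

lemma normL2_sq {y : ℝ → EuclideanSpace ℝ (Fin d)} {t : ℝ} (ht : 0 ≤ t) :
    normL2 t y ^ 2 = ∫ s in (0 : ℝ)..t, ‖y s‖ ^ 2 :=
  Real.sq_sqrt (intervalIntegral.integral_nonneg ht fun _ _ => sq_nonneg _)

lemma map_expMart (hW : IsStdBrownian W P) {y : ℝ → EuclideanSpace ℝ (Fin d)}
    (hy : SqIntegrable T y) {t : ℝ} (ht : t ∈ Icc 0 T) (m : ℝ) :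
    P.map (fun ω => m * expMart hW (cutoff T y) t ω) = (gaussianReal 0 1).map
      (fun n => m * Real.exp (normL2 t y * n - normL2 t y ^ 2 / 2)) := by
  have hmem := memLp_indicator (memLp_cutoff hy) 0 t
  have h1 := map_wiener hW hmem
  have h2 : (gaussianReal 0 1).map (fun n => normL2 t y * n) =
      P.map (wiener hW ((Ioc 0 t).indicator (cutoff T y))) := by
    rw [h1, gaussianReal_map_const_mul, integral_norm_indicator_sq le_rfl ht.1,
      integral_cutoff_norm_sq ht, ← normL2_sq ht.1]
    congr 1
    · simp
    · ext; simp [sq_nonneg]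
  have h3 : (fun ω => m * expMart hW (cutoff T y) t ω) =
      (fun z => m * Real.exp (z - normL2 t y ^ 2 / 2)) ∘
        wiener hW ((Ioc 0 t).indicator (cutoff T y)) := by
    ext ω
    simp only [Function.comp_apply, expMart, integral_cutoff_norm_sq ht, normL2_sq ht.1]
  rw [h3, ← Measure.map_map (by fun_prop) (measurable_wiener hW _), ← h2,
    Measure.map_map (by fun_prop) (by fun_prop)]
  rfl

lemma IsWealth.tailMean_eq (hW : IsStdBrownian W P) (hT : 0 < T) (hθ : SqIntegrable T M.θ)
    (hx : 0 < x) (hα0 : 0 < α) (hα1 : α < 1 / 2) (hc : c.IsAdmissible T) {X : ℝ → Ω → ℝ}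
    (hX : IsWealth W P M T x c X) {t : ℝ} (ht : t ∈ Icc 0 T) :
    tailMean P α (X t) = meanWealth M x c t * Fα α (|zq α| + normL2 t c.y) := by
  rw [tailMean_congr_ae ((hX.adapted t ht).mono (filtW_le hW t) le_rfl)
      ((measurable_expMart hW t).const_mul _) (hX.ae_eq hW hT hθ hx hc ht),
    tailMean_congr_map ((measurable_expMart hW t).const_mul _) (by fun_prop)
      (map_expMart hW hc.sq_integrable ht _),
    tailMean_lognormal hα0 hα1 (meanWealth_pos hx t) (normL2_nonneg _ _)]

lemma integral_drift (hT : 0 ≤ T) (hθ : SqIntegrable T M.θ) (hc : c.IsAdmissible T) {t : ℝ}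
    (ht : t ∈ Icc 0 T) : ∫ s in (0 : ℝ)..t, drift M c s =
      M.R t - (∫ s in (0 : ℝ)..t, c.v s) + ∫ s in (0 : ℝ)..t, inner ℝ (c.y s) (M.θ s) := by
  have hsub : uIcc 0 t ⊆ uIcc 0 T := by
    rw [uIcc_of_le hT, uIcc_of_le ht.1]; exact Icc_subset_Icc_right ht.2
  have h1 := (intervalIntegrable_of_Icc hT (M.cadlag_r.integrableOn T)).mono_set hsub
  have h2 := (intervalIntegrable_of_Icc hT hc.integrable).mono_set hsub
  have h3 := (intervalIntegrable_inner hT hc.sq_integrable hθ).mono_set hsub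
  simp only [drift]
  rw [intervalIntegral.integral_add (h1.sub h2) h3, intervalIntegral.integral_sub h1 h2, Market.R]

/-- The risk bound at time `t`, on the logarithmic scale. -/
def LogRiskBound (M : Market d) (α ζ : ℝ) (c : Control d) (t : ℝ) : Prop :=
  Real.log (1 - ζ) ≤ -(∫ s in (0 : ℝ)..t, c.v s) + (∫ s in (0 : ℝ)..t, inner ℝ (c.y s) (M.θ s)) +
    Real.log (Fα α (|zq α| + normL2 t c.y))

/-- The factor `x exp(R_t)` is common to wealth, benchmark and level, so it cancels; taking
logarithms leaves the stated bound. -/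
lemma IsWealth.satisfiesES_iff (hW : IsStdBrownian W P) (hT : 0 < T) (hθ : SqIntegrable T M.θ)
    (hx : 0 < x) (hα0 : 0 < α) (hα1 : α < 1 / 2) (hζ0 : 0 < ζ) (hζ1 : ζ < 1)
    (hc : c.IsAdmissible T) {X : ℝ → Ω → ℝ} (hX : IsWealth W P M T x c X) :
    SatisfiesES P M T x α ζ X ↔ ∀ t ∈ Icc 0 T, LogRiskBound M α ζ c t := by
  refine forall₂_congr fun t ht => ?_
  have hE := Real.exp_pos (M.R t)
  have hl : 0 < level M x ζ t := mul_pos (mul_pos hζ0 hx) hE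
  rw [div_le_one hl, ES, hX.tailMean_eq hW hT hθ hx hα0 hα1 hc ht, meanWealth,
    integral_drift hT.le hθ hc ht, level, LogRiskBound]
  set V := ∫ s in (0 : ℝ)..t, c.v s
  set Q := ∫ s in (0 : ℝ)..t, inner ℝ (c.y s) (M.θ s)
  have hF := Fα_pos α (|zq α| + normL2 t c.y)
  have e : Real.exp (M.R t - V + Q) = Real.exp (M.R t) * Real.exp (-V + Q) := by
    rw [← Real.exp_add]; ring_nf
  have h1 : Real.log (1 - ζ) ≤ -V + Q + Real.log (Fα α (|zq α| + normL2 t c.y)) ↔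
      1 - ζ ≤ Real.exp (-V + Q) * Fα α (|zq α| + normL2 t c.y) := by
    rw [← Real.log_le_log_iff (by linarith) (mul_pos (Real.exp_pos _) hF),
      Real.log_mul (Real.exp_pos _).ne' hF.ne', Real.log_exp]
  have h2 := mul_le_mul_iff_right₀ (mul_pos hx hE) (b := 1 - ζ)
    (c := Real.exp (-V + Q) * Fα α (|zq α| + normL2 t c.y))
  rw [h1, e, ← h2]
  constructor <;> intro h <;> linarith

end Risk

/-! ### The cost in terms of mean wealth -/

section Cost

set_option linter.unusedSectionVars false

variable {Ω : Type*} [MeasurableSpace Ω] {P : Measure Ω} [IsProbabilityMeasure P] {d : ℕ}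
  {W : Fin d → ℝ≥0 → Ω → ℝ} {M : Market d} {T x : ℝ} {c : Control d}

/-- The cost of a control in terms of its mean wealth. -/
def meanCost (M : Market d) (T x : ℝ) (c : Control d) : ℝ :=
  (∫ t in (0 : ℝ)..T, c.v t * meanWealth M x c t) + meanWealth M x c T

lemma intervalIntegrable_mul_meanWealth (hT : 0 ≤ T) (hθ : SqIntegrable T M.θ)
    (hc : c.IsAdmissible T) :
    IntervalIntegrable (fun t => c.v t * meanWealth M x c t) volume 0 T :=
  (intervalIntegrable_of_Icc hT hc.integrable).mul_continuousOn (by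
    rw [uIcc_of_le hT]; exact (isPrimitive_meanWealth hT hθ hc).continuousOn hT)

lemma IsWealth.lintegral_eq (hW : IsStdBrownian W P) (hT : 0 < T) (hθ : SqIntegrable T M.θ)
    (hx : 0 < x) (hc : c.IsAdmissible T) {X : ℝ → Ω → ℝ} (hX : IsWealth W P M T x c X) {t : ℝ}
    (ht : t ∈ Icc 0 T) :
    ∫⁻ ω, ENNReal.ofReal (X t ω) ∂P = ENNReal.ofReal (meanWealth M x c t) := by
  have hy := memLp_cutoff hc.sq_integrable
  refine (lintegral_congr_ae (g := fun ω =>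
    ENNReal.ofReal (meanWealth M x c t * expMart hW (cutoff T c.y) t ω)) ?_).trans ?_
  · filter_upwards [hX.ae_eq hW hT hθ hx hc ht] with ω h
    rw [h]
  have hi : Integrable (fun ω => meanWealth M x c t * expMart hW (cutoff T c.y) t ω) P :=
    ((memLp_expMart hW hy t).integrable (by norm_num)).const_mul _
  have h := ofReal_integral_eq_lintegral_ofReal hi (ae_of_all _ fun ω =>
    (mul_pos (meanWealth_pos hx t) (Real.exp_pos _)).le)
  rw [integral_const_mul, integral_expMart hW hy ht.1, mul_one] at h
  exact h.symm

/-- Tonelli's theorem and `E X_t = m_t`. The exchange of integrals is made for the jointly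
measurable modification. -/
theorem IsWealth.cost_eq (hW : IsStdBrownian W P) (hT : 0 < T) (hθ : SqIntegrable T M.θ)
    (hx : 0 < x) (hc : c.IsAdmissible T) {X : ℝ → Ω → ℝ} (hX : IsWealth W P M T x c X) :
    cost P T 1 1 c X = ENNReal.ofReal (meanCost M T x c) := by
  obtain ⟨X', hX', hae⟩ := hX.exists_modification hW hT
  have hTm : T ∈ Icc 0 T := ⟨hT.le, le_rfl⟩
  have e1 : cost P T 1 1 c X = ∫⁻ ω, ((∫⁻ t in Icc 0 T, ENNReal.ofReal (c.v t * X' t ω)) +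
      ENNReal.ofReal (X' T ω)) ∂P := by
    rw [cost]
    refine lintegral_congr_ae ?_
    filter_upwards [hae] with ω h
    simp only [ENNReal.rpow_one]
    rw [h T hTm]
    congr 1
    refine setLIntegral_congr_fun measurableSet_Icc fun t ht => ?_
    simp only [h t ht]
  have hm : AEMeasurable (Function.uncurry fun (t : ℝ) (ω : Ω) => ENNReal.ofReal (c.v t * X' t ω))
      ((volume.restrict (Icc 0 T)).prod P) :=
    (AEMeasurable.mul hc.integrable.1.comp_fst.aemeasurable
      hX'.measurable.aemeasurable).ennreal_ofReal
  have hXT : Measurable (X' T) := hX'.measurable.comp measurable_prodMk_left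
  have hmt : ∀ t ∈ Icc 0 T, ∫⁻ ω, ENNReal.ofReal (X' t ω) ∂P =
      ENNReal.ofReal (meanWealth M x c t) := fun t ht => by
    rw [← hX.lintegral_eq hW hT hθ hx hc ht]
    exact lintegral_congr_ae (hae.mono fun ω h => by simp only [h t ht])
  have hi := intervalIntegrable_mul_meanWealth (x := x) hT.le hθ hc
  have hnn : ∀ t ∈ Icc 0 T, 0 ≤ c.v t * meanWealth M x c t := fun t ht =>
    mul_nonneg (hc.nonneg t ht) (meanWealth_pos hx t).le
  rw [e1, lintegral_add_right _ hXT.ennreal_ofReal, hmt T hTm,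
    ← lintegral_lintegral_swap hm, meanCost,
    ENNReal.ofReal_add (intervalIntegral.integral_nonneg hT.le hnn) (meanWealth_pos hx T).le]
  congr 1
  rw [intervalIntegral.integral_of_le hT.le, ← integral_Icc_eq_integral_Ioc,
    ofReal_integral_eq_lintegral_ofReal]
  · refine setLIntegral_congr_fun measurableSet_Icc fun t ht => ?_
    simp only [ENNReal.ofReal_mul (hc.nonneg t ht)]
    have hmX : Measurable (X' t) := hX'.measurable.comp measurable_prodMk_left
    rw [lintegral_const_mul _ hmX.ennreal_ofReal, hmt t ht]
  · exact (intervalIntegrable_iff_integrableOn_Icc_of_le hT.le).1 hi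
  · filter_upwards [ae_restrict_mem measurableSet_Icc] with t ht using hnn t ht

end Cost

/-! ### The deterministic optimization problem -/

section Optimization

variable {d : ℕ} {M : Market d} {T t x α ζ ρ : ℝ} {c : Control d}

lemma SqIntegrable.mono {f : ℝ → EuclideanSpace ℝ (Fin d)} (hf : SqIntegrable T f) (ht : t ≤ T) :
    SqIntegrable t f :=
  hf.mono_measure (Measure.restrict_mono (Icc_subset_Icc_right ht) le_rfl)

lemma SqIntegrable.intervalIntegrable {f : ℝ → EuclideanSpace ℝ (Fin d)} (hf : SqIntegrable t f)
    (ht : 0 ≤ t) : IntervalIntegrable (fun s => ‖f s‖ ^ 2) volume 0 t :=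
  intervalIntegrable_of_Icc ht ((memLp_two_iff_integrable_sq_norm hf.1).1 hf)

lemma integral_norm_sub_smul_sq {f g : ℝ → EuclideanSpace ℝ (Fin d)} (ht : 0 ≤ t)
    (hf : SqIntegrable t f) (hg : SqIntegrable t g) (l : ℝ) :
    ∫ s in (0 : ℝ)..t, ‖f s - l • g s‖ ^ 2 = normL2 t f ^ 2 -
      2 * l * (∫ s in (0 : ℝ)..t, inner ℝ (f s) (g s)) + l ^ 2 * normL2 t g ^ 2 := by
  have h1 := hf.intervalIntegrable ht
  have h2 := hg.intervalIntegrable ht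
  have h3 := intervalIntegrable_inner ht hf hg
  have e : ∀ s, ‖f s - l • g s‖ ^ 2 =
      ‖f s‖ ^ 2 - 2 * l * inner ℝ (f s) (g s) + l ^ 2 * ‖g s‖ ^ 2 := fun s => by
    rw [norm_sub_sq_real, real_inner_smul_right, norm_smul, mul_pow, Real.norm_eq_abs, sq_abs]
    ring
  simp only [e]
  rw [intervalIntegral.integral_add (h1.sub (h3.const_mul _)) (h2.const_mul _),
    intervalIntegral.integral_sub h1 (h3.const_mul _), intervalIntegral.integral_const_mul,
    intervalIntegral.integral_const_mul, normL2_sq ht, normL2_sq ht]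

lemma abs_integral_inner_le {f g : ℝ → EuclideanSpace ℝ (Fin d)} (ht : 0 ≤ t)
    (hf : SqIntegrable t f) (hg : SqIntegrable t g) :
    |∫ s in (0 : ℝ)..t, inner ℝ (f s) (g s)| ≤ normL2 t f * normL2 t g := by
  set Q := ∫ s in (0 : ℝ)..t, inner ℝ (f s) (g s) with hQ
  have h : ∀ l : ℝ, 0 ≤ normL2 t g ^ 2 * (l * l) + -2 * Q * l + normL2 t f ^ 2 := fun l => by
    have h1 : 0 ≤ ∫ s in (0 : ℝ)..t, ‖f s - l • g s‖ ^ 2 :=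
      intervalIntegral.integral_nonneg ht fun _ _ => sq_nonneg _
    rw [integral_norm_sub_smul_sq ht hf hg l] at h1
    linarith
  have h2 := discrim_le_zero h
  rw [discrim] at h2
  refine abs_le_of_sq_le_sq ?_ (mul_nonneg (normL2_nonneg _ _) (normL2_nonneg _ _))
  nlinarith

lemma normL2_mono {f : ℝ → EuclideanSpace ℝ (Fin d)} (hf : SqIntegrable T f) (ht : t ∈ Icc 0 T) :
    normL2 t f ≤ normL2 T f :=
  Real.sqrt_le_sqrt (intervalIntegral.integral_mono_interval le_rfl ht.1 ht.2
    (ae_of_all _ fun _ => sq_nonneg _) (hf.intervalIntegrable (ht.1.trans ht.2)))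

lemma integral_v_nonneg (hc : c.IsAdmissible T) (ht : t ∈ Icc 0 T) :
    0 ≤ ∫ s in (0 : ℝ)..t, c.v s :=
  intervalIntegral.integral_nonneg ht.1 fun s hs => hc.nonneg s ⟨hs.1, hs.2.trans ht.2⟩

/-- Discarding consumption and applying Cauchy-Schwarz turns the bound into `ψ(ρ,1) ≤ ψ(‖y‖_t,1)`;
strict monotonicity of `ψ(·,1)` inverts it. -/
lemma normL2_le_of_logRiskBound (hα0 : 0 < α) (hα1 : α < 1 / 2)
    (hz : 2 * normL2 T M.θ ≤ |zq α|) (hρ : 0 < ρ) (he : psi M T α ρ 1 = Real.log (1 - ζ))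
    (hθ : SqIntegrable T M.θ) (hc : c.IsAdmissible T) (ht : t ∈ Icc 0 T)
    (h : LogRiskBound M α ζ c t) : normL2 t c.y ≤ ρ := by
  rw [← psi_critical_le_iff hα0 hα1 hz hρ.le (normL2_nonneg _ _), he]
  have h1 := (le_abs_self _).trans
    (abs_integral_inner_le ht.1 (hc.sq_integrable.mono ht.2) (hθ.mono ht.2))
  have h2 := mul_le_mul_of_nonneg_left (normL2_mono hθ ht) (normL2_nonneg t c.y)
  have h3 := integral_v_nonneg hc ht
  rw [LogRiskBound] at h
  simp only [psi, one_pow, mul_one]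
  linarith

lemma integral_inner_le_of_logRiskBound (hα0 : 0 < α) (hα1 : α < 1 / 2)
    (hz : 2 * normL2 T M.θ ≤ |zq α|) (hρ : 0 < ρ) (he : psi M T α ρ 1 = Real.log (1 - ζ))
    (hθ : SqIntegrable T M.θ) (hc : c.IsAdmissible T) (ht : t ∈ Icc 0 T)
    (h : LogRiskBound M α ζ c t) :
    ∫ s in (0 : ℝ)..t, inner ℝ (c.y s) (M.θ s) ≤ ρ * normL2 T M.θ :=
  (le_abs_self _).trans
    ((abs_integral_inner_le ht.1 (hc.sq_integrable.mono ht.2) (hθ.mono ht.2)).trans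
    (mul_le_mul (normL2_le_of_logRiskBound hα0 hα1 hz hρ he hθ hc ht h) (normL2_mono hθ ht)
      (normL2_nonneg _ _) hρ.le))

lemma R_mono (hr : ∀ t ∈ Icc 0 T, 0 ≤ M.r t) (ht : t ∈ Icc 0 T) : M.R t ≤ M.R T :=
  intervalIntegral.integral_mono_interval le_rfl ht.1 ht.2
    ((ae_restrict_iff' measurableSet_Ioc).2 (ae_of_all _ fun s hs => hr s ⟨hs.1.le, hs.2⟩))
    (intervalIntegrable_of_Icc (ht.1.trans ht.2) (M.cadlag_r.integrableOn T))

lemma isPrimitive_exp_neg (hT : 0 ≤ T) (hc : c.IsAdmissible T) :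
    IsPrimitive T (fun t => Real.exp (-∫ s in (0 : ℝ)..t, c.v s))
      (fun t => Real.exp (-∫ s in (0 : ℝ)..t, c.v s) * -c.v t) := by
  simpa using! (IsPrimitive.of_intervalIntegrable
    (intervalIntegrable_of_Icc hT hc.integrable) 0).neg.exp hT

/-- If the mean wealth is bounded by `B e^{-V_t}`, the cost is at most `B`, and equality forces
equality at time `T`. -/
lemma meanCost_le_of_le (hT : 0 ≤ T) (hθ : SqIntegrable T M.θ) (hc : c.IsAdmissible T) {B : ℝ}
    (h : ∀ t ∈ Icc 0 T, meanWealth M x c t ≤ B * Real.exp (-∫ s in (0 : ℝ)..t, c.v s)) :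
    meanCost M T x c ≤ B ∧
      (B ≤ meanCost M T x c →
        meanWealth M x c T = B * Real.exp (-∫ s in (0 : ℝ)..T, c.v s)) := by
  have h0 := isPrimitive_exp_neg hT hc
  have hTm : T ∈ Icc 0 T := ⟨hT, le_rfl⟩
  have e := h0.eq_add_integral T hTm
  simp only [intervalIntegral.integral_same, neg_zero, Real.exp_zero] at e
  have h1 : ∫ t in (0 : ℝ)..T, c.v t * meanWealth M x c t ≤
      ∫ t in (0 : ℝ)..T, -B * (Real.exp (-∫ s in (0 : ℝ)..t, c.v s) * -c.v t) := by
    refine intervalIntegral.integral_mono_on hT (intervalIntegrable_mul_meanWealth hT hθ hc)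
      (h0.intervalIntegrable.const_mul _) fun t ht => ?_
    have := mul_le_mul_of_nonneg_left (h t ht) (hc.nonneg t ht)
    linarith
  rw [intervalIntegral.integral_const_mul] at h1
  have h2 := h T hTm
  -- Since `∫ v exp(-∫v) = 1 - exp(-∫_0^T v)`, the bounds for consumption and terminal wealth add up
  -- to exactly `B`; attaining `B` makes both of them equalities.
  have e' : B * Real.exp (-∫ s in (0 : ℝ)..T, c.v s) =
      B + B * ∫ t in (0 : ℝ)..T, Real.exp (-∫ s in (0 : ℝ)..t, c.v s) * -c.v t := by
    rw [e]; ring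
  rw [meanCost]
  exact ⟨by linarith, fun h3 => by linarith⟩

lemma meanWealth_eq (hT : 0 ≤ T) (hθ : SqIntegrable T M.θ) (hc : c.IsAdmissible T)
    (ht : t ∈ Icc 0 T) : meanWealth M x c t =
      x * Real.exp (M.R t + ∫ s in (0 : ℝ)..t, inner ℝ (c.y s) (M.θ s)) *
        Real.exp (-∫ s in (0 : ℝ)..t, c.v s) := by
  rw [meanWealth, integral_drift hT hθ hc ht, mul_assoc, ← Real.exp_add]
  ring_nf

lemma meanWealth_le (hα0 : 0 < α) (hα1 : α < 1 / 2) (hz : 2 * normL2 T M.θ ≤ |zq α|)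
    (hρ : 0 < ρ) (he : psi M T α ρ 1 = Real.log (1 - ζ)) (hx : 0 < x)
    (hr : ∀ t ∈ Icc 0 T, 0 ≤ M.r t) (hθ : SqIntegrable T M.θ) (hc : c.IsAdmissible T)
    (ht : t ∈ Icc 0 T) (h : LogRiskBound M α ζ c t) :
    meanWealth M x c t ≤ x * Real.exp (ρ * normL2 T M.θ + M.R T) *
      Real.exp (-∫ s in (0 : ℝ)..t, c.v s) := by
  rw [meanWealth_eq (ht.1.trans ht.2) hθ hc ht]
  have h1 := integral_inner_le_of_logRiskBound hα0 hα1 hz hρ he hθ hc ht h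
  have h2 := R_mono hr ht
  exact mul_le_mul_of_nonneg_right
    (mul_le_mul_of_nonneg_left (Real.exp_le_exp.2 (by linarith)) hx.le) (Real.exp_pos _).le

theorem meanCost_le (hα0 : 0 < α) (hα1 : α < 1 / 2) (hz : 2 * normL2 T M.θ ≤ |zq α|)
    (hρ : 0 < ρ) (he : psi M T α ρ 1 = Real.log (1 - ζ)) (hx : 0 < x) (hT : 0 ≤ T)
    (hr : ∀ t ∈ Icc 0 T, 0 ≤ M.r t) (hθ : SqIntegrable T M.θ) (hc : c.IsAdmissible T)
    (h : ∀ t ∈ Icc 0 T, LogRiskBound M α ζ c t) :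
    meanCost M T x c ≤ x * Real.exp (ρ * normL2 T M.θ + M.R T) :=
  (meanCost_le_of_le hT hθ hc fun t ht =>
    meanWealth_le hα0 hα1 hz hρ he hx hr hθ hc ht (h t ht)).1

/-- A control attaining the upper bound for the cost coincides almost everywhere with the
control in the direction of `θ`. -/
theorem ae_eq_of_le_meanCost (hα0 : 0 < α) (hα1 : α < 1 / 2) (hz : 2 * normL2 T M.θ ≤ |zq α|)
    (hρ : 0 < ρ) (he : psi M T α ρ 1 = Real.log (1 - ζ)) (hx : 0 < x) (hT : 0 ≤ T)
    (hr : ∀ t ∈ Icc 0 T, 0 ≤ M.r t) (hθ : SqIntegrable T M.θ) (hθ0 : 0 < normL2 T M.θ)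
    (hc : c.IsAdmissible T) (h : ∀ t ∈ Icc 0 T, LogRiskBound M α ζ c t)
    (hle : x * Real.exp (ρ * normL2 T M.θ + M.R T) ≤ meanCost M T x c) :
    c.y =ᵐ[volume.restrict (Icc 0 T)] (starControl M T ρ).y ∧
      c.v =ᵐ[volume.restrict (Icc 0 T)] fun _ => 0 := by
  have hTm : T ∈ Icc 0 T := ⟨hT, le_rfl⟩
  have h1 := (meanCost_le_of_le hT hθ hc fun t ht =>
    meanWealth_le hα0 hα1 hz hρ he hx hr hθ hc ht (h t ht)).2 hle
  rw [meanWealth_eq hT hθ hc hTm, mul_left_inj' (Real.exp_pos _).ne', mul_right_inj' hx.ne',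
    Real.exp_eq_exp] at h1
  set n := normL2 T M.θ with hn
  have hQ : ∫ s in (0 : ℝ)..T, inner ℝ (c.y s) (M.θ s) = ρ * n := by linarith
  have hk := normL2_le_of_logRiskBound hα0 hα1 hz hρ he hθ hc hTm (h T hTm)
  have hCS := (le_abs_self _).trans (abs_integral_inner_le hT hc.sq_integrable hθ)
  rw [hQ, ← hn] at hCS
  -- Cauchy-Schwarz gives `ρ‖θ‖ ≤ ‖y‖‖θ‖`; dividing by `‖θ‖ > 0` complements `‖y‖ ≤ ρ`.
  have hkρ : normL2 T c.y = ρ := le_antisymm hk (le_of_mul_le_mul_right hCS hθ0)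
  constructor
  -- The squared distance of `y` from `(ρ/‖θ‖) θ` expands to `ρ² - 2ρ² + ρ² = 0`.
  · have h2 := integral_norm_sub_smul_sq hT hc.sq_integrable hθ (ρ / n)
    rw [hQ, hkρ, ← hn] at h2
    have h3 : ρ ^ 2 - 2 * (ρ / n) * (ρ * n) + (ρ / n) ^ 2 * n ^ 2 = 0 := by
      field_simp; ring
    have hm : MemLp (fun s => c.y s - (ρ / n) • M.θ s) 2 (volume.restrict (Icc 0 T)) :=
      MemLp.sub hc.sq_integrable (MemLp.const_smul hθ (ρ / n))
    rw [h3, intervalIntegral.integral_of_le hT, ← integral_Icc_eq_integral_Ioc,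
      integral_eq_zero_iff_of_nonneg (fun _ => sq_nonneg _)
        ((memLp_two_iff_integrable_sq_norm hm.1).1 hm)] at h2
    filter_upwards [h2] with s hs
    have h4 : ‖c.y s - (ρ / n) • M.θ s‖ ^ 2 = 0 := hs
    rw [pow_eq_zero_iff two_ne_zero, norm_eq_zero, sub_eq_zero] at h4
    exact h4
  -- The bound at `T` now reads `ln(1-ζ) ≤ -∫ v + ln(1-ζ)`, which forces the nonnegative `v` to have
  -- zero integral.
  · have h2 := h T hTm
    rw [LogRiskBound, hQ, hkρ, ← he] at h2
    simp only [psi, one_pow, mul_one, ← hn] at h2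
    have h3 : ∫ s in (0 : ℝ)..T, c.v s = 0 :=
      le_antisymm (by linarith) (integral_v_nonneg hc hTm)
    rw [intervalIntegral.integral_of_le hT, ← integral_Icc_eq_integral_Ioc,
      setIntegral_eq_zero_iff_of_nonneg_ae ?_ hc.integrable] at h3
    · exact h3
    · filter_upwards [ae_restrict_mem measurableSet_Icc] with s hs using hc.nonneg s hs

lemma normL2_smul (hT : 0 ≤ T) {f : ℝ → EuclideanSpace ℝ (Fin d)} {k : ℝ} (hk : 0 ≤ k) :
    normL2 T (fun s => k • f s) = k * normL2 T f := by
  rw [← Real.sqrt_sq (mul_nonneg hk (normL2_nonneg T f)), normL2, mul_pow, normL2_sq hT,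
    ← intervalIntegral.integral_const_mul]
  simp only [norm_smul, mul_pow, Real.norm_eq_abs, sq_abs]

lemma starControl_isAdmissible (hθ : SqIntegrable T M.θ) : (starControl M T ρ).IsAdmissible T :=
  ⟨MemLp.const_smul hθ (ρ / normL2 T M.θ), integrableOn_zero, fun _ _ => le_rfl⟩

/-- With `u = ‖θ‖_t/‖θ‖_T` the bound at time `t` is precisely `ln(1-ζ) ≤ ψ(ρ,u)`, and `u ≤ 1` makes
`psi_one_le` applicable. -/
lemma starControl_logRiskBound (hz : 2 * normL2 T M.θ ≤ |zq α|) (hρ : 0 < ρ)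
    (he : psi M T α ρ 1 = Real.log (1 - ζ)) (hθ : SqIntegrable T M.θ) (hθ0 : 0 < normL2 T M.θ)
    (ht : t ∈ Icc 0 T) : LogRiskBound M α ζ (starControl M T ρ) t := by
  have hu1 : normL2 t M.θ / normL2 T M.θ ≤ 1 := (div_le_one hθ0).2 (normL2_mono hθ ht)
  have h := psi_one_le hz hρ.le (div_nonneg (normL2_nonneg t M.θ) hθ0.le) hu1
  rw [he, psi] at h
  rw [LogRiskBound]
  simp only [starControl, real_inner_smul_left, real_inner_self_eq_norm_sq]
  rw [normL2_smul ht.1 (div_nonneg hρ.le hθ0.le), intervalIntegral.integral_const_mul,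
    ← normL2_sq ht.1, intervalIntegral.integral_zero]
  have e1 : ρ / normL2 T M.θ * normL2 t M.θ = ρ * (normL2 t M.θ / normL2 T M.θ) := by ring
  have e2 : ρ / normL2 T M.θ * normL2 t M.θ ^ 2 =
      normL2 T M.θ * ρ * (normL2 t M.θ / normL2 T M.θ) ^ 2 := by
    field_simp
  rw [e1, e2]
  linarith

lemma meanCost_of_v_eq_zero {y : ℝ → EuclideanSpace ℝ (Fin d)} (hT : 0 ≤ T)
    (hθ : SqIntegrable T M.θ) (hy : SqIntegrable T y) :
    meanCost M T x ⟨y, fun _ => 0⟩ =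
      x * Real.exp ((∫ s in (0 : ℝ)..T, inner ℝ (y s) (M.θ s)) + M.R T) := by
  have hc : (⟨y, fun _ => 0⟩ : Control d).IsAdmissible T :=
    ⟨hy, integrableOn_zero, fun _ _ => le_rfl⟩
  rw [meanCost, meanWealth_eq hT hθ hc ⟨hT, le_rfl⟩]
  simp [add_comm]

lemma meanCost_starControl (hT : 0 ≤ T) (hθ : SqIntegrable T M.θ) (hθ0 : 0 < normL2 T M.θ) :
    meanCost M T x (starControl M T ρ) = x * Real.exp (ρ * normL2 T M.θ + M.R T) := by
  have h := meanCost_of_v_eq_zero (x := x) hT hθ (hθ.const_smul (ρ / normL2 T M.θ))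
  simp only [Pi.smul_apply, real_inner_smul_left, real_inner_self_eq_norm_sq] at h
  rw [intervalIntegral.integral_const_mul, ← normL2_sq hT] at h
  refine Eq.trans h ?_
  congr 3
  field_simp

/-- When `‖θ‖_T = 0`, Cauchy-Schwarz removes the return term and `ψ(ρ,1)` is the logarithm of the
tail alone, which decreases in the norm of `y`. -/
lemma logRiskBound_of_normL2_le (hρ : psi M T α ρ 1 = Real.log (1 - ζ))
    (hθ : SqIntegrable T M.θ) (hθ0 : normL2 T M.θ = 0) {y : ℝ → EuclideanSpace ℝ (Fin d)}
    (hy : SqIntegrable T y) (hle : normL2 T y ≤ ρ) (ht : t ∈ Icc 0 T) :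
    LogRiskBound M α ζ ⟨y, fun _ => 0⟩ t := by
  have h1 := abs_integral_inner_le ht.1 (hy.mono ht.2) (hθ.mono ht.2)
  have h2 : normL2 t M.θ = 0 := le_antisymm (hθ0 ▸ normL2_mono hθ ht) (normL2_nonneg _ _)
  rw [h2, mul_zero, abs_nonpos_iff] at h1
  have h3 := log_Fα_antitone α (add_le_add_right ((normL2_mono hy ht).trans hle) |zq α|)
  rw [psi, hθ0] at hρ
  simp only [mul_one, zero_mul, one_pow, zero_add] at hρ
  rw [LogRiskBound, ← hρ]
  simpa [h1] using! h3

lemma ae_toLp_mulVec_eq_iff (k : ℝ) : ∀ᵐ t ∂(volume.restrict (Icc 0 T)), ∀ p : Fin d → ℝ,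
    WithLp.toLp 2 ((M.σ t).transpose.mulVec p) = k • M.θ t ↔
      p = k • (M.σ t * (M.σ t).transpose)⁻¹.mulVec (M.excess t) := by
  filter_upwards [ae_restrict_of_ae_restrict_of_subset Icc_subset_Ici_self M.nonsingular] with t h p
  have h' : IsUnit (M.σ t).transpose.det := by rwa [Matrix.det_transpose]
  rw [Market.θ, ← WithLp.toLp_smul, (WithLp.toLp_injective 2).eq_iff, Matrix.mul_inv_rev,
    ← Matrix.mulVec_mulVec]
  constructor
  · intro e
    rw [← Matrix.mulVec_smul, ← e, Matrix.mulVec_mulVec, Matrix.nonsing_inv_mul _ h', Matrix.one_mulVec]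
  · intro e
    rw [e, Matrix.mulVec_smul, Matrix.mulVec_mulVec, Matrix.mul_nonsing_inv _ h', Matrix.one_mulVec]

end Optimization

/-! ### Optimality and uniqueness -/

section Solution

variable {Ω : Type*} [MeasurableSpace Ω] {P : Measure Ω} [IsProbabilityMeasure P] {d : ℕ}
  {W : Fin d → ℝ≥0 → Ω → ℝ} {M : Market d} {T x α ζ ρ : ℝ} {c : Control d}

/-- An admissible control that satisfies the risk bound and whose cost attains the upper bound
is optimal. -/
theorem isOptimal_of_meanCost_eq (hW : IsStdBrownian W P) (hT : 0 < T)
    (hθ : SqIntegrable T M.θ) (hr : ∀ t ∈ Icc 0 T, 0 ≤ M.r t) (hx : 0 < x) (hζ0 : 0 < ζ)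
    (hζ1 : ζ < 1) (hα0 : 0 < α) (hα1 : α < 1 / 2) (hz : 2 * normL2 T M.θ ≤ |zq α|) (hρ : 0 < ρ)
    (he : psi M T α ρ 1 = Real.log (1 - ζ)) (hc : c.IsAdmissible T)
    (h : ∀ t ∈ Icc 0 T, LogRiskBound M α ζ c t)
    (hB : meanCost M T x c = x * Real.exp (ρ * normL2 T M.θ + M.R T)) :
    IsOptimal W P M T x α ζ 1 1 c where
  admissible := hc
  exists_wealth := (exists_wealth hW hT hθ hx hc).imp fun _ h => h.1
  feasible X hX := (hX.satisfiesES_iff hW hT hθ hx hα0 hα1 hζ0 hζ1 hc).2 h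
  optimal X hX c' hc' X' hX' hS := by
    rw [hX.cost_eq hW hT hθ hx hc, hX'.cost_eq hW hT hθ hx hc', hB]
    exact ENNReal.ofReal_le_ofReal (meanCost_le hα0 hα1 hz hρ he hx hT.le hr hθ hc'
      ((hX'.satisfiesES_iff hW hT hθ hx hα0 hα1 hζ0 hζ1 hc').1 hS))

/-- Any optimal control attains the upper bound and hence is the control in the direction
of `θ`. -/
theorem IsOptimal.ae_eq_starControl (hW : IsStdBrownian W P) (hT : 0 < T)
    (hθ : SqIntegrable T M.θ) (hr : ∀ t ∈ Icc 0 T, 0 ≤ M.r t) (hx : 0 < x) (hζ0 : 0 < ζ)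
    (hζ1 : ζ < 1) (hα0 : 0 < α) (hα1 : α < 1 / 2) (hz : 2 * normL2 T M.θ ≤ |zq α|) (hρ : 0 < ρ)
    (he : psi M T α ρ 1 = Real.log (1 - ζ)) (hθ0 : 0 < normL2 T M.θ)
    (hc : IsOptimal W P M T x α ζ 1 1 c) :
    c.y =ᵐ[volume.restrict (Icc 0 T)] (starControl M T ρ).y ∧
      c.v =ᵐ[volume.restrict (Icc 0 T)] fun _ => 0 := by
  obtain ⟨X, hX⟩ := hc.exists_wealth
  have hs := starControl_isAdmissible (ρ := ρ) hθ
  obtain ⟨Y, hY, -⟩ := ESProblem.exists_wealth hW hT hθ hx hs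
  -- Comparison with the feasible control along `θ` shows that an optimal control reaches the upper
  -- bound, so the equality case applies.
  have h := hc.optimal X hX _ hs Y hY ((hY.satisfiesES_iff hW hT hθ hx hα0 hα1 hζ0 hζ1 hs).2
    fun t ht => starControl_logRiskBound hz hρ he hθ hθ0 ht)
  rw [hX.cost_eq hW hT hθ hx hc.admissible, hY.cost_eq hW hT hθ hx hs,
    meanCost_starControl hT.le hθ hθ0, ENNReal.ofReal_le_ofReal_iff'] at h
  exact ae_eq_of_le_meanCost hα0 hα1 hz hρ he hx hT.le hr hθ hθ0 hc.admissible
    ((hX.satisfiesES_iff hW hT hθ hx hα0 hα1 hζ0 hζ1 hc.admissible).1 (hc.feasible X hX))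
    -- Truncation by `ENNReal.ofReal` could hide the inequality only if the bound were nonpositive.
    (h.resolve_right (mul_pos hx (Real.exp_pos _)).not_ge)

end Solution

end ESProblem

end

open ESProblem
theorem theorem3p16 {Ω : Type*} [MeasurableSpace Ω] (P : Measure Ω) [IsProbabilityMeasure P]
    {d : ℕ} (W : Fin d → ℝ≥0 → Ω → ℝ) (hW : IsStdBrownian W P)
    (M : Market d) (T : ℝ) (hT : 0 < T) (hθ : SqIntegrable T M.θ)
    (hr : ∀ t ∈ Icc 0 T, 0 ≤ M.r t)
    (x : ℝ) (hx : 0 < x) (ζ : ℝ) (hζ0 : 0 < ζ) (hζ1 : ζ < 1)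
    (α : ℝ) (hα0 : 0 < α) (hα1 : α < 1 / 2) (hz : 2 * normL2 T M.θ ≤ |zq α|) :
    (∀ c : Control d, c.IsAdmissible T → ∃ X, IsWealth W P M T x c X) ∧
    ∃ ρ : ℝ, rhoES M T α ζ = (ρ : EReal) ∧ 0 < ρ ∧
      psi M T α ρ 1 = Real.log (1 - ζ) ∧
      (∀ ρ' : ℝ, 0 ≤ ρ' → psi M T α ρ' 1 = Real.log (1 - ζ) → ρ' = ρ) ∧
      (0 < normL2 T M.θ →
        IsOptimal W P M T x α ζ 1 1 (starControl M T ρ) ∧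
        (∀ X, IsWealth W P M T x (starControl M T ρ) X →
          cost P T 1 1 (starControl M T ρ) X =
            ENNReal.ofReal (x * Real.exp (ρ * normL2 T M.θ + M.R T))) ∧
        (∀ᵐ t ∂(volume.restrict (Icc 0 T)), ∀ p : Fin d → ℝ,
          WithLp.toLp 2 ((M.σ t).transpose.mulVec p) = (starControl M T ρ).y t ↔
            p = (ρ / normL2 T M.θ) •
              (M.σ t * (M.σ t).transpose)⁻¹.mulVec (M.excess t)) ∧
        (∀ c : Control d, IsOptimal W P M T x α ζ 1 1 c →
          c.y =ᵐ[volume.restrict (Icc 0 T)] (starControl M T ρ).y ∧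
          c.v =ᵐ[volume.restrict (Icc 0 T)] fun _ => 0)) ∧
      (normL2 T M.θ = 0 →
        ∀ y : ℝ → EuclideanSpace ℝ (Fin d), SqIntegrable T y → normL2 T y ≤ ρ →
          IsOptimal W P M T x α ζ 1 1 ⟨y, fun _ => 0⟩ ∧
          ∀ X, IsWealth W P M T x ⟨y, fun _ => 0⟩ X →
            cost P T 1 1 (⟨y, fun _ => 0⟩ : Control d) X =
              ENNReal.ofReal (x * Real.exp (M.R T))) := by
  refine ⟨fun c hc => (exists_wealth hW hT hθ hx hc).imp fun _ h => h.1, ?_⟩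
  obtain ⟨ρ, hρ, he⟩ := exists_critical (M := M) (T := T) hα0 hα1 hz hζ0 hζ1
  refine ⟨ρ, rhoES_eq hα0 hα1 hz hρ he, hρ, he, fun ρ' h0 h' =>
    (psi_strictAntiOn hα0 hα1 hz).injOn h0 hρ.le (h'.trans he.symm), fun hθ0 => ?_, fun hθ0 => ?_⟩
  · have hs := starControl_isAdmissible (ρ := ρ) hθ
    refine ⟨isOptimal_of_meanCost_eq hW hT hθ hr hx hζ0 hζ1 hα0 hα1 hz hρ he hs
      (fun t ht => starControl_logRiskBound hz hρ he hθ hθ0 ht) (meanCost_starControl hT.le hθ hθ0),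
      fun X hX => ?_, ae_toLp_mulVec_eq_iff _,
      fun c hc => hc.ae_eq_starControl hW hT hθ hr hx hζ0 hζ1 hα0 hα1 hz hρ he hθ0⟩
    rw [hX.cost_eq hW hT hθ hx hs, meanCost_starControl hT.le hθ hθ0]
  · intro y hy hle
    have hc : (⟨y, fun _ => 0⟩ : Control d).IsAdmissible T :=
      ⟨hy, integrableOn_zero, fun _ _ => le_rfl⟩
    have hQ := abs_integral_inner_le hT.le hy hθ
    rw [hθ0, mul_zero, abs_nonpos_iff] at hQ
    have hB := meanCost_of_v_eq_zero (M := M) (x := x) hT.le hθ hy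
    rw [hQ, zero_add] at hB
    refine ⟨isOptimal_of_meanCost_eq hW hT hθ hr hx hζ0 hζ1 hα0 hα1 hz hρ he hc
      (fun t ht => logRiskBound_of_normL2_le he hθ hθ0 hy hle ht) ?_, fun X hX => ?_⟩
    · rw [hB, hθ0, mul_zero, zero_add]
    · rw [hX.cost_eq hW hT hθ hx hc, hB]
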